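/- Throughout, $X$ is a complex Banach space, $\mathcal B(X)$ the algebra of bounded operators and $\mathcal F(X)$ the finite rank operators on $X$. For $Z\in\mathcal B(X)$ let $\sigma(Z)$ be its spectrum and $\rho(Z)=\mathbb C\setminus\sigma(Z)$. The discrete spectrum $\sigma_d(Z)$ consists of the eigenvalues $\lambda$ of $Z$ that are isolated points of $\sigma(Z)$ and have finite algebraic multiplicity, the algebraic multiplicity of an isolated eigenvalue $\lambda$ being the rank of the Riesz projection $\frac1{2\pi i}\oint(\mu-Z)^{-1}d\mu$ over a small circle around $\lambda$. Let $(\lambda_j(Z))$ denote the discrete eigenvalues of $Z$, counted according to algebraic multiplicity. Let $p>0$. For $F\in\mathcal F(X)$ put $\det(I-F):=\det(I_R-F|_R)$ and $\operatorname{tr}F:=\operatorname{tr}(F|_R)$ with $R=\operatorname{Ran}F$, and $${\det}_p(I-F):=\det(I-F)\exp\Big(\sum_{k=1}^{\lceil p\rceil-1}\tfrac1k\operatorname{tr}(F^k)\Big).$$ There is a constant $\Gamma_p>0$, depending only on $p$, such that for every $X$ $$|{\det}_p(I-F)|\le\exp\Big(\Gamma_p\sum_k|\lambda_k(F)|^p\Big)\qquad(F\in\mathcal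 F(X)).\tag{1}$$ An $l_p$-ideal in $\mathcal B(X)$ with eigenvalue constant $\gamma_p$ is a linear subspace $\mathcal I\subset\mathcal B(X)$ with a quasi-norm $\|\cdot\|_{\mathcal I}$ (positive definite, absolutely homogeneous, and $\|L+M\|_{\mathcal I}\le q(\|L\|_{\mathcal I}+\|M\|_{\mathcal I})$ for some $q\ge1$) such that $\mathcal F(X)$ is contained and dense in $(\mathcal I,\|\cdot\|_{\mathcal I})$; $\|L\|\le\|L\|_{\mathcal I}$ for $L\in\mathcal I$; $ALB\in\mathcal I$ and $\|ALB\|_{\mathcal I}\le\|A\|\,\|L\|_{\mathcal I}\|B\|$ for $L\in\mathcal I$, $A,B\in\mathcal B(X)$; and $\big(\sum_j|\lambda_j(L)|^p\big)^{1/p}\le\gamma_p\|L\|_{\mathcal I}$ for $L\in\mathcal I$. **Theorem.** Let $p>0$ and let $(\mathcal I,\|\cdot\|_{\mathcal I})$ be an $l_p$-ideal in $\mathcal B(X)$ with eigenvalue constant $\gamma_p$. Then $F\mapsto\det_p(I-F)$ has a unique continuous extension $L\mapsto\det_{p,\mathcal I}(I-L)$ from $\mathcal F(X)$ to $(\mathcal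 I,\|\cdot\|_{\mathcal I})$. For $A\in\mathcal B(X)$ and $K\in\mathcal I$ the perturbation determinant $$D(\lambda):={\det}_{p,\mathcal I}\big(I-K(\lambda-A)^{-1}\big),\qquad\lambda\in\rho(A),$$ has the following properties. 1. $\lim_{|\lambda|\to\infty}D(\lambda)=1$. 2. $D$ is analytic on $\rho(A)$. 3. $|D(\lambda)|\le\exp\big(\gamma_p^p\,\Gamma_p\,\|K(\lambda-A)^{-1}\|_{\mathcal I}^p\big)$ for $\lambda\in\rho(A)$ and every constant $\Gamma_p>0$ for which (1) holds on $X$. 4. For $\lambda\in\rho(A)$: $D(\lambda)=0$ if and only if $\lambda\in\sigma(A+K)$. 5. If $\lambda_0\in\rho(A)\cap\sigma_d(A+K)$, then the order of $\lambda_0$ as a zero of $D$ equals the algebraic multiplicity of $\lambda_0$ as an eigenvalue of $A+K$. -/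

import Mathlib

open Filter Topology
open scoped ENNReal

universe u

namespace PertDet

noncomputable section

/-! ### Discrete eigenvalues and algebraic multiplicity -/

section Spectral

variable {X : Type u} [NormedAddCommGroup X] [NormedSpace ℂ X]

/-- The closed disc of radius `r` around `z` meets the spectrum of `Z` at most in `z`. -/
def Isolates (Z : X →L[ℂ] X) (z : ℂ) (r : ℝ) : Prop :=
  0 < r ∧ Metric.closedBall z r ∩ spectrum ℂ Z ⊆ {z}

open Classical in
/-- A radius of a circle around `z` that excludes the rest of the spectrum of `Z`
(`0` if there is none). -/
def isolatingRadius (Z : X →L[ℂ] X) (z : ℂ) : ℝ :=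
  if h : ∃ r, Isolates Z z r then h.choose else 0

/-- The Riesz projection `(2πi)⁻¹ ∮ (μ - Z)⁻¹ dμ` over a small circle around `z`. -/
def rieszProjection (Z : X →L[ℂ] X) (z : ℂ) : X →L[ℂ] X :=
  (2 * (Real.pi : ℂ) * Complex.I)⁻¹ • ∮ w in C(z, isolatingRadius Z z), resolvent Z w

/-- A bounded operator of finite rank. -/
def IsFiniteRank (F : X →L[ℂ] X) : Prop :=
  FiniteDimensional ℂ (LinearMap.range (F : X →ₗ[ℂ] X))

/-- The algebraic multiplicity: the rank of the Riesz projection. -/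
def algMult (Z : X →L[ℂ] X) (z : ℂ) : ℕ :=
  Module.finrank ℂ (LinearMap.range (rieszProjection Z z : X →ₗ[ℂ] X))

/-- The discrete spectrum: isolated points of the spectrum that are eigenvalues of
finite algebraic multiplicity. -/
def discreteSpectrum (Z : X →L[ℂ] X) : Set ℂ :=
  {z | Module.End.HasEigenvalue (Z : X →ₗ[ℂ] X) z ∧ (∃ r, Isolates Z z r) ∧
    IsFiniteRank (rieszProjection Z z)}

/-- `∑ |λ_j(L)|^p` over the discrete eigenvalues of `L`, each counted according to its
algebraic multiplicity, as an element of `[0, ∞]`. -/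
def eigenvaluePowerSum (p : ℝ) (L : X →L[ℂ] X) : ℝ≥0∞ :=
  ∑' z : discreteSpectrum L, (algMult L z : ℝ≥0∞) * ENNReal.ofReal (‖(z : ℂ)‖ ^ p)

end Spectral

/-! ### Determinants of finite rank operators -/

section FiniteRank

variable {X : Type u} [NormedAddCommGroup X] [NormedSpace ℂ X]

/-- The restriction of `F` to its range. -/
def restrictRange (F : X →L[ℂ] X) :
    LinearMap.range (F : X →ₗ[ℂ] X) →ₗ[ℂ] LinearMap.range (F : X →ₗ[ℂ] X) :=
  (F : X →ₗ[ℂ] X).restrict fun x _ => LinearMap.mem_range_self (F : X →ₗ[ℂ] X) x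

/-- `det (I - F)` for a finite rank operator `F`. -/
def finDet (F : X →L[ℂ] X) : ℂ := LinearMap.det (LinearMap.id - restrictRange F)

/-- `tr F` for a finite rank operator `F`. -/
def finTrace (F : X →L[ℂ] X) : ℂ := LinearMap.trace ℂ _ (restrictRange F)

/-- `det_p (I - F) = det (I - F) exp (∑_{k=1}^{⌈p⌉-1} tr (F^k) / k)` for a finite rank
operator `F` and `p > 0`. -/
def finRegDet (p : ℝ) (F : X →L[ℂ] X) : ℂ :=
  finDet F * Complex.exp (∑ k ∈ Finset.Icc 1 (⌈p⌉₊ - 1), (1 / (k : ℂ)) * finTrace (F ^ k))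

/-- `Γ` is an admissible constant in `|det_p (I - F)| ≤ exp (Γ ∑ |λ_k(F)|^p)` for the finite
rank operators on `X` (these have finitely many discrete eigenvalues, so the sum is finite). -/
def IsDetConstant (X : Type u) [NormedAddCommGroup X] [NormedSpace ℂ X] (p Γ : ℝ) : Prop :=
  0 < Γ ∧ ∀ F : X →L[ℂ] X, IsFiniteRank F →
    ‖finRegDet p F‖ ≤ Real.exp (Γ * (eigenvaluePowerSum p F).toReal)

end FiniteRank

/-! ### Quasi-normed `l_p`-ideals and their regularized determinants -/

/-- `N` is a quasi-norm on the complex vector space `V`. -/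
structure IsQuasiNorm {V : Type u} [AddCommGroup V] [Module ℂ V] (N : V → ℝ) : Prop where
  nonneg : ∀ x, 0 ≤ N x
  eq_zero_iff : ∀ x, N x = 0 ↔ x = 0
  quasi_triangle : ∃ q : ℝ, 1 ≤ q ∧ ∀ x y, N (x + y) ≤ q * (N x + N y)
  smul : ∀ (c : ℂ) (x), N (c • x) = ‖c‖ * N x

/-- Continuity for the topology that is induced by the quasi-norm `N`, in which the sets
`{M | N (M - L) < δ}`, `δ > 0`, form a basis of neighbourhoods of `L`
(they need not be open). -/
def QuasiContinuous {V : Type u} [AddCommGroup V] (N : V → ℝ) (d : V → ℂ) : Prop :=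
  ∀ L : V, ∀ ε : ℝ, 0 < ε → ∃ δ : ℝ, 0 < δ ∧ ∀ M : V, N (M - L) < δ → ‖d M - d L‖ < ε

section Ideal

variable {X : Type u} [NormedAddCommGroup X] [NormedSpace ℂ X]

/-- `(I, N)` is an `l_p`-ideal in `B(X)` with eigenvalue constant `γ`. -/
structure IsLpIdeal (p γ : ℝ) (I : Submodule ℂ (X →L[ℂ] X)) (N : I → ℝ) : Prop where
  quasiNorm : IsQuasiNorm N
  finiteRank_mem : ∀ F : X →L[ℂ] X, IsFiniteRank F → F ∈ I
  finiteRank_dense : ∀ L : I, ∀ ε : ℝ, 0 < ε →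
    ∃ F : I, IsFiniteRank (F : X →L[ℂ] X) ∧ N (L - F) < ε
  norm_le : ∀ L : I, ‖(L : X →L[ℂ] X)‖ ≤ N L
  mul_mem : ∀ (A : X →L[ℂ] X) (L : I) (B : X →L[ℂ] X), A * (L : X →L[ℂ] X) * B ∈ I
  quasiNorm_mul_le : ∀ (A : X →L[ℂ] X) (L : I) (B : X →L[ℂ] X),
    N ⟨A * (L : X →L[ℂ] X) * B, mul_mem A L B⟩ ≤ ‖A‖ * N L * ‖B‖
  eigenvalue_le : ∀ L : I,
    eigenvaluePowerSum p (L : X →L[ℂ] X) ^ (1 / p) ≤ ENNReal.ofReal (γ * N L)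

theorem IsLpIdeal.mul_right_mem {p γ : ℝ} {I : Submodule ℂ (X →L[ℂ] X)} {N : I → ℝ}
    (h : IsLpIdeal p γ I N) (K : I) (B : X →L[ℂ] X) : (K : X →L[ℂ] X) * B ∈ I := by
  simpa using h.mul_mem 1 K B

/-- `d` is continuous on `(I, N)` and `d F = det_p (I - F)` for finite rank `F`. -/
def IsRegDetExtension (p : ℝ) (I : Submodule ℂ (X →L[ℂ] X)) (N : I → ℝ) (d : I → ℂ) : Prop :=
  QuasiContinuous N d ∧
    ∀ F : I, IsFiniteRank (F : X →L[ℂ] X) → d F = finRegDet p (F : X →L[ℂ] X)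

open Classical in
/-- The `p`-regularized determinant `L ↦ det_{p,I} (I - L)`: the continuous extension of `det_p`
from the finite rank operators to `(I, N)` (`0` if there were none). -/
def regDet (p : ℝ) (I : Submodule ℂ (X →L[ℂ] X)) (N : I → ℝ) : I → ℂ :=
  if h : ∃ d, IsRegDetExtension p I N d then h.choose else 0

/-- The operator `K (z - A)⁻¹` as an element of the ideal (meaningful for `z` in the resolvent
set of `A`). -/
def resolventProduct {p γ : ℝ} {I : Submodule ℂ (X →L[ℂ] X)} {N : I → ℝ} (h : IsLpIdeal p γ I N)
    (A : X →L[ℂ] X) (K : I) (z : ℂ) : I :=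
  ⟨(K : X →L[ℂ] X) * resolvent A z, h.mul_right_mem K (resolvent A z)⟩

/-- The `p`-regularized perturbation determinant `D(z) = det_{p,I} (I - K (z - A)⁻¹)` of `A` by
`K` (meaningful for `z` in the resolvent set of `A`). -/
def pertDet {p γ : ℝ} {I : Submodule ℂ (X →L[ℂ] X)} {N : I → ℝ} (h : IsLpIdeal p γ I N)
    (A : X →L[ℂ] X) (K : I) (z : ℂ) : ℂ :=
  regDet p I N (resolventProduct h A K z)

end Ideal

end

end PertDet

namespace PertDet

noncomputable section

/-! With n = ⌈p⌉, the regularized determinant of a finite rank F is the product of the Weierstrass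
primary factors E_n(μ) over the eigenvalues μ of F. The scalar bound |E_n(u)| ≤ exp(Γ|u|^p)
therefore gives (1), and rank one operators show that a constant admissible on a nonzero space must
satisfy this scalar bound.

Extension. For finite rank F, G the function t ↦ det_p(I - G - t(F - G)) is entire and bounded on
the disc of radius 1/N(F - G), so the Schwarz lemma makes det_p Lipschitz on quasi-balls
(`IsLpIdeal.exists_lipschitz`). It extends by density, and D is a locally uniform limit of
holomorphic functions.

Zeros. If I - L' = (I - G)(I - L) with G of finite rank, then det_p(I - L') is det(I - G) det_p(I -
L) times an exponential (`IsLpIdeal.regDet_mul`). Splitting off a small operator reduces the zero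
set to a finite-dimensional determinant. For the order at z, let Q be the Riesz projection of Z = A
+ K and pass from K to K - Q: the new determinant does not vanish at z, and the extra factor is ((w
- z)/(w - z + 1))^rank Q. Riesz projections are handled through the algebraic notion
`IsSpectralProjection`.

The bound. Approximation by finite rank operators loses the constant of the quasi-norm. Instead f(w)
= det_p(I - wL) is studied as an entire function: f - 1 = o(w^(n-1)), the zeros are the reciprocals
of the nonzero eigenvalues with their multiplicities (`IsLpIdeal.analyticOrderAt_regDet_smul`), and
f has minimal type for the order p (`IsLpIdeal.exists_norm_regDet_smul_le`). A Hadamard argument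
(`norm_le_exp_of_minimalType`) then bounds |f(1)| by exp(Γ ∑ |λ_j|^p), and the eigenvalue inequality
of the ideal finishes. -/

theorem det_id_sub_comp_comm {V W : Type*} [AddCommGroup V] [Module ℂ V] [FiniteDimensional ℂ V]
    [AddCommGroup W] [Module ℂ W] [FiniteDimensional ℂ W] (f : V →ₗ[ℂ] W) (g : W →ₗ[ℂ] V) :
    LinearMap.det (LinearMap.id - f ∘ₗ g) = LinearMap.det (LinearMap.id - g ∘ₗ f) := by
  classical
  let bV := Module.finBasis ℂ V
  let bW := Module.finBasis ℂ W
  rw [← LinearMap.det_toMatrix bW, ← LinearMap.det_toMatrix bV, map_sub, map_sub,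
    LinearMap.toMatrix_id, LinearMap.toMatrix_id, LinearMap.toMatrix_comp bW bV bW,
    LinearMap.toMatrix_comp bV bW bV, Matrix.det_one_sub_mul_comm]

/-! ### Determinant, trace and rank of finite rank operators -/

section FiniteRankCalculus

variable {X : Type u} [NormedAddCommGroup X] [NormedSpace ℂ X]

/-- The restriction of `F` to a subspace that contains its range. -/
def restrictTo (W : Submodule ℂ X) (F : X →L[ℂ] X) (h : LinearMap.range (F : X →ₗ[ℂ] X) ≤ W) :
    W →ₗ[ℂ] W :=
  (F : X →ₗ[ℂ] X).restrict fun x _ => h (LinearMap.mem_range_self (F : X →ₗ[ℂ] X) x)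

@[simp] theorem coe_restrictTo (W : Submodule ℂ X) (F : X →L[ℂ] X)
    (h : LinearMap.range (F : X →ₗ[ℂ] X) ≤ W) (x : W) : (restrictTo W F h x : X) = F x := rfl

theorem isFiniteRank_of_range_le {F : X →L[ℂ] X} {W : Submodule ℂ X} [FiniteDimensional ℂ W]
    (h : LinearMap.range (F : X →ₗ[ℂ] X) ≤ W) : IsFiniteRank F :=
  Submodule.finiteDimensional_of_le h

/-- The restrictions to W and to the range are the two compositions of F : W → Ran F with the
inclusion Ran F → W, and det(1 - fg) = det(1 - gf). Several operators can thus be compared on one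
common subspace. -/
theorem finDet_eq_det_restrictTo {F : X →L[ℂ] X} {W : Submodule ℂ X} [FiniteDimensional ℂ W]
    (h : LinearMap.range (F : X →ₗ[ℂ] X) ≤ W) :
    finDet F = LinearMap.det (LinearMap.id - restrictTo W F h) := by
  have : FiniteDimensional ℂ (LinearMap.range (F : X →ₗ[ℂ] X)) := isFiniteRank_of_range_le h
  exact det_id_sub_comp_comm ((F : X →ₗ[ℂ] X).rangeRestrict ∘ₗ W.subtype) (Submodule.inclusion h)

theorem finTrace_eq_trace_restrictTo {F : X →L[ℂ] X} {W : Submodule ℂ X} [FiniteDimensional ℂ W]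
    (h : LinearMap.range (F : X →ₗ[ℂ] X) ≤ W) :
    finTrace F = LinearMap.trace ℂ W (restrictTo W F h) := by
  have : FiniteDimensional ℂ (LinearMap.range (F : X →ₗ[ℂ] X)) := isFiniteRank_of_range_le h
  exact LinearMap.trace_comp_comm' (Submodule.inclusion h)
    ((F : X →ₗ[ℂ] X).rangeRestrict ∘ₗ W.subtype)

theorem range_add_le {F G : X →L[ℂ] X} {W : Submodule ℂ X}
    (hF : LinearMap.range (F : X →ₗ[ℂ] X) ≤ W) (hG : LinearMap.range (G : X →ₗ[ℂ] X) ≤ W) :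
    LinearMap.range ((F + G : X →L[ℂ] X) : X →ₗ[ℂ] X) ≤ W := by
  rintro _ ⟨x, rfl⟩
  exact W.add_mem (hF ⟨x, rfl⟩) (hG ⟨x, rfl⟩)

theorem range_sub_le {F G : X →L[ℂ] X} {W : Submodule ℂ X}
    (hF : LinearMap.range (F : X →ₗ[ℂ] X) ≤ W) (hG : LinearMap.range (G : X →ₗ[ℂ] X) ≤ W) :
    LinearMap.range ((F - G : X →L[ℂ] X) : X →ₗ[ℂ] X) ≤ W := by
  rintro _ ⟨x, rfl⟩
  exact W.sub_mem (hF ⟨x, rfl⟩) (hG ⟨x, rfl⟩)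

theorem range_smul_le {F : X →L[ℂ] X} {W : Submodule ℂ X} (c : ℂ)
    (hF : LinearMap.range (F : X →ₗ[ℂ] X) ≤ W) :
    LinearMap.range ((c • F : X →L[ℂ] X) : X →ₗ[ℂ] X) ≤ W := by
  rintro _ ⟨x, rfl⟩
  exact W.smul_mem c (hF ⟨x, rfl⟩)

theorem range_mul_le {F : X →L[ℂ] X} {W : Submodule ℂ X} (B : X →L[ℂ] X)
    (hF : LinearMap.range (F : X →ₗ[ℂ] X) ≤ W) :
    LinearMap.range ((F * B : X →L[ℂ] X) : X →ₗ[ℂ] X) ≤ W := by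
  rintro _ ⟨x, rfl⟩
  exact hF ⟨B x, rfl⟩

theorem range_pow_le {F : X →L[ℂ] X} {W : Submodule ℂ X}
    (hF : LinearMap.range (F : X →ₗ[ℂ] X) ≤ W) {k : ℕ} (hk : k ≠ 0) :
    LinearMap.range ((F ^ k : X →L[ℂ] X) : X →ₗ[ℂ] X) ≤ W := by
  obtain ⟨k, rfl⟩ := Nat.exists_eq_succ_of_ne_zero hk
  rw [pow_succ']
  exact range_mul_le _ hF

theorem restrictTo_pow {F : X →L[ℂ] X} {W : Submodule ℂ X}
    (hF : LinearMap.range (F : X →ₗ[ℂ] X) ≤ W) {k : ℕ} (hk : k ≠ 0) :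
    restrictTo W (F ^ k) (range_pow_le hF hk) = restrictTo W F hF ^ k := by
  have key : ∀ (k : ℕ) (x : W), ((restrictTo W F hF ^ k) x : X) = (F ^ k) x := by
    intro k
    induction k with
    | zero => intro x; simp
    | succ k ih => intro x; rw [pow_succ, pow_succ, Module.End.mul_apply, ih]; simp
  ext x
  rw [key, coe_restrictTo]

theorem IsFiniteRank.exists_common {F G : X →L[ℂ] X} (hF : IsFiniteRank F) (hG : IsFiniteRank G) :
    ∃ W : Submodule ℂ X, FiniteDimensional ℂ W ∧ LinearMap.range (F : X →ₗ[ℂ] X) ≤ W ∧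
      LinearMap.range (G : X →ₗ[ℂ] X) ≤ W := by
  unfold IsFiniteRank at hF hG
  exact ⟨_, inferInstance, le_sup_left, le_sup_right⟩

theorem IsFiniteRank.add {F G : X →L[ℂ] X} (hF : IsFiniteRank F) (hG : IsFiniteRank G) :
    IsFiniteRank (F + G) := by
  obtain ⟨W, _, h1, h2⟩ := hF.exists_common hG
  exact isFiniteRank_of_range_le (range_add_le h1 h2)

theorem IsFiniteRank.sub {F G : X →L[ℂ] X} (hF : IsFiniteRank F) (hG : IsFiniteRank G) :
    IsFiniteRank (F - G) := by
  obtain ⟨W, _, h1, h2⟩ := hF.exists_common hG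
  exact isFiniteRank_of_range_le (range_sub_le h1 h2)

theorem IsFiniteRank.smul {F : X →L[ℂ] X} (hF : IsFiniteRank F) (c : ℂ) :
    IsFiniteRank (c • F) := by
  unfold IsFiniteRank at hF
  exact isFiniteRank_of_range_le (range_smul_le c le_rfl)

theorem IsFiniteRank.mul_right {F : X →L[ℂ] X} (hF : IsFiniteRank F) (B : X →L[ℂ] X) :
    IsFiniteRank (F * B) := by
  unfold IsFiniteRank at hF
  exact isFiniteRank_of_range_le (range_mul_le B le_rfl)

theorem isFiniteRank_zero : IsFiniteRank (0 : X →L[ℂ] X) :=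
  isFiniteRank_of_range_le (W := ⊥) (by rintro _ ⟨x, rfl⟩; simp)

theorem IsFiniteRank.pow {F : X →L[ℂ] X} (hF : IsFiniteRank F) {k : ℕ} (hk : k ≠ 0) :
    IsFiniteRank (F ^ k) := by
  obtain ⟨k, rfl⟩ := Nat.exists_eq_succ_of_ne_zero hk
  rw [pow_succ']
  exact hF.mul_right _

theorem isFiniteRank_of_rank_le {F : X →L[ℂ] X} {r : ℕ}
    (h : LinearMap.rank (F : X →ₗ[ℂ] X) ≤ r) : IsFiniteRank F :=
  Module.rank_lt_aleph0_iff.1 (h.trans_lt (Cardinal.natCast_lt_aleph0))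

theorem IsFiniteRank.rank_eq {F : X →L[ℂ] X} (hF : IsFiniteRank F) :
    LinearMap.rank (F : X →ₗ[ℂ] X) =
      (Module.finrank ℂ (LinearMap.range (F : X →ₗ[ℂ] X)) : Cardinal) := by
  unfold IsFiniteRank at hF
  exact (Module.finrank_eq_rank _ _).symm

theorem finDet_zero : finDet (0 : X →L[ℂ] X) = 1 := by
  rw [finDet_eq_det_restrictTo (W := (⊥ : Submodule ℂ X)) (by rintro _ ⟨x, rfl⟩; simp)]
  exact LinearMap.det_eq_one_of_subsingleton _

theorem finTrace_add {F G : X →L[ℂ] X} (hF : IsFiniteRank F) (hG : IsFiniteRank G) :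
    finTrace (F + G) = finTrace F + finTrace G := by
  obtain ⟨W, _, h1, h2⟩ := hF.exists_common hG
  rw [finTrace_eq_trace_restrictTo h1, finTrace_eq_trace_restrictTo h2,
    finTrace_eq_trace_restrictTo (range_add_le h1 h2), ← map_add]
  rfl

theorem finTrace_smul {F : X →L[ℂ] X} (hF : IsFiniteRank F) (c : ℂ) :
    finTrace (c • F) = c * finTrace F := by
  have hF' := hF
  unfold IsFiniteRank at hF'
  rw [finTrace_eq_trace_restrictTo (F := F) le_rfl,
    finTrace_eq_trace_restrictTo (F := c • F) (range_smul_le c le_rfl),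
    ← smul_eq_mul, ← map_smul]
  rfl

theorem finTrace_sub {F G : X →L[ℂ] X} (hF : IsFiniteRank F) (hG : IsFiniteRank G) :
    finTrace (F - G) = finTrace F - finTrace G := by
  rw [sub_eq_add_neg, ← neg_one_smul ℂ G, finTrace_add hF (hG.smul _), finTrace_smul hG]
  ring

/-- Multiplicativity of `det (I - ·)`: if `I - H = (I - G) (I - F)`, then the determinants
multiply. -/
theorem finDet_mul {F G : X →L[ℂ] X} (hF : IsFiniteRank F) (hG : IsFiniteRank G) :
    finDet (F + G * (1 - F)) = finDet G * finDet F := by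
  obtain ⟨W, _, h1, h2⟩ := hF.exists_common hG
  rw [finDet_eq_det_restrictTo h1, finDet_eq_det_restrictTo h2,
    finDet_eq_det_restrictTo (range_add_le h1 (range_mul_le _ h2)), ← LinearMap.det_comp]
  congr 1
  ext x
  simp [mul_sub]
  abel

theorem norm_trace_le {V : Type*} [AddCommGroup V] [Module ℂ V] [FiniteDimensional ℂ V]
    (T : V →ₗ[ℂ] V) {C : ℝ} (hC : ∀ μ, Module.End.HasEigenvalue T μ → ‖μ‖ ≤ C) :
    ‖LinearMap.trace ℂ V T‖ ≤ Module.finrank ℂ V * C := by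
  rw [Module.End.trace_eq_sum_roots_charpoly_of_splits (IsAlgClosed.splits _)]
  have hle : ∀ s : Multiset ℂ, (∀ μ ∈ s, ‖μ‖ ≤ C) → ‖s.sum‖ ≤ Multiset.card s * C := by
    intro s
    induction s using Multiset.induction_on with
    | empty => simp
    | cons a s ih =>
      intro h
      rw [Multiset.sum_cons, Multiset.card_cons]
      push_cast
      have h1 := h a (Multiset.mem_cons_self a s)
      have h2 := ih fun μ hμ => h μ (Multiset.mem_cons_of_mem hμ)
      linarith [norm_add_le a s.sum]
  have hcard : Multiset.card T.charpoly.roots = Module.finrank ℂ V := by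
    rw [← T.charpoly_natDegree]
    exact (Polynomial.splits_iff_card_roots.1 (IsAlgClosed.splits _))
  rw [← hcard]
  refine hle _ fun μ hμ => hC μ ?_
  rw [Module.End.hasEigenvalue_iff_isRoot_charpoly]
  exact (Polynomial.mem_roots'.1 hμ).2

/-- The trace is a sum of at most r eigenvalues, each bounded by the operator norm. Consequently the
trace is norm continuous as long as the rank stays bounded. -/
theorem norm_finTrace_le {T : X →L[ℂ] X} {r : ℕ} (h : LinearMap.rank (T : X →ₗ[ℂ] X) ≤ r) :
    ‖finTrace T‖ ≤ r * ‖T‖ := by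
  have hT : IsFiniteRank T := isFiniteRank_of_rank_le h
  have hr : Module.finrank ℂ (LinearMap.range (T : X →ₗ[ℂ] X)) ≤ r := by
    have := hT.rank_eq ▸ h
    exact_mod_cast this
  unfold IsFiniteRank at hT
  refine (norm_trace_le (restrictRange T) (C := ‖T‖) fun μ hμ => ?_).trans ?_
  · obtain ⟨v, hv⟩ := hμ.exists_hasEigenvector
    have hv0 : (v : X) ≠ 0 := by simpa using hv.2
    have h1 : T (v : X) = μ • (v : X) := congrArg Subtype.val hv.apply_eq_smul
    have h2 := T.le_opNorm (v : X)
    rw [h1, norm_smul] at h2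
    exact le_of_mul_le_mul_right h2 (norm_pos_iff.2 hv0)
  · gcongr

theorem rank_add_le' {S T : X →L[ℂ] X} {r s : ℕ} (hS : LinearMap.rank (S : X →ₗ[ℂ] X) ≤ r)
    (hT : LinearMap.rank (T : X →ₗ[ℂ] X) ≤ s) :
    LinearMap.rank ((S + T : X →L[ℂ] X) : X →ₗ[ℂ] X) ≤ ((r + s : ℕ) : Cardinal) := by
  push_cast
  exact (LinearMap.rank_add_le _ _).trans (add_le_add hS hT)

theorem rank_smul_le' {S : X →L[ℂ] X} {r : ℕ} (c : ℂ) (hS : LinearMap.rank (S : X →ₗ[ℂ] X) ≤ r) :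
    LinearMap.rank ((c • S : X →L[ℂ] X) : X →ₗ[ℂ] X) ≤ r :=
  (Submodule.rank_mono (range_smul_le c le_rfl)).trans hS

theorem rank_sub_le' {S T : X →L[ℂ] X} {r s : ℕ} (hS : LinearMap.rank (S : X →ₗ[ℂ] X) ≤ r)
    (hT : LinearMap.rank (T : X →ₗ[ℂ] X) ≤ s) :
    LinearMap.rank ((S - T : X →L[ℂ] X) : X →ₗ[ℂ] X) ≤ ((r + s : ℕ) : Cardinal) := by
  rw [sub_eq_add_neg, ← neg_one_smul ℂ T]
  exact rank_add_le' hS (rank_smul_le' _ hT)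

theorem rank_mul_right_le {S : X →L[ℂ] X} {r : ℕ} (hS : LinearMap.rank (S : X →ₗ[ℂ] X) ≤ r)
    (B : X →L[ℂ] X) : LinearMap.rank ((S * B : X →L[ℂ] X) : X →ₗ[ℂ] X) ≤ r :=
  (LinearMap.rank_comp_le_left (B : X →ₗ[ℂ] X) (S : X →ₗ[ℂ] X)).trans hS

theorem rank_mul_left_le {S : X →L[ℂ] X} {r : ℕ} (hS : LinearMap.rank (S : X →ₗ[ℂ] X) ≤ r)
    (B : X →L[ℂ] X) : LinearMap.rank ((B * S : X →L[ℂ] X) : X →ₗ[ℂ] X) ≤ r :=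
  (LinearMap.rank_comp_le_right (S : X →ₗ[ℂ] X) (B : X →ₗ[ℂ] X)).trans hS

/-- By the telescoping identity S^(k+1) - T^(k+1) = S(S^k - T^k) + (S - T)T^k, each step costs one
more copy of the rank of S - T. -/
theorem rank_pow_sub_pow_le {S T : X →L[ℂ] X} {r : ℕ}
    (h : LinearMap.rank ((S - T : X →L[ℂ] X) : X →ₗ[ℂ] X) ≤ r) (k : ℕ) :
    LinearMap.rank ((S ^ k - T ^ k : X →L[ℂ] X) : X →ₗ[ℂ] X) ≤ ((k * r : ℕ) : Cardinal) := by
  induction k with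
  | zero => simp
  | succ k ih =>
    have : S ^ (k + 1) - T ^ (k + 1) = S * (S ^ k - T ^ k) + (S - T) * T ^ k := by
      rw [pow_succ', pow_succ' T]; noncomm_ring
    rw [this, add_mul, one_mul]
    exact rank_add_le' (rank_mul_left_le ih S) (rank_mul_right_le h _)

theorem tendsto_finTrace {α : Type*} {l : Filter α} {T : α → X →L[ℂ] X} {T₀ : X →L[ℂ] X} {r : ℕ}
    (hr : ∀ᶠ a in l, LinearMap.rank (T a : X →ₗ[ℂ] X) ≤ r)
    (hr₀ : LinearMap.rank (T₀ : X →ₗ[ℂ] X) ≤ r) (h : Tendsto T l (𝓝 T₀)) :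
    Tendsto (fun a => finTrace (T a)) l (𝓝 (finTrace T₀)) := by
  rw [tendsto_iff_norm_sub_tendsto_zero] at h ⊢
  have h' := h.const_mul ((r + r : ℕ) : ℝ)
  rw [mul_zero] at h'
  refine squeeze_zero' (Eventually.of_forall fun _ => norm_nonneg _) ?_ h'
  filter_upwards [hr] with a ha
  rw [← finTrace_sub (isFiniteRank_of_rank_le ha) (isFiniteRank_of_rank_le hr₀)]
  exact norm_finTrace_le (rank_sub_le' ha hr₀)

end FiniteRankCalculus

/-! ### Growth of the Weierstrass primary factors -/

section PrimaryFactor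

/-- The Weierstrass primary factor `(1 - u) exp (∑_{k=1}^{n-1} u^k / k)`. -/
def primaryFactor (n : ℕ) (u : ℂ) : ℂ :=
  (1 - u) * Complex.exp (∑ k ∈ Finset.Icc 1 (n - 1), (1 / (k : ℂ)) * u ^ k)

@[simp] theorem primaryFactor_zero (n : ℕ) : primaryFactor n 0 = 1 := by
  have : ∑ k ∈ Finset.Icc 1 (n - 1), (1 / (k : ℂ)) * 0 ^ k = 0 :=
    Finset.sum_eq_zero fun k hk => by
      rw [zero_pow (by have := (Finset.mem_Icc.1 hk).1; lia), mul_zero]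
  rw [primaryFactor, this]
  simp

theorem differentiable_primaryFactor (n : ℕ) : Differentiable ℂ (primaryFactor n) := by
  unfold primaryFactor
  fun_prop

/-- The logarithm of the primary factor is log(1 - u) minus its Taylor polynomial of degree n - 1, a
remainder of order u^n. -/
theorem exists_primaryFactor_eq_exp {n : ℕ} (hn : 1 ≤ n) {u : ℂ} (hu : ‖u‖ ≤ 1 / 2) :
    ∃ h : ℂ, primaryFactor n u = Complex.exp h ∧ ‖h‖ ≤ 2 * ‖u‖ ^ n := by
  obtain ⟨m, rfl⟩ := Nat.exists_eq_add_of_le' hn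
  have hu1 : ‖-u‖ < 1 := by rw [norm_neg]; linarith
  have hne : (1 : ℂ) + -u ≠ 0 := by
    intro h0
    have : ‖-u‖ = 1 := by rw [show -u = -1 by linear_combination h0]; simp
    linarith
  refine ⟨Complex.log (1 + -u) - Complex.logTaylor (m + 1) (-u), ?_, ?_⟩
  · rw [Complex.exp_sub, Complex.exp_log hne, primaryFactor, ← sub_eq_add_neg, div_eq_mul_inv,
      ← Complex.exp_neg, Complex.logTaylor, Finset.sum_range_succ']
    congr 2
    simp only [Nat.add_sub_cancel, pow_zero, Nat.cast_zero, div_zero, add_zero]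
    rw [← Finset.sum_neg_distrib, Finset.range_eq_Ico, Finset.sum_Ico_add' (fun k : ℕ =>
      -((-1) ^ (k + 1) * (-u) ^ k / (k : ℂ))) 0 m 1]
    refine Finset.sum_congr (by ext; simp) fun k _ => ?_
    rw [neg_pow u, pow_succ]
    have : ((-1 : ℂ) ^ k) * (-1) ^ k = 1 := by rw [← mul_pow]; simp
    linear_combination (-(u ^ k / (k : ℂ))) * this
  · refine (Complex.norm_log_sub_logTaylor_le m hu1).trans ?_
    rw [norm_neg]
    have h1 : (1 - ‖u‖)⁻¹ ≤ 2 := by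
      rw [inv_le_comm₀ (by linarith) (by norm_num)]; linarith
    have h2 : ‖u‖ ^ (m + 1) * (1 - ‖u‖)⁻¹ ≤ ‖u‖ ^ (m + 1) * 2 := by gcongr
    refine (div_le_self (by have : 0 < 1 - ‖u‖ := by linarith
                            positivity) (by norm_cast)).trans (by linarith)

theorem norm_primaryFactor_sub_one_le {n : ℕ} (hn : 1 ≤ n) {u : ℂ} (hu : ‖u‖ ≤ 1 / 2) :
    ‖primaryFactor n u - 1‖ ≤ 4 * ‖u‖ ^ n := by
  obtain ⟨h, h1, h2⟩ := exists_primaryFactor_eq_exp hn hu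
  rw [h1]
  have h3 : ‖u‖ ^ n ≤ 1 / 2 :=
    (pow_le_of_le_one (norm_nonneg u) (by linarith) (by lia)).trans hu
  have := Complex.norm_exp_sub_one_le (x := h) (by linarith)
  linarith

/-- Near 0 the exponent n ≥ p of the logarithmic remainder decides; away from 0 all powers in the
exponential have exponent k ≤ n - 1 < p. -/
theorem exists_norm_primaryFactor_le {p : ℝ} (hp : 0 < p) :
    ∃ Γ : ℝ, 0 < Γ ∧ ∀ u : ℂ, ‖primaryFactor ⌈p⌉₊ u‖ ≤ Real.exp (Γ * ‖u‖ ^ p) := by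
  set n := ⌈p⌉₊ with hn
  have hn1 : 1 ≤ n := Nat.one_le_ceil_iff.2 hp
  -- The summand 2 serves |u| ≤ 1/2. For larger u, n bounds the number of terms in the exponential,
  -- 1 + 1/p comes from log 2 + log x, and 2^p from x = 2|u|, which is at least 1 so that its powers
  -- increase with the exponent.
  refine ⟨(n + 1 + 1 / p) * 2 ^ p + 2, by positivity, fun u => ?_⟩
  rcases le_total ‖u‖ (1 / 2) with hu | hu
  · obtain ⟨h, h1, h2⟩ := exists_primaryFactor_eq_exp hn1 hu
    rw [h1, Complex.norm_exp, Real.exp_le_exp]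
    have h3 : ‖u‖ ^ n ≤ ‖u‖ ^ p := by
      rw [← Real.rpow_natCast]
      rcases eq_or_ne ‖u‖ 0 with h0 | h0
      · rw [h0, Real.zero_rpow hp.ne', Real.zero_rpow (by positivity)]
      · exact Real.rpow_le_rpow_of_exponent_ge (by positivity) (by linarith) (Nat.le_ceil p)
    have h4 : 0 ≤ (n + 1 + 1 / p) * 2 ^ p * ‖u‖ ^ p := by positivity
    linarith [Complex.re_le_norm h]
  · set x := 2 * ‖u‖ with hx
    have hx1 : 1 ≤ x := by linarith
    have hxp : 1 ≤ x ^ p := Real.one_le_rpow hx1 hp.le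
    have h1 : ‖1 - u‖ ≤ Real.exp ((1 + 1 / p) * x ^ p) := by
      have ha : ‖1 - u‖ ≤ 2 * x := by
        have := norm_sub_le (1 : ℂ) u
        rw [norm_one] at this
        linarith
      refine ha.trans ?_
      rw [← Real.log_le_iff_le_exp (by positivity), Real.log_mul (by norm_num) (by positivity)]
      have h2 := Real.log_le_rpow_div (by positivity : 0 ≤ x) hp
      have h3 : Real.log 2 ≤ 1 := by linarith [Real.log_two_lt_d9]
      calc Real.log 2 + Real.log x ≤ x ^ p + x ^ p / p := by linarith
        _ = (1 + 1 / p) * x ^ p := by ring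
    have h2 : ‖Complex.exp (∑ k ∈ Finset.Icc 1 (n - 1), (1 / (k : ℂ)) * u ^ k)‖ ≤
        Real.exp (n * x ^ p) := by
      rw [Complex.norm_exp, Real.exp_le_exp]
      refine (Complex.re_le_norm _).trans ((norm_sum_le_of_le _ (f := fun k : ℕ =>
        (1 / (k : ℂ)) * u ^ k) (n := fun _ => x ^ p) fun k hk => ?_).trans ?_)
      · obtain ⟨hk1, hk2⟩ := Finset.mem_Icc.1 hk
        have hkp : (k : ℝ) ≤ p := (Nat.lt_ceil.1 (show k < ⌈p⌉₊ by lia)).le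
        rw [norm_mul, norm_pow, norm_div, norm_one, Complex.norm_natCast]
        calc 1 / (k : ℝ) * ‖u‖ ^ k ≤ 1 * x ^ k := by
              gcongr
              · rw [div_le_one (by positivity)]; exact_mod_cast hk1
              · linarith
          _ = x ^ (k : ℝ) := by rw [one_mul, Real.rpow_natCast]
          _ ≤ x ^ p := Real.rpow_le_rpow_of_exponent_le hx1 hkp
      · rw [Finset.sum_const, nsmul_eq_mul]
        gcongr
        simp
    rw [primaryFactor, norm_mul]
    calc _ ≤ Real.exp ((1 + 1 / p) * x ^ p) * Real.exp (n * x ^ p) := by gcongr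
      _ = Real.exp ((n + 1 + 1 / p) * x ^ p) := by rw [← Real.exp_add]; congr 1; ring
      _ ≤ _ := by
        rw [Real.exp_le_exp, hx, Real.mul_rpow (by norm_num) (norm_nonneg u)]
        have : 0 ≤ 2 * ‖u‖ ^ p := by positivity
        linarith

end PrimaryFactor

/-! ### The regularized determinant as a product over eigenvalues -/

section ProductFormula

variable {V : Type*} [AddCommGroup V] [Module ℂ V] [FiniteDimensional ℂ V]

/-- On the generalized eigenspace of μ, T is μ plus a commuting nilpotent, so T^k has trace μ^k
times the dimension there, and that dimension is the multiplicity of μ as a root of the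
characteristic polynomial. -/
theorem trace_pow_eq_sum_roots (T : Module.End ℂ V) (k : ℕ) :
    LinearMap.trace ℂ V (T ^ k) = (T.charpoly.roots.map (· ^ k)).sum := by
  classical
  have hds := DirectSum.isInternal_submodule_of_iSupIndep_of_iSup_eq_top
    T.independent_maxGenEigenspace (Module.End.iSup_maxGenEigenspace_eq_top T)
  have hfin : {μ | T.maxGenEigenspace μ ≠ ⊥}.Finite :=
    WellFoundedGT.finite_ne_bot_of_iSupIndep T.independent_maxGenEigenspace
  have hmaps (k : ℕ) (μ : ℂ) : Set.MapsTo (T ^ k) (T.maxGenEigenspace μ) (T.maxGenEigenspace μ) :=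
    T.mapsTo_maxGenEigenspace_of_comm ((Commute.refl T).pow_right k) μ
  have hloc (k : ℕ) (μ : ℂ) : LinearMap.trace ℂ (T.maxGenEigenspace μ)
      ((T ^ k).restrict (hmaps k μ)) = μ ^ k * Module.finrank ℂ (T.maxGenEigenspace μ) := by
    induction k with
    | zero =>
      have : (T ^ 0).restrict (hmaps 0 μ) = LinearMap.id := by ext; simp
      rw [this, LinearMap.trace_id]; simp
    | succ k ih =>
      have h1 : (T ^ (k + 1)).restrict (hmaps (k + 1) μ) =
          (T ^ k).restrict (hmaps k μ) ∘ₗ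
            T.restrict (T.mapsTo_maxGenEigenspace_of_comm rfl μ) := by
        ext x
        change (T ^ (k + 1)) (x : V) = (T ^ k) (T x)
        rw [pow_succ, Module.End.mul_apply]
      rw [h1, LinearMap.trace_comp_eq_mul_of_commute_of_isNilpotent μ, ih, pow_succ]
      · ring
      · exact LinearMap.restrict_commute ((Commute.refl T).pow_left k) _ _
      · exact T.isNilpotent_restrict_maxGenEigenspace_sub_algebraMap μ
  rw [LinearMap.trace_eq_sum_trace_restrict' hds hfin (hmaps k), Finset.sum_multiset_map_count]
  simp_rw [hloc, LinearMap.finrank_maxGenEigenspace_eq, Polynomial.count_roots, nsmul_eq_mul]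
  refine Finset.sum_congr ?_ fun μ _ => mul_comm _ _
  ext μ
  rw [Set.Finite.mem_toFinset, Set.mem_ofPred_eq, Multiset.mem_toFinset,
    ← Multiset.count_pos, Polynomial.count_roots, ← LinearMap.finrank_maxGenEigenspace_eq,
    Module.finrank_pos_iff, Submodule.nontrivial_iff_ne_bot]

theorem det_id_sub_smul_eq_prod_roots (T : Module.End ℂ V) (w : ℂ) :
    LinearMap.det (LinearMap.id - w • T) = (T.charpoly.roots.map fun μ => 1 - w * μ).prod := by
  have hs := (IsAlgClosed.splits T.charpoly).eq_prod_roots_of_monic T.charpoly_monic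
  have hev (t : ℂ) : LinearMap.det (algebraMap ℂ (Module.End ℂ V) t - T) =
      (T.charpoly.roots.map fun μ => t - μ).prod := by
    rw [← LinearMap.eval_charpoly]
    conv_lhs => rw [hs]
    rw [Polynomial.eval_multiset_prod, Multiset.map_map]
    simp
  rcases eq_or_ne w 0 with rfl | hw
  · simp
  · have h1 : (LinearMap.id - w • T : Module.End ℂ V) =
        w • (algebraMap ℂ (Module.End ℂ V) w⁻¹ - T) := by
      ext x
      simp [smul_sub, smul_smul, hw]
    have hcard : Multiset.card T.charpoly.roots = Module.finrank ℂ V := by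
      rw [← T.charpoly_natDegree]
      exact (Polynomial.splits_iff_card_roots.1 (IsAlgClosed.splits _))
    rw [h1, LinearMap.det_smul, hev, ← hcard, ← Multiset.prod_replicate,
      ← Multiset.map_const', ← Multiset.prod_map_mul]
    congr 1
    refine Multiset.map_congr rfl fun μ _ => ?_
    field_simp

theorem det_mul_exp_eq_prod_primaryFactor (n : ℕ) (T : Module.End ℂ V) (w : ℂ) :
    LinearMap.det (LinearMap.id - w • T) *
      Complex.exp (∑ k ∈ Finset.Icc 1 (n - 1),
        (1 / (k : ℂ)) * LinearMap.trace ℂ V ((w • T) ^ k)) =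
      (T.charpoly.roots.map fun μ => primaryFactor n (w * μ)).prod := by
  rw [det_id_sub_smul_eq_prod_roots]
  simp_rw [smul_pow, map_smul, trace_pow_eq_sum_roots]
  generalize T.charpoly.roots = s
  induction s using Multiset.induction_on with
  | empty => simp
  | cons a s ih =>
    simp only [Multiset.map_cons, Multiset.prod_cons, Multiset.sum_cons, smul_add, mul_add,
      Finset.sum_add_distrib, Complex.exp_add]
    rw [← ih, primaryFactor]
    simp only [smul_eq_mul, mul_pow]
    ring

end ProductFormula

/-! ### The product formula for operators on the Banach space -/

section RegularizedDeterminant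

variable {X : Type u} [NormedAddCommGroup X] [NormedSpace ℂ X]

theorem finRegDet_eq {F : X →L[ℂ] X} {W : Submodule ℂ X} [FiniteDimensional ℂ W]
    (h : LinearMap.range (F : X →ₗ[ℂ] X) ≤ W) (p : ℝ) :
    finRegDet p F = LinearMap.det (LinearMap.id - restrictTo W F h) *
      Complex.exp (∑ k ∈ Finset.Icc 1 (⌈p⌉₊ - 1),
        (1 / (k : ℂ)) * LinearMap.trace ℂ W (restrictTo W F h ^ k)) := by
  rw [finRegDet, finDet_eq_det_restrictTo h]
  congr 2
  refine Finset.sum_congr rfl fun k hk => ?_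
  have hk0 : k ≠ 0 := by have := (Finset.mem_Icc.1 hk).1; lia
  rw [finTrace_eq_trace_restrictTo (range_pow_le h hk0), restrictTo_pow h hk0]

/-- The eigenvalues of the restriction of `F` to its range, with algebraic
multiplicity. -/
def eigenvalueMultiset (F : X →L[ℂ] X) (hF : IsFiniteRank F) : Multiset ℂ :=
  have : FiniteDimensional ℂ (LinearMap.range (F : X →ₗ[ℂ] X)) := hF
  (LinearMap.charpoly (restrictRange F)).roots

theorem finRegDet_smul_eq_prod {F : X →L[ℂ] X} (hF : IsFiniteRank F) (p : ℝ) (w : ℂ) :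
    finRegDet p (w • F) =
      ((eigenvalueMultiset F hF).map fun μ => primaryFactor ⌈p⌉₊ (w * μ)).prod := by
  have : FiniteDimensional ℂ (LinearMap.range (F : X →ₗ[ℂ] X)) := hF
  rw [finRegDet_eq (W := LinearMap.range (F : X →ₗ[ℂ] X)) (range_smul_le w le_rfl)]
  exact det_mul_exp_eq_prod_primaryFactor _ (restrictRange F) w

theorem finRegDet_eq_prod {F : X →L[ℂ] X} (hF : IsFiniteRank F) (p : ℝ) :
    finRegDet p F = ((eigenvalueMultiset F hF).map (primaryFactor ⌈p⌉₊)).prod := by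
  simpa using finRegDet_smul_eq_prod hF p 1

end RegularizedDeterminant

/-! ### Spectral projections, algebraically -/

section SpectralProjection

variable {A : Type*} [Ring A] [Algebra ℂ A]

/-- `Q` is a spectral projection of `Z` at `z`: it is an idempotent that commutes with `Z`, the
operator `z - Z` is nilpotent on its range and invertible on its kernel. -/
structure IsSpectralProjection (Z : A) (z : ℂ) (Q : A) : Prop where
  comm : Commute Q Z
  idem : Q * Q = Q
  nilp : ∃ m : ℕ, (algebraMap ℂ A z - Z) ^ m * Q = 0
  inv : ∃ S : A, Commute S Q ∧ (algebraMap ℂ A z - Z) * S = 1 - Q ∧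
    S * (algebraMap ℂ A z - Z) = 1 - Q

/-- An element with a Drazin inverse has a spectral projection at `0`. -/
theorem isSpectralProjection_of_drazin {Z : A} {z : ℂ} {D : A} {m : ℕ}
    (hc : Commute (algebraMap ℂ A z - Z) D)
    (h : (algebraMap ℂ A z - Z) ^ m = (algebraMap ℂ A z - Z) ^ (m + 1) * D) :
    IsSpectralProjection Z z (1 - (algebraMap ℂ A z - Z) ^ m * D ^ m) := by
  set T := algebraMap ℂ A z - Z with hT
  have hTZ : Commute T Z := (Algebra.commute_algebraMap_left z Z).sub_left (Commute.refl Z)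
  have hZD : Commute Z D := by
    have : Z = algebraMap ℂ A z - T := by rw [hT]; abel
    rw [this]
    exact (Algebra.commute_algebraMap_left z D).sub_left hc
  -- Iteration of T^m = T^(m+1) D; the case j = m makes T^m D^m idempotent.
  have hj : ∀ j, T ^ m = T ^ (m + j) * D ^ j := by
    intro j
    induction j with
    | zero => simp
    | succ j ih =>
      calc T ^ m = T ^ (m + j) * D ^ j := ih
        _ = T ^ j * T ^ m * D ^ j := by rw [← pow_add, add_comm j]
        _ = T ^ j * (T ^ (m + 1) * D) * D ^ j := by rw [← h]
        _ = T ^ j * T ^ (m + 1) * (D * D ^ j) := by simp only [mul_assoc]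
        _ = _ := by rw [← pow_add, ← pow_succ', show j + (m + 1) = m + (j + 1) by ring]
  have hcm : D ^ m * T ^ m = T ^ m * D ^ m := (hc.symm.pow_pow m m).eq
  have he : T ^ m * (T ^ m * D ^ m) = T ^ m := by
    rw [← mul_assoc, ← pow_add, ← hj]
  have hidem : (T ^ m * D ^ m) * (T ^ m * D ^ m) = T ^ m * D ^ m := by
    rw [mul_assoc, ← mul_assoc (D ^ m), hcm, ← mul_assoc, he]
  have hcT : Commute (T ^ m * D ^ m) T :=
    ((Commute.refl T).pow_left m).mul_left (hc.symm.pow_left m)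
  have hcD : Commute (T ^ m * D ^ m) D :=
    (hc.pow_left m).mul_left ((Commute.refl D).pow_left m)
  refine ⟨?_, ?_, ⟨m, ?_⟩, T ^ m * D ^ (m + 1), ?_, ?_, ?_⟩
  · exact (Commute.one_left Z).sub_left ((hTZ.pow_left m).mul_left (hZD.symm.pow_left m))
  · rw [mul_sub, sub_mul, sub_mul, hidem]; simp
  · rw [mul_sub, he, mul_one, sub_self]
  · refine (Commute.one_right _).sub_right ?_
    rw [pow_succ, ← mul_assoc]
    exact (Commute.refl _).mul_left hcD.symm
  · rw [sub_sub_cancel, ← mul_assoc, ← pow_succ', pow_succ' D, ← mul_assoc, ← h]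
  · rw [sub_sub_cancel, mul_assoc, (hc.symm.pow_left (m + 1)).eq, ← mul_assoc, ← pow_succ,
      pow_succ' D, ← mul_assoc, ← h]

/-- The inverse of `b + T` on the range of a projection on which `T` is nilpotent. -/
def nilpotentInverse (T : A) (m : ℕ) (b : ℂ) : A :=
  ∑ k ∈ Finset.range m, (b ^ (k + 1))⁻¹ • (-T) ^ k

theorem nilpotentInverse_mul {T Q : A} {m : ℕ} (h : T ^ m * Q = 0) {b : ℂ} (hb : b ≠ 0) :
    (algebraMap ℂ A b + T) * (nilpotentInverse T m b * Q) = Q := by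
  -- A finite Neumann series: the product telescopes, and the remainder T^m dies on the range of Q.
  have key : (algebraMap ℂ A b + T) * nilpotentInverse T m b =
      1 - (b ^ m)⁻¹ • (-T) ^ m := by
    unfold nilpotentInverse
    clear h
    induction m with
    | zero => simp
    | succ m ih =>
      rw [Finset.sum_range_succ, mul_add, ih, add_mul, Algebra.algebraMap_eq_smul_one,
        smul_mul_smul_comm, one_mul, mul_smul_comm, pow_succ (-T), mul_neg, pow_succ b m,
        (((Commute.refl T).neg_left).pow_left m).eq, mul_inv]
      have : b * ((b ^ m)⁻¹ * b⁻¹) = (b ^ m)⁻¹ := by field_simp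
      rw [this, smul_neg, sub_neg_eq_add]
      abel
  rw [← mul_assoc, key, sub_mul, one_mul, smul_mul_assoc, neg_pow, mul_assoc, h]
  simp

theorem commute_nilpotentInverse {T Q : A} (h : Commute T Q) (m : ℕ) (b : ℂ) :
    Commute (nilpotentInverse T m b) Q :=
  Commute.sum_left _ _ _ fun k _ => ((h.neg_left).pow_left k).smul_left _

end SpectralProjection

section NormedSpectralProjection

variable {A : Type*} [Ring A] [Algebra ℂ A] {Z Q : A} {z : ℂ}

namespace IsSpectralProjection

theorem commute_compl (h : IsSpectralProjection Z z Q) (w : ℂ) :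
    Commute (algebraMap ℂ A w - Z) Q :=
  (Algebra.commute_algebraMap_left w Q).sub_left h.comm.symm

/-- A two-sided inverse assembled from the inverses on the range and the kernel of `Q`. -/
theorem isUnit_of_pieces (h : IsSpectralProjection Z z Q) {B Y : A} {m : ℕ} {b : ℂ} (hb : b ≠ 0)
    (hm : (algebraMap ℂ A z - Z) ^ m * Q = 0) (hBQ : Commute B Q)
    (hB : B * Q = (algebraMap ℂ A b + (algebraMap ℂ A z - Z)) * Q)
    (h1 : B * Y = 1 - Q) (h2 : Y * B = 1 - Q) :
    B * (Y + nilpotentInverse (algebraMap ℂ A z - Z) m b * Q) = 1 ∧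
    (Y + nilpotentInverse (algebraMap ℂ A z - Z) m b * Q) * B = 1 := by
  set T := algebraMap ℂ A z - Z with hT
  set M := nilpotentInverse T m b with hM
  have hTQ : Commute T Q := h.commute_compl z
  have hMQ : Commute M Q := commute_nilpotentInverse hTQ m b
  have hMT : Commute M (algebraMap ℂ A b + T) :=
    (Algebra.commute_algebraMap_right b M).add_right
      (commute_nilpotentInverse (Commute.refl T) m b)
  have h3 : B * (M * Q) = Q := by
    calc B * (M * Q) = B * (Q * Q * M) := by rw [h.idem, hMQ.eq]
      _ = B * Q * (M * Q) := by rw [hMQ.eq]; simp only [mul_assoc]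
      _ = (algebraMap ℂ A b + T) * (Q * (M * Q)) := by rw [hB, mul_assoc]
      _ = (algebraMap ℂ A b + T) * (M * Q) := by
        rw [hMQ.eq, ← mul_assoc Q Q M, h.idem]
      _ = Q := nilpotentInverse_mul hm hb
  have h4 : M * Q * B = Q := by
    calc M * Q * B = M * (B * Q) := by rw [mul_assoc, hBQ.eq]
      _ = (algebraMap ℂ A b + T) * (M * Q) := by rw [hB, ← mul_assoc, hMT.eq, mul_assoc]
      _ = Q := nilpotentInverse_mul hm hb
  constructor
  · rw [mul_add, h1, h3]; abel
  · rw [add_mul, h2, h4]; abel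

theorem mul_compl (h : IsSpectralProjection Z z Q) : Q * (1 - Q) = 0 := by
  rw [mul_sub, mul_one, h.idem, sub_self]

theorem compl_idem (h : IsSpectralProjection Z z Q) : (1 - Q) * (1 - Q) = 1 - Q := by
  rw [sub_mul, one_mul, h.mul_compl, sub_zero]

theorem commute_shift (h : IsSpectralProjection Z z Q) (w a : ℂ) :
    Commute (algebraMap ℂ A w - (Z - a • Q)) Q :=
  (Algebra.commute_algebraMap_left w Q).sub_left
    (h.comm.symm.sub_left ((Commute.refl Q).smul_left a))

theorem shift_mul (h : IsSpectralProjection Z z Q) (w a : ℂ) :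
    (algebraMap ℂ A w - (Z - a • Q)) * Q =
      (algebraMap ℂ A (w + a - z) + (algebraMap ℂ A z - Z)) * Q := by
  simp only [map_sub, map_add, add_mul, sub_mul, smul_mul_assoc, h.idem,
    Algebra.algebraMap_eq_smul_one, one_mul]
  abel

theorem shift_mul_compl (h : IsSpectralProjection Z z Q) (w a : ℂ) :
    (algebraMap ℂ A w - (Z - a • Q)) * (1 - Q) = (algebraMap ℂ A w - Z) * (1 - Q) := by
  rw [sub_mul, sub_mul, sub_mul, smul_mul_assoc, h.mul_compl, smul_zero, sub_zero]

/-- If `B` and the invertible operator `C` agree on the kernel of `Q`, then the inverse of `C` is an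
inverse of `B` there. -/
theorem pieces_of_unit (h : IsSpectralProjection Z z Q) {B : A} {C : Aˣ} (hBQ : Commute B Q)
    (hCQ : Commute (C : A) Q) (hBC : B * (1 - Q) = C * (1 - Q)) :
    B * (↑C⁻¹ * (1 - Q)) = 1 - Q ∧ ↑C⁻¹ * (1 - Q) * B = 1 - Q := by
  have h1 : Commute (↑C⁻¹ : A) (1 - Q) := (Commute.one_right _).sub_right hCQ.units_inv_left
  have h2 : Commute B (1 - Q) := (Commute.one_right _).sub_right hBQ
  constructor
  · rw [← h.compl_idem, ← mul_assoc, ← mul_assoc, mul_assoc B, h1.eq, ← mul_assoc, hBC,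
      mul_assoc (C : A), ← h1.eq, ← mul_assoc, Units.mul_inv, one_mul]
  · rw [mul_assoc, ← h2.eq, hBC, ← mul_assoc, Units.inv_mul, one_mul]

/-- The operator `Z - a Q`, for which `z` is moved to `z - a`, has `z` and every point of the
resolvent set of `Z` other than `z - a` in its resolvent set. -/
theorem mem_resolventSet_shift (h : IsSpectralProjection Z z Q) {a w : ℂ} (ha : w + a ≠ z)
    (hw : w ∈ resolventSet ℂ Z ∨ w = z) : w ∈ resolventSet ℂ (Z - a • Q) := by
  obtain ⟨m, hm⟩ := h.nilp
  have hb : w + a - z ≠ 0 := sub_ne_zero.2 ha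
  -- Y inverts w - (Z - aQ) on the kernel of Q, where this operator agrees with w - Z. At w = z,
  -- where w - Z need not be invertible, the inverse on the kernel comes from `h.inv`.
  obtain ⟨Y, hY1, hY2⟩ : ∃ Y, (algebraMap ℂ A w - (Z - a • Q)) * Y = 1 - Q ∧
      Y * (algebraMap ℂ A w - (Z - a • Q)) = 1 - Q := by
    rcases hw with hw | rfl
    · obtain ⟨u, hu⟩ := spectrum.mem_resolventSet_iff.1 hw
      exact ⟨_, h.pieces_of_unit (C := u) (h.commute_shift w a) (by rw [hu]; exact h.commute_compl w)
        (by rw [hu, h.shift_mul_compl])⟩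
    · obtain ⟨S, hSQ, hS1, hS2⟩ := h.inv
      have h1 : Commute S (1 - Q) := (Commute.one_right _).sub_right hSQ
      have h2 : Commute (algebraMap ℂ A w - (Z - a • Q)) (1 - Q) :=
        (Commute.one_right _).sub_right (h.commute_shift w a)
      refine ⟨S * (1 - Q), ?_, ?_⟩
      · rw [h1.eq, ← mul_assoc, h.shift_mul_compl, mul_assoc, ← h1.eq, ← mul_assoc, hS1,
          h.compl_idem]
      · rw [mul_assoc, ← h2.eq, h.shift_mul_compl, ← mul_assoc, hS2, h.compl_idem]
  have := h.isUnit_of_pieces hb hm (h.commute_shift w a) (h.shift_mul w a) hY1 hY2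
  exact spectrum.mem_resolventSet_of_left_right_inverse this.1 this.2

/-- This is the Laurent decomposition of the resolvent at z: the first summand stays regular at z
once the shift has moved z away, the second is a finite principal part in powers of (w - z)⁻¹. -/
theorem inverse_eq_of_mem_resolventSet_shift (h : IsSpectralProjection Z z Q) {m : ℕ}
    (hm : (algebraMap ℂ A z - Z) ^ m * Q = 0) {a w : ℂ} (hwz : w ≠ z)
    (hw : w ∈ resolventSet ℂ (Z - a • Q)) :
    w ∈ resolventSet ℂ Z ∧ resolvent Z w = resolvent (Z - a • Q) w * (1 - Q) +
      nilpotentInverse (algebraMap ℂ A z - Z) m (w - z) * Q := by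
  obtain ⟨u, hu⟩ := spectrum.mem_resolventSet_iff.1 hw
  have h1 := h.pieces_of_unit (C := u) (h.commute_compl w) (by rw [hu]; exact h.commute_shift w a)
    (by rw [hu, h.shift_mul_compl])
  have h2 := h.isUnit_of_pieces (B := algebraMap ℂ A w - Z) (sub_ne_zero.2 hwz) hm
    (h.commute_compl w) (by rw [map_sub]; congr 1; abel) h1.1 h1.2
  have h3 := spectrum.mem_resolventSet_of_left_right_inverse h2.1 h2.2
  refine ⟨h3, ?_⟩
  obtain ⟨v, hv⟩ := spectrum.mem_resolventSet_iff.1 h3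
  rw [resolvent, resolvent, ← hu, ← hv, Ring.inverse_unit, Ring.inverse_unit]
  rw [← hv] at h2
  exact Units.inv_eq_of_mul_eq_one_right h2.1

end IsSpectralProjection

end NormedSpectralProjection

/-! ### Spectral projections from a parametrix -/

section DrazinOfFiniteRank

variable {X : Type u} [NormedAddCommGroup X] [NormedSpace ℂ X]

/-- T acts on the finite-dimensional range of P. Its characteristic polynomial there is X^m g with
g(0) ≠ 0, and g divided by g(0) has the form 1 + X k; Cayley–Hamilton gives the relation. -/
theorem exists_polynomial_annihilating {T P : X →L[ℂ] X} (hP : IsFiniteRank P)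
    (hTP : Commute T P) :
    ∃ (m : ℕ) (k : Polynomial ℂ), T ^ m * (1 + T * Polynomial.aeval T k) * P = 0 := by
  have hfd : FiniteDimensional ℂ (LinearMap.range (P : X →ₗ[ℂ] X)) := hP
  have hmap : ∀ x ∈ LinearMap.range (P : X →ₗ[ℂ] X), (T : X →ₗ[ℂ] X) x ∈
      LinearMap.range (P : X →ₗ[ℂ] X) := by
    rintro _ ⟨y, rfl⟩
    exact ⟨T y, (congrArg (fun B : X →L[ℂ] X => B y) hTP.eq).symm⟩
  set TV := (T : X →ₗ[ℂ] X).restrict hmap with hTV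
  have hae : ∀ (q : Polynomial ℂ) (v : LinearMap.range (P : X →ₗ[ℂ] X)),
      ((Polynomial.aeval TV q v : LinearMap.range (P : X →ₗ[ℂ] X)) : X) =
        Polynomial.aeval T q (v : X) := by
    intro q
    induction q using Polynomial.induction_on' with
    | add a b ha hb => intro v; simp [ha, hb]
    | monomial n a =>
      intro v
      rw [Polynomial.aeval_monomial, Polynomial.aeval_monomial]
      have : ∀ n : ℕ, (((TV ^ n) v : LinearMap.range (P : X →ₗ[ℂ] X)) : X) = (T ^ n) (v : X) := by
        intro n
        induction n with
        | zero => simp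
        | succ n ih =>
          rw [pow_succ', pow_succ', Module.End.mul_apply]
          change T ((TV ^ n) v : X) = T ((T ^ n) v)
          rw [ih]
      simp [this, Algebra.algebraMap_eq_smul_one]
  obtain ⟨g, hg, hnd⟩ := TV.charpoly.exists_eq_pow_rootMultiplicity_mul_and_not_dvd
    (LinearMap.charpoly_monic TV).ne_zero 0
  set m := TV.charpoly.rootMultiplicity 0
  rw [Polynomial.C_0, sub_zero] at hg hnd
  have hg0 : g.coeff 0 ≠ 0 := fun h => hnd (Polynomial.X_dvd_iff.2 h)
  refine ⟨m, Polynomial.C (g.coeff 0)⁻¹ * g.divX, ?_⟩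
  have h1 : (Polynomial.C (g.coeff 0)⁻¹ * TV.charpoly : Polynomial ℂ) =
      Polynomial.X ^ m * (1 + Polynomial.X * (Polynomial.C (g.coeff 0)⁻¹ * g.divX)) := by
    have h2 : (Polynomial.C (g.coeff 0)⁻¹ * Polynomial.C (g.coeff 0) : Polynomial ℂ) = 1 := by
      rw [← Polynomial.C_mul, inv_mul_cancel₀ hg0, Polynomial.C_1]
    have h3 := g.divX_mul_X_add
    rw [hg]
    linear_combination (Polynomial.X ^ m) * h2 -
      (Polynomial.C (g.coeff 0)⁻¹ * Polynomial.X ^ m) * h3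
  have h3 : T ^ m * (1 + T * Polynomial.aeval T (Polynomial.C (g.coeff 0)⁻¹ * g.divX)) =
      Polynomial.aeval T (Polynomial.C (g.coeff 0)⁻¹ * TV.charpoly) := by
    rw [h1]; simp
  rw [h3]
  ext x
  have := hae (Polynomial.C (g.coeff 0)⁻¹ * TV.charpoly) ⟨P x, x, rfl⟩
  rw [map_mul, LinearMap.aeval_self_charpoly, mul_zero] at this
  exact this.symm

/-- If `z - Z` is invertible modulo a finite rank operator, with a commuting parametrix, then there
is a spectral projection at `z`, of finite rank. -/
theorem exists_isSpectralProjection {Z S P : X →L[ℂ] X} {z : ℂ} (hP : IsFiniteRank P)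
    (h1 : (algebraMap ℂ (X →L[ℂ] X) z - Z) * S = 1 - P)
    (h2 : S * (algebraMap ℂ (X →L[ℂ] X) z - Z) = 1 - P) :
    ∃ Q, IsSpectralProjection Z z Q ∧ IsFiniteRank Q := by
  set T := algebraMap ℂ (X →L[ℂ] X) z - Z with hT
  have hTS : Commute T S := h1.trans h2.symm
  have hP' : P = 1 - T * S := by rw [h1]; abel
  have hTP : Commute T P := by
    rw [hP']
    exact (Commute.one_right T).sub_right ((Commute.refl T).mul_right hTS)
  obtain ⟨m, k, hk⟩ := exists_polynomial_annihilating hP hTP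
  set c := Polynomial.aeval T k
  have hcT : Commute T c := by
    have := Polynomial.commute_X k
    simpa using (this.map (Polynomial.aeval T)).symm.symm
  -- With P = 1 - TS, the relation T^m (1 + Tc) P = 0 rearranges to T^m = T^(m+1) D for this D.
  set D := (1 + T * c) * S - c with hD
  have hTD : Commute T D :=
    (((Commute.one_right T).add_right ((Commute.refl T).mul_right hcT)).mul_right hTS).sub_right hcT
  have hmD : T ^ m = T ^ (m + 1) * D := by
    have e : T ^ m * (1 + T * c) * (1 - T * S) = T ^ m - T ^ (m + 1) * D := by
      have h3 : (1 + T * c) * (T * S) = T * ((1 + T * c) * S) := by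
        rw [← mul_assoc, ← mul_assoc, ((Commute.one_right T).add_right
          ((Commute.refl T).mul_right hcT)).eq]
      rw [mul_sub, mul_one, mul_assoc, h3, hD, pow_succ, mul_sub, mul_add, mul_one,
        mul_assoc (T ^ m), mul_assoc (T ^ m)]
      abel
    rw [hP', e] at hk
    exact sub_eq_zero.1 hk
  have hQ := isSpectralProjection_of_drazin hTD hmD
  refine ⟨_, hQ, ?_⟩
  obtain ⟨j, hj⟩ := hQ.nilp
  -- Since (1 - P)^j = S^j T^j kills Q and has the form 1 - PB, one gets Q = PBQ, which has finite
  -- rank.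
  have hS : (1 - P) ^ j * (1 - T ^ m * D ^ m) = 0 := by
    rw [← h2, hTS.symm.mul_pow, mul_assoc, hj, mul_zero]
  have hB : ∀ j : ℕ, ∃ B, (1 - P) ^ j = 1 - P * B := by
    intro j
    induction j with
    | zero => exact ⟨0, by simp⟩
    | succ j ih =>
      obtain ⟨B, hB⟩ := ih
      refine ⟨B + (1 - P * B), ?_⟩
      rw [pow_succ', hB]
      noncomm_ring
  obtain ⟨B, hB⟩ := hB j
  rw [hB, sub_mul, one_mul, sub_eq_zero, mul_assoc] at hS
  rw [hS]
  exact hP.mul_right _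

end DrazinOfFiniteRank

/-! ### Identification with the Riesz projection -/

section RieszProjection

variable {X : Type u} [NormedAddCommGroup X] [NormedSpace ℂ X]

theorem isolates_isolatingRadius {Z : X →L[ℂ] X} {z : ℂ} (h : ∃ r, Isolates Z z r) :
    Isolates Z z (isolatingRadius Z z) := by
  rw [isolatingRadius, dif_pos h]
  exact h.choose_spec

theorem Isolates.mem_resolventSet {Z : X →L[ℂ] X} {z w : ℂ} {r : ℝ} (h : Isolates Z z r)
    (hw : w ∈ Metric.closedBall z r) (hwz : w ≠ z) : w ∈ resolventSet ℂ Z := by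
  by_contra hc
  exact hwz (h.2 ⟨hw, hc⟩)

variable [CompleteSpace X]

theorem differentiableAt_resolvent {Z : X →L[ℂ] X} {w : ℂ} (hw : w ∈ resolventSet ℂ Z) :
    DifferentiableAt ℂ (resolvent Z) w :=
  (spectrum.hasDerivAt_resolvent_const_left hw).differentiableAt

theorem continuousOn_resolvent (Z : X →L[ℂ] X) :
    ContinuousOn (resolvent Z) (resolventSet ℂ Z) :=
  fun _ hw => (differentiableAt_resolvent hw).continuousAt.continuousWithinAt

/-- Subtracting Q moves z into the resolvent set, which is open; off z, membership carries back from
Z - Q to Z. -/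
theorem IsSpectralProjection.isolates {Z Q : X →L[ℂ] X} {z : ℂ}
    (h : IsSpectralProjection Z z Q) : ∃ r, Isolates Z z r := by
  obtain ⟨m, hm⟩ := h.nilp
  have h1 : z ∈ resolventSet ℂ (Z - (1 : ℂ) • Q) :=
    h.mem_resolventSet_shift (by simp) (Or.inr rfl)
  obtain ⟨r, hr, hsub⟩ := Metric.nhds_basis_closedBall.mem_iff.1
    ((spectrum.isOpen_resolventSet (𝕜 := ℂ) (Z - (1 : ℂ) • Q)).mem_nhds h1)
  refine ⟨r, hr, fun w ⟨hw, hws⟩ => ?_⟩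
  by_contra hne
  exact hws (h.inverse_eq_of_mem_resolventSet_shift hm hne (hsub hw)).1

/-- In the Laurent decomposition of the resolvent only the coefficient of (w - z)⁻¹, which is Q,
survives integration. In particular the spectral projection at z is unique. -/
theorem IsSpectralProjection.rieszProjection_eq {Z Q : X →L[ℂ] X} {z : ℂ}
    (h : IsSpectralProjection Z z Q) : rieszProjection Z z = Q := by
  obtain ⟨hr, hiso⟩ : Isolates Z z (isolatingRadius Z z) := isolates_isolatingRadius h.isolates
  set r := isolatingRadius Z z
  obtain ⟨m, hm⟩ := h.nilp
  -- The shift by 2r moves z to z - 2r, outside the closed disc, so the shifted resolvent is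
  -- holomorphic on all of it.
  have hmem : ∀ w ∈ Metric.closedBall z r,
      w ∈ resolventSet ℂ (Z - ((2 * r : ℝ) : ℂ) • Q) := by
    intro w hw
    refine h.mem_resolventSet_shift ?_ ?_
    · intro hc
      rw [mem_closedBall_iff_norm, ← hc] at hw
      simp only [sub_add_cancel_left, norm_neg, Complex.norm_real, Real.norm_eq_abs] at hw
      rw [abs_of_pos (by linarith)] at hw
      linarith
    · by_cases hwz : w = z
      · exact Or.inr hwz
      · refine Or.inl ?_
        by_contra hc
        exact hwz (hiso ⟨hw, hc⟩)
  have hint0 : (∮ w in C(z, r), resolvent (Z - ((2 * r : ℝ) : ℂ) • Q) w * (1 - Q)) = 0 := by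
    refine Complex.circleIntegral_eq_zero_of_differentiable_on_off_countable hr.le
      Set.countable_empty ?_ ?_
    · exact ((continuousOn_resolvent _).mono hmem).mul continuousOn_const
    · intro w hw
      exact (differentiableAt_resolvent (hmem w (Metric.ball_subset_closedBall hw.1))).mul_const _
  have hz : ∀ w ∈ Metric.sphere z r, w ≠ z := by
    rintro w hw rfl
    simp at hw
    linarith
  have hcont : ∀ k : ℕ, ContinuousOn (fun w : ℂ => ((w - z) ^ (k + 1))⁻¹ •
      ((-(algebraMap ℂ (X →L[ℂ] X) z - Z)) ^ k * Q)) (Metric.sphere z r) := fun k =>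
    (ContinuousOn.inv₀ (by fun_prop) fun w hw => pow_ne_zero _ (sub_ne_zero.2 (hz w hw))).smul
      continuousOn_const
  have hintk : ∀ k : ℕ, (∮ w in C(z, r), ((w - z) ^ (k + 1))⁻¹ •
      ((-(algebraMap ℂ (X →L[ℂ] X) z - Z)) ^ k * Q)) =
      if k = 0 then (2 * Real.pi * Complex.I : ℂ) • Q else 0 := by
    intro k
    rw [circleIntegral.integral_smul_const]
    split_ifs with hk
    · subst hk
      simp only [zero_add, pow_one, pow_zero, one_mul]
      rw [circleIntegral.integral_sub_center_inv z hr.ne']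
    · have : (fun w : ℂ => ((w - z) ^ (k + 1))⁻¹) = fun w => (w - z) ^ (-((k : ℤ) + 1)) := by
        ext w
        rw [zpow_neg]
        norm_cast
      rw [this, circleIntegral.integral_sub_zpow_of_ne (by lia), zero_smul]
  have heq : (∮ w in C(z, r), resolvent Z w) =
      (∮ w in C(z, r), (resolvent (Z - ((2 * r : ℝ) : ℂ) • Q) w * (1 - Q) +
        ∑ k ∈ Finset.range m, ((w - z) ^ (k + 1))⁻¹ •
          ((-(algebraMap ℂ (X →L[ℂ] X) z - Z)) ^ k * Q))) := by
    refine circleIntegral.integral_congr hr.le fun w hw => ?_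
    have := (h.inverse_eq_of_mem_resolventSet_shift hm (hz w hw)
      (hmem w (Metric.sphere_subset_closedBall hw))).2
    change resolvent Z w = _
    rw [this, nilpotentInverse, Finset.sum_mul]
    simp only [smul_mul_assoc]
  rw [rieszProjection, heq, circleIntegral.integral_add, hint0, zero_add,
    circleIntegral.integral_fun_sum]
  · simp_rw [hintk]
    rw [Finset.sum_ite_eq' (Finset.range m) 0]
    split_ifs with h0
    · rw [smul_smul, inv_mul_cancel₀ Complex.two_pi_I_ne_zero, one_smul]
    -- With nilpotency exponent 0 the principal part is empty, but then Q = 0.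
    · have : m = 0 := by simpa using h0
      subst this
      rw [pow_zero, one_mul] at hm
      rw [hm, smul_zero]
  · exact fun k _ => (hcont k).circleIntegrable hr.le
  · exact (((continuousOn_resolvent _).mono fun w hw =>
      hmem w (Metric.sphere_subset_closedBall hw)).mul continuousOn_const).circleIntegrable hr.le
  · exact (continuousOn_finsetSum _ fun k _ => hcont k).circleIntegrable hr.le

theorem circleIntegral_map {E F : Type*} [NormedAddCommGroup E] [NormedSpace ℂ E] [CompleteSpace E]
    [NormedAddCommGroup F] [NormedSpace ℂ F] [CompleteSpace F] (L : E →L[ℂ] F) {f : ℂ → E} {c : ℂ}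
    {r : ℝ} (hf : CircleIntegrable f c r) :
    L (∮ w in C(c, r), f w) = ∮ w in C(c, r), L (f w) := by
  rw [circleIntegral, circleIntegral, ← L.intervalIntegral_comp_comm hf.out]
  simp

/-- S is the normalized integral of (w - z)⁻¹ (w - Z)⁻¹. The identity (z - Z)(w - Z)⁻¹ = 1 - (w -
z)(w - Z)⁻¹ shows that S inverts z - Z modulo the Riesz integral, without knowing yet that the
latter is idempotent. -/
theorem exists_parametrix {Z : X →L[ℂ] X} {z : ℂ} {r : ℝ} (h : Isolates Z z r) :
    ∃ S, (algebraMap ℂ (X →L[ℂ] X) z - Z) * S =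
        1 - (2 * (Real.pi : ℂ) * Complex.I)⁻¹ • ∮ w in C(z, r), resolvent Z w ∧
      S * (algebraMap ℂ (X →L[ℂ] X) z - Z) =
        1 - (2 * (Real.pi : ℂ) * Complex.I)⁻¹ • ∮ w in C(z, r), resolvent Z w := by
  have hr := h.1
  have hz : ∀ w ∈ Metric.sphere z r, w ≠ z := by
    rintro w hw rfl
    simp at hw
    linarith
  have hmem : ∀ w ∈ Metric.sphere z r, w ∈ resolventSet ℂ Z := fun w hw =>
    h.mem_resolventSet (Metric.sphere_subset_closedBall hw) (hz w hw)
  have hc1 : ContinuousOn (resolvent Z) (Metric.sphere z r) := (continuousOn_resolvent Z).mono hmem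
  have hc2 : ContinuousOn (fun w : ℂ => (w - z)⁻¹) (Metric.sphere z r) :=
    ContinuousOn.inv₀ (by fun_prop) fun w hw => sub_ne_zero.2 (hz w hw)
  have hi1 := hc1.circleIntegrable hr.le
  have hi2 := (hc2.smul hc1).circleIntegrable hr.le
  have hi3 : CircleIntegrable (fun w : ℂ => (w - z)⁻¹ • (1 : X →L[ℂ] X)) z r :=
    (hc2.smul continuousOn_const).circleIntegrable hr.le
  have hval : (2 * (Real.pi : ℂ) * Complex.I)⁻¹ •
      (∮ w in C(z, r), ((w - z)⁻¹ • (1 : X →L[ℂ] X) - resolvent Z w)) =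
      1 - (2 * (Real.pi : ℂ) * Complex.I)⁻¹ • ∮ w in C(z, r), resolvent Z w := by
    rw [circleIntegral.integral_sub hi3 hi1, circleIntegral.integral_smul_const,
      circleIntegral.integral_sub_center_inv z hr.ne', smul_sub, smul_smul,
      inv_mul_cancel₀ Complex.two_pi_I_ne_zero, one_smul]
  have hsplit : ∀ w : ℂ, algebraMap ℂ (X →L[ℂ] X) z - Z =
      (algebraMap ℂ (X →L[ℂ] X) w - Z) - (w - z) • 1 := by
    intro w
    rw [Algebra.algebraMap_eq_smul_one, Algebra.algebraMap_eq_smul_one, sub_smul]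
    abel
  refine ⟨(2 * (Real.pi : ℂ) * Complex.I)⁻¹ • ∮ w in C(z, r), (w - z)⁻¹ • resolvent Z w, ?_, ?_⟩
  · rw [← hval, mul_smul_comm]
    congr 1
    refine (circleIntegral_map (ContinuousLinearMap.mul ℂ (X →L[ℂ] X)
      (algebraMap ℂ (X →L[ℂ] X) z - Z)) hi2).trans ?_
    refine circleIntegral.integral_congr hr.le fun w hw => ?_
    have hw0 : w - z ≠ 0 := sub_ne_zero.2 (hz w hw)
    change (algebraMap ℂ (X →L[ℂ] X) z - Z) * ((w - z)⁻¹ • resolvent Z w) = _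
    rw [hsplit w, mul_smul_comm, sub_mul, resolvent,
      Ring.mul_inverse_cancel _ (spectrum.mem_resolventSet_iff.1 (hmem w hw)), smul_sub,
      smul_mul_assoc, one_mul, smul_smul, inv_mul_cancel₀ hw0, one_smul]
  · rw [← hval, smul_mul_assoc]
    congr 1
    refine (circleIntegral_map ((ContinuousLinearMap.mul ℂ (X →L[ℂ] X)).flip
      (algebraMap ℂ (X →L[ℂ] X) z - Z)) hi2).trans ?_
    refine circleIntegral.integral_congr hr.le fun w hw => ?_
    have hw0 : w - z ≠ 0 := sub_ne_zero.2 (hz w hw)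
    change ((w - z)⁻¹ • resolvent Z w) * (algebraMap ℂ (X →L[ℂ] X) z - Z) = _
    rw [hsplit w, smul_mul_assoc, mul_sub, resolvent,
      Ring.inverse_mul_cancel _ (spectrum.mem_resolventSet_iff.1 (hmem w hw)), smul_sub,
      mul_smul_comm, mul_one, smul_smul, inv_mul_cancel₀ hw0, one_smul]

/-- The finite rank of the Riesz integral makes the parametrix yield some spectral projection; by
uniqueness it is the Riesz projection itself. -/
theorem isSpectralProjection_of_mem_discreteSpectrum {Z : X →L[ℂ] X} {z : ℂ}
    (hz : z ∈ discreteSpectrum Z) : IsSpectralProjection Z z (rieszProjection Z z) := by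
  obtain ⟨-, hiso, hfin⟩ := hz
  obtain ⟨S, h1, h2⟩ := exists_parametrix (isolates_isolatingRadius hiso)
  obtain ⟨Q, hQ, -⟩ := exists_isSpectralProjection hfin h1 h2
  rw [hQ.rieszProjection_eq]
  exact hQ

/-- An eigenvector is found in the range of (z - Z)^m Q, where m + 1 is the least exponent of
nilpotency. -/
theorem IsSpectralProjection.mem_discreteSpectrum {Z Q : X →L[ℂ] X} {z : ℂ}
    (h : IsSpectralProjection Z z Q) (hfin : IsFiniteRank Q) (h0 : Q ≠ 0) :
    z ∈ discreteSpectrum Z := by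
  refine ⟨?_, h.isolates, by rwa [h.rieszProjection_eq]⟩
  classical
  have hex := h.nilp
  have hm := Nat.find_spec hex
  obtain ⟨m, hm'⟩ : ∃ m, Nat.find hex = m + 1 := by
    refine Nat.exists_eq_succ_of_ne_zero fun h1 => h0 ?_
    rw [h1, pow_zero, one_mul] at hm
    exact hm
  have hlt := Nat.find_min hex (m := m) (by lia)
  rw [hm', pow_succ'] at hm
  obtain ⟨x, hx⟩ : ∃ x, ((algebraMap ℂ (X →L[ℂ] X) z - Z) ^ m * Q) x ≠ 0 := by
    by_contra! hc
    exact hlt (ContinuousLinearMap.ext hc)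
  refine Module.End.hasEigenvalue_of_hasEigenvector (x := ((algebraMap ℂ (X →L[ℂ] X) z - Z) ^ m * Q) x)
    ⟨Module.End.mem_eigenspace_iff.2 ?_, hx⟩
  have := congrArg (fun B : X →L[ℂ] X => B x) hm
  rw [mul_assoc] at this
  have h2 : algebraMap ℂ (X →L[ℂ] X) z (((algebraMap ℂ (X →L[ℂ] X) z - Z) ^ m * Q) x) -
      Z (((algebraMap ℂ (X →L[ℂ] X) z - Z) ^ m * Q) x) = 0 := this
  rw [Algebra.algebraMap_eq_smul_one] at h2
  exact (sub_eq_zero.1 h2).symm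

theorem IsSpectralProjection.algMult_eq {Z Q : X →L[ℂ] X} {z : ℂ}
    (h : IsSpectralProjection Z z Q) :
    algMult Z z = Module.finrank ℂ (LinearMap.range (Q : X →ₗ[ℂ] X)) := by
  rw [algMult, h.rieszProjection_eq]

end RieszProjection

/-! ### Discrete spectrum of finite rank operators and the bound (1) -/

section FiniteRankSpectrum

variable {X : Type u} [NormedAddCommGroup X] [NormedSpace ℂ X]

/-- For μ ≠ 0, μ⁻¹ inverts μ - F modulo the finite rank operator μ⁻¹F. The identity x = μ⁻¹((μ - F)x
+ Fx) puts every generalized eigenvector into Ran F, so Ran Q is the generalized eigenspace of the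
restriction, whose dimension the characteristic polynomial counts. -/
theorem exists_isSpectralProjection_of_finiteRank {F : X →L[ℂ] X} (hF : IsFiniteRank F) {μ : ℂ}
    (hμ : μ ≠ 0) : ∃ Q, IsSpectralProjection F μ Q ∧ IsFiniteRank Q ∧
      Module.finrank ℂ (LinearMap.range (Q : X →ₗ[ℂ] X)) = (eigenvalueMultiset F hF).count μ := by
  have e1 : (algebraMap ℂ (X →L[ℂ] X) μ - F) * (μ⁻¹ • 1) = 1 - μ⁻¹ • F := by
    rw [mul_smul_comm, mul_one, smul_sub, Algebra.algebraMap_eq_smul_one, smul_smul,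
      inv_mul_cancel₀ hμ, one_smul]
  have e2 : (μ⁻¹ • 1) * (algebraMap ℂ (X →L[ℂ] X) μ - F) = 1 - μ⁻¹ • F := by
    rw [smul_mul_assoc, one_mul, smul_sub, Algebra.algebraMap_eq_smul_one, smul_smul,
      inv_mul_cancel₀ hμ, one_smul]
  obtain ⟨Q, hQ, hQf⟩ := exists_isSpectralProjection (hF.smul μ⁻¹) e1 e2
  refine ⟨Q, hQ, hQf, ?_⟩
  have hfd : FiniteDimensional ℂ (LinearMap.range (F : X →ₗ[ℂ] X)) := hF
  have hpow : ∀ (k : ℕ) (x : LinearMap.range (F : X →ₗ[ℂ] X)),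
      (((restrictRange F - μ • (1 : Module.End ℂ (LinearMap.range (F : X →ₗ[ℂ] X)))) ^ k) x : X) =
        (-1 : ℂ) ^ k • ((algebraMap ℂ (X →L[ℂ] X) μ - F) ^ k) (x : X) := by
    intro k
    induction k with
    | zero => intro x; simp
    | succ k ih =>
      intro x
      rw [pow_succ, Module.End.mul_apply, ih, pow_succ (algebraMap ℂ (X →L[ℂ] X) μ - F),
        pow_succ (-1 : ℂ), mul_smul, mul_apply_eq_comp]
      congr 1
      rw [← map_smul]
      congr 1
      rw [Algebra.algebraMap_eq_smul_one]
      simp [restrictRange]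
  have hker : ∀ (k : ℕ) (x : X), ((algebraMap ℂ (X →L[ℂ] X) μ - F) ^ k) x = 0 →
      x ∈ LinearMap.range (F : X →ₗ[ℂ] X) := by
    intro k
    induction k with
    | zero => intro x hx; rw [show x = 0 by simpa using hx]; exact Submodule.zero_mem _
    | succ k ih =>
      intro x hx
      rw [pow_succ] at hx
      have h1 := ih _ hx
      have h2 : x = μ⁻¹ • ((algebraMap ℂ (X →L[ℂ] X) μ - F) x + F x) := by
        rw [Algebra.algebraMap_eq_smul_one]
        simp [smul_smul, hμ]
      rw [h2]
      exact Submodule.smul_mem _ _ (Submodule.add_mem _ h1 ⟨x, rfl⟩)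
  have hrange : LinearMap.range (Q : X →ₗ[ℂ] X) =
      (Module.End.maxGenEigenspace (restrictRange F) μ).map
        (LinearMap.range (F : X →ₗ[ℂ] X)).subtype := by
    apply le_antisymm
    · rintro _ ⟨y, rfl⟩
      obtain ⟨m, hm⟩ := hQ.nilp
      have h1 : ((algebraMap ℂ (X →L[ℂ] X) μ - F) ^ m) (Q y) = 0 :=
        congrArg (fun B : X →L[ℂ] X => B y) hm
      refine ⟨⟨Q y, hker m _ h1⟩, ?_, rfl⟩
      refine Module.End.mem_maxGenEigenspace _ _ _ |>.2 ⟨m, Subtype.ext ?_⟩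
      rw [hpow]
      simp [h1]
    · rintro _ ⟨x, hx, rfl⟩
      obtain ⟨k, hk⟩ := Module.End.mem_maxGenEigenspace _ _ _ |>.1 hx
      have h1 := hpow k x
      rw [hk, Submodule.coe_zero, eq_comm, smul_eq_zero_iff_right (by simp)] at h1
      obtain ⟨S, -, hS1, hS2⟩ := hQ.inv
      have h2 : S ^ (k + 1) * (algebraMap ℂ (X →L[ℂ] X) μ - F) ^ (k + 1) = 1 - Q := by
        have hc : Commute S (algebraMap ℂ (X →L[ℂ] X) μ - F) := hS2.trans hS1.symm
        have hi : IsIdempotentElem (1 - Q) := hQ.compl_idem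
        rw [← hc.mul_pow, hS2, hi.pow_succ_eq]
      have h3 : (1 - Q) (x : X) = 0 := by
        rw [← h2, pow_succ' (algebraMap ℂ (X →L[ℂ] X) μ - F), mul_apply_eq_comp,
          mul_apply_eq_comp, h1, map_zero, map_zero]
      exact ⟨x, (sub_eq_zero.1 h3).symm⟩
  rw [hrange, Submodule.finrank_map_subtype_eq, LinearMap.finrank_maxGenEigenspace_eq,
    eigenvalueMultiset, Polynomial.count_roots]

/-- A rank one operator with a prescribed eigenvalue. -/
theorem exists_eigenvalueMultiset_eq [Nontrivial X] (u : ℂ) (hu : u ≠ 0) :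
    ∃ (F : X →L[ℂ] X) (hF : IsFiniteRank F), eigenvalueMultiset F hF = {u} := by
  obtain ⟨x, hx⟩ := exists_ne (0 : X)
  obtain ⟨f, -, hf⟩ := exists_dual_vector ℂ x (norm_ne_zero_iff.2 hx)
  have hf2 : f x = (‖x‖ : ℂ) := hf
  have hx0 : (‖x‖ : ℂ) ≠ 0 := by simpa using hx
  set F : X →L[ℂ] X := (u * (‖x‖ : ℂ)⁻¹) • f.smulRight x with hFdef
  have hFx : F x = u • x := by
    rw [hFdef, smul_apply, ContinuousLinearMap.smulRight_apply, hf2, smul_smul,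
      mul_assoc, inv_mul_cancel₀ hx0, mul_one]
  have hFa : ∀ y, F y = (u * (‖x‖ : ℂ)⁻¹ * f y) • x := by
    intro y; simp [hFdef, smul_smul]
  have hrange : LinearMap.range (F : X →ₗ[ℂ] X) = ℂ ∙ x := by
    apply le_antisymm
    · rintro _ ⟨y, rfl⟩
      exact Submodule.mem_span_singleton.2 ⟨_, (hFa y).symm⟩
    · rw [Submodule.span_singleton_le_iff_mem]
      exact ⟨u⁻¹ • x, by simp [hFx, smul_smul, hu]⟩
  have hF : IsFiniteRank F := isFiniteRank_of_range_le hrange.le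
  refine ⟨F, hF, ?_⟩
  have hfd : FiniteDimensional ℂ (LinearMap.range (F : X →ₗ[ℂ] X)) := hF
  have hone : Module.finrank ℂ (LinearMap.range (F : X →ₗ[ℂ] X)) = 1 := by
    rw [hrange]; exact finrank_span_singleton hx
  have hcard : Multiset.card (eigenvalueMultiset F hF) = 1 := by
    rw [← hone, ← (restrictRange F).charpoly_natDegree]
    exact (Polynomial.splits_iff_card_roots.1 (IsAlgClosed.splits _))
  obtain ⟨v, hv⟩ := Multiset.card_eq_one.1 hcard
  have hmem : u ∈ eigenvalueMultiset F hF := by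
    refine (Polynomial.mem_roots (LinearMap.charpoly_monic (restrictRange F)).ne_zero).2
      ((Module.End.hasEigenvalue_iff_isRoot_charpoly _ _).1 ?_)
    have hxr : x ∈ LinearMap.range (F : X →ₗ[ℂ] X) := by
      rw [hrange]; exact Submodule.mem_span_singleton_self x
    refine Module.End.hasEigenvalue_of_hasEigenvector (x := ⟨x, hxr⟩)
      ⟨Module.End.mem_eigenspace_iff.2 (Subtype.ext hFx), fun h => hx (congrArg Subtype.val h)⟩
  rw [hv] at hmem ⊢
  rw [Multiset.mem_singleton.1 hmem]

variable [CompleteSpace X]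

/-- This links the multiplicities defined by Riesz projections to the roots of the characteristic
polynomial. The point 0 has weight 0, and a nonzero point outside the discrete spectrum has zero
spectral projection, so it is not a root. -/
theorem eigenvaluePowerSum_eq {F : X →L[ℂ] X} (hF : IsFiniteRank F) {p : ℝ} (hp : 0 < p) :
    eigenvaluePowerSum p F =
      ENNReal.ofReal ((eigenvalueMultiset F hF).map fun μ => ‖μ‖ ^ p).sum := by
  classical
  have key : (discreteSpectrum F).indicator (fun z : ℂ => (algMult F z : ℝ≥0∞) *
      ENNReal.ofReal (‖z‖ ^ p)) = fun z : ℂ => ((eigenvalueMultiset F hF).count z : ℝ≥0∞) *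
      ENNReal.ofReal (‖z‖ ^ p) := by
    ext z
    rcases eq_or_ne z 0 with rfl | hz
    · simp [Real.zero_rpow hp.ne', Set.indicator_apply]
    obtain ⟨Q, hQ, hQf, hQr⟩ := exists_isSpectralProjection_of_finiteRank hF hz
    by_cases hd : z ∈ discreteSpectrum F
    · rw [Set.indicator_of_mem hd, hQ.algMult_eq, hQr]
    · rw [Set.indicator_of_notMem hd]
      have hQ0 : Q = 0 := by
        by_contra h0
        exact hd (hQ.mem_discreteSpectrum hQf h0)
      have h0 : Module.finrank ℂ (LinearMap.range ((0 : X →L[ℂ] X) : X →ₗ[ℂ] X)) = 0 := by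
        rw [ContinuousLinearMap.toLinearMap_zero, LinearMap.range_zero, finrank_bot]
      rw [← hQr, hQ0, h0]
      simp
  rw [eigenvaluePowerSum, tsum_subtype (discreteSpectrum F) (fun z : ℂ => (algMult F z : ℝ≥0∞) *
    ENNReal.ofReal (‖z‖ ^ p)), key, tsum_eq_sum (s := (eigenvalueMultiset F hF).toFinset),
    Finset.sum_multiset_map_count, ENNReal.ofReal_sum_of_nonneg]
  · refine Finset.sum_congr rfl fun z _ => ?_
    rw [nsmul_eq_mul, ENNReal.ofReal_mul (by positivity), ENNReal.ofReal_natCast]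
  · intro z _
    positivity
  · intro z hz
    rw [Multiset.mem_toFinset, ← Multiset.count_eq_zero] at hz
    simp [hz]

theorem toReal_eigenvaluePowerSum {F : X →L[ℂ] X} (hF : IsFiniteRank F) {p : ℝ} (hp : 0 < p) :
    (eigenvaluePowerSum p F).toReal = ((eigenvalueMultiset F hF).map fun μ => ‖μ‖ ^ p).sum := by
  rw [eigenvaluePowerSum_eq hF hp, ENNReal.toReal_ofReal]
  refine Multiset.sum_nonneg fun x hx => ?_
  obtain ⟨μ, -, rfl⟩ := Multiset.mem_map.1 hx
  positivity

theorem norm_prod_primaryFactor_le {p Γ : ℝ}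
    (h : ∀ u : ℂ, ‖primaryFactor ⌈p⌉₊ u‖ ≤ Real.exp (Γ * ‖u‖ ^ p)) (s : Multiset ℂ) :
    ‖(s.map (primaryFactor ⌈p⌉₊)).prod‖ ≤ Real.exp (Γ * (s.map fun μ => ‖μ‖ ^ p).sum) := by
  induction s using Multiset.induction_on with
  | empty => simp
  | cons a s ih =>
    rw [Multiset.map_cons, Multiset.prod_cons, Multiset.map_cons, Multiset.sum_cons, mul_add,
      Real.exp_add, norm_mul]
    exact mul_le_mul (h a) ih (norm_nonneg _) (Real.exp_nonneg _)

theorem isDetConstant_of_primaryFactor_le {p Γ : ℝ} (hp : 0 < p) (hΓ : 0 < Γ)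
    (h : ∀ u : ℂ, ‖primaryFactor ⌈p⌉₊ u‖ ≤ Real.exp (Γ * ‖u‖ ^ p)) : IsDetConstant X p Γ := by
  refine ⟨hΓ, fun F hF => ?_⟩
  rw [toReal_eigenvaluePowerSum hF hp, finRegDet_eq_prod hF]
  exact norm_prod_primaryFactor_le h _

/-- A rank one operator with eigenvalue u turns the operator inequality into the scalar one. The
Hadamard argument can then use any admissible constant of the given space. -/
theorem IsDetConstant.norm_primaryFactor_le [Nontrivial X] {p Γ : ℝ} (hp : 0 < p)
    (h : IsDetConstant X p Γ) (u : ℂ) : ‖primaryFactor ⌈p⌉₊ u‖ ≤ Real.exp (Γ * ‖u‖ ^ p) := by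
  rcases eq_or_ne u 0 with rfl | hu
  · simp [Real.zero_rpow hp.ne']
  obtain ⟨F, hF, hm⟩ := exists_eigenvalueMultiset_eq (X := X) u hu
  have := h.2 F hF
  rw [toReal_eigenvaluePowerSum hF hp, finRegDet_eq_prod hF, hm] at this
  simpa using this

end FiniteRankSpectrum

/-! ### Holomorphic dependence in finite rank -/

section Holomorphy

theorem differentiableAt_det {ι : Type*} [Fintype ι] [DecidableEq ι] {M : ℂ → Matrix ι ι ℂ}
    {z : ℂ} (hM : ∀ i j, DifferentiableAt ℂ (fun w => M w i j) z) :
    DifferentiableAt ℂ (fun w => (M w).det) z := by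
  simp_rw [Matrix.det_apply]
  refine DifferentiableAt.fun_sum fun σ _ => DifferentiableAt.const_smul ?_ _
  exact DifferentiableAt.fun_finsetProd fun i _ => hM _ _

theorem differentiableAt_matrix_pow {ι : Type*} [Fintype ι] [DecidableEq ι]
    {M : ℂ → Matrix ι ι ℂ} {z : ℂ} (hM : ∀ i j, DifferentiableAt ℂ (fun w => M w i j) z) (k : ℕ) :
    ∀ i j, DifferentiableAt ℂ (fun w => (M w ^ k) i j) z := by
  induction k with
  | zero => intro i j; simp
  | succ k ih =>
    intro i j
    simp_rw [pow_succ, Matrix.mul_apply]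
    exact DifferentiableAt.fun_sum fun l _ => (ih i l).mul (hM l j)

variable {X : Type u} [NormedAddCommGroup X] [NormedSpace ℂ X]

/-- In a basis of the common subspace W the determinant and the traces are polynomials in the matrix
entries, and the entries depend holomorphically on w through a continuous projection onto W. -/
theorem differentiableAt_finRegDet (p : ℝ) {Φ : ℂ → X →L[ℂ] X} {W : Submodule ℂ X}
    [FiniteDimensional ℂ W] (hW : ∀ w, LinearMap.range (Φ w : X →ₗ[ℂ] X) ≤ W) {z : ℂ}
    (hΦ : DifferentiableAt ℂ Φ z) : DifferentiableAt ℂ (fun w => finRegDet p (Φ w)) z := by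
  classical
  obtain ⟨π, hπ⟩ := Submodule.ClosedComplemented.of_finiteDimensional W
  let b := Module.finBasis ℂ W
  have hM : ∀ i j, DifferentiableAt ℂ
      (fun w => LinearMap.toMatrixAlgEquiv b (restrictTo W (Φ w) (hW w)) i j) z := by
    intro i j
    have : ∀ w, LinearMap.toMatrixAlgEquiv b (restrictTo W (Φ w) (hW w)) i j =
        (LinearMap.toContinuousLinearMap (b.coord i)) (π (Φ w (b j : X))) := by
      intro w
      rw [LinearMap.toMatrixAlgEquiv_apply]
      have : π (Φ w (b j : X)) = restrictTo W (Φ w) (hW w) (b j) :=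
        hπ (restrictTo W (Φ w) (hW w) (b j))
      rw [this]
      rfl
    simp_rw [this]
    exact (ContinuousLinearMap.differentiableAt _).comp z ((ContinuousLinearMap.differentiableAt π).comp z
      (hΦ.clm_apply (differentiableAt_const _)))
  have e1 : ∀ w, LinearMap.det (LinearMap.id - restrictTo W (Φ w) (hW w)) =
      (1 - LinearMap.toMatrixAlgEquiv b (restrictTo W (Φ w) (hW w))).det := by
    intro w
    rw [← LinearMap.det_toMatrix b, map_sub, LinearMap.toMatrix_id]
    rfl
  have e2 : ∀ (k : ℕ) (w : ℂ), LinearMap.trace ℂ W (restrictTo W (Φ w) (hW w) ^ k) =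
      ∑ i, ((LinearMap.toMatrixAlgEquiv b (restrictTo W (Φ w) (hW w))) ^ k) i i := by
    intro k w
    rw [LinearMap.trace_eq_matrix_trace ℂ b, ← map_pow]
    rfl
  simp_rw [fun w => finRegDet_eq (hW w) p, e1, e2]
  refine DifferentiableAt.mul (differentiableAt_det fun i j => ?_) (DifferentiableAt.cexp ?_)
  · simp only [Matrix.sub_apply]
    exact (differentiableAt_const _).sub (hM i j)
  · exact DifferentiableAt.fun_sum fun k _ => (differentiableAt_const _).mul
      (DifferentiableAt.fun_sum fun i _ => differentiableAt_matrix_pow hM k i i)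

end Holomorphy

/-! ### Lipschitz estimate in the quasi-norm -/

section IdealEstimates

variable {X : Type u} [NormedAddCommGroup X] [NormedSpace ℂ X]
  {p γ : ℝ} {I : Submodule ℂ (X →L[ℂ] X)} {N : I → ℝ}

theorem IsQuasiNorm.neg {V : Type u} [AddCommGroup V] [Module ℂ V] {N : V → ℝ}
    (h : IsQuasiNorm N) (x : V) : N (-x) = N x := by
  rw [← neg_one_smul ℂ x, h.smul]; simp

theorem IsQuasiNorm.sub_comm {V : Type u} [AddCommGroup V] [Module ℂ V] {N : V → ℝ}
    (h : IsQuasiNorm N) (x y : V) : N (x - y) = N (y - x) := by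
  rw [← h.neg, neg_sub]

theorem IsLpIdeal.mul_right_le (h : IsLpIdeal p γ I N) (L : I) (B : X →L[ℂ] X) :
    N ⟨(L : X →L[ℂ] X) * B, h.mul_right_mem L B⟩ ≤ N L * ‖B‖ := by
  have h1 := h.quasiNorm_mul_le 1 L B
  simp only [one_mul] at h1
  refine h1.trans ?_
  have h2 : ‖(1 : X →L[ℂ] X)‖ ≤ 1 := ContinuousLinearMap.norm_id_le
  have h3 := h.quasiNorm.nonneg L
  gcongr
  exact mul_le_of_le_one_left h3 h2

/-- No sign of γ is part of the definition, so `max γ 0` stands in for it until a nonzero space is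
seen to force γ ≥ 0. -/
theorem IsLpIdeal.eigenvaluePowerSum_le (h : IsLpIdeal p γ I N) (hp : 0 < p) (L : I) :
    eigenvaluePowerSum p (L : X →L[ℂ] X) ≤ ENNReal.ofReal ((max γ 0 * N L) ^ p) := by
  have h1 := h.eigenvalue_le L
  have h2 : ENNReal.ofReal (γ * N L) ≤ ENNReal.ofReal (max γ 0 * N L) :=
    ENNReal.ofReal_le_ofReal (mul_le_mul_of_nonneg_right (le_max_left _ _) (h.quasiNorm.nonneg L))
  have h3 := ENNReal.rpow_le_rpow (h1.trans h2) hp.le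
  rw [← ENNReal.rpow_mul, one_div_mul_cancel hp.ne', ENNReal.rpow_one] at h3
  rwa [← ENNReal.ofReal_rpow_of_nonneg (mul_nonneg (le_max_right _ _) (h.quasiNorm.nonneg L)) hp.le]

theorem IsLpIdeal.toReal_eigenvaluePowerSum_le (h : IsLpIdeal p γ I N) (hp : 0 < p) (L : I) :
    (eigenvaluePowerSum p (L : X →L[ℂ] X)).toReal ≤ (max γ 0 * N L) ^ p :=
  ENNReal.toReal_le_of_le_ofReal
    (Real.rpow_nonneg (mul_nonneg (le_max_right _ _) (h.quasiNorm.nonneg L)) p)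
    (h.eigenvaluePowerSum_le hp L)

theorem IsLpIdeal.norm_finRegDet_le (h : IsLpIdeal p γ I N) (hp : 0 < p) {Γ : ℝ}
    (hΓ : IsDetConstant X p Γ) {F : I} (hF : IsFiniteRank (F : X →L[ℂ] X)) :
    ‖finRegDet p (F : X →L[ℂ] X)‖ ≤ Real.exp (Γ * (max γ 0 * N F) ^ p) := by
  refine (hΓ.2 F hF).trans (Real.exp_le_exp.2 ?_)
  exact mul_le_mul_of_nonneg_left (h.toReal_eigenvaluePowerSum_le hp F) hΓ.1.le

/-- Schwarz lemma for t ↦ det_p(I - G - t(F - G)) on the disc of radius 1/δ, δ = N(F - G): there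
N(t(F - G)) ≤ 1, so the function is bounded by B, and its values at 1 and 0 differ by at most 2Bδ.
-/
theorem IsLpIdeal.exists_lipschitz (h : IsLpIdeal p γ I N) (hp : 0 < p) {Γ : ℝ}
    (hΓ : IsDetConstant X p Γ) (r : ℝ) :
    ∃ C : ℝ, 0 ≤ C ∧ ∀ F G : I, IsFiniteRank (F : X →L[ℂ] X) → IsFiniteRank (G : X →L[ℂ] X) →
      N F ≤ r → N G ≤ r →
      ‖finRegDet p (F : X →L[ℂ] X) - finRegDet p (G : X →L[ℂ] X)‖ ≤ C * N (F - G) := by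
  obtain ⟨q, hq1, hq⟩ := h.quasiNorm.quasi_triangle
  set B := Real.exp (Γ * (max γ 0 * (q * (r + 1))) ^ p) with hB
  have hγ : 0 ≤ max γ 0 := le_max_right _ _
  have hbd : ∀ F : I, IsFiniteRank (F : X →L[ℂ] X) → N F ≤ q * (r + 1) →
      ‖finRegDet p (F : X →L[ℂ] X)‖ ≤ B := by
    intro F hF hN
    refine (h.norm_finRegDet_le hp hΓ hF).trans (Real.exp_le_exp.2 ?_)
    have h1 := h.quasiNorm.nonneg F
    have h2 := hΓ.1.le
    gcongr
  refine ⟨2 * B, by positivity, fun F G hF hG hFr hGr => ?_⟩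
  have hr : 0 ≤ r := (h.quasiNorm.nonneg F).trans hFr
  have hqr : r ≤ q * (r + 1) := by nlinarith
  set δ := N (F - G) with hδ
  have hδ0 : 0 ≤ δ := h.quasiNorm.nonneg _
  rcases hδ0.eq_or_lt with h0 | hpos
  · have : F - G = 0 := (h.quasiNorm.eq_zero_iff _).1 h0.symm
    rw [sub_eq_zero.1 this]
    simp [← h0]
  -- The point 1 lies in the disc of radius 1/δ only if δ < 1; otherwise the bound B + B already
  -- suffices.
  rcases le_or_gt 1 δ with h1 | h1
  · calc _ ≤ B + B := (norm_sub_le _ _).trans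
          (add_le_add (hbd F hF (hFr.trans hqr)) (hbd G hG (hGr.trans hqr)))
      _ = 2 * B * 1 := by ring
      _ ≤ _ := by gcongr
  · set f : ℂ → ℂ := fun t => finRegDet p ((G + t • (F - G) : I) : X →L[ℂ] X) with hf
    have hfin : ∀ t : ℂ, IsFiniteRank ((G + t • (F - G) : I) : X →L[ℂ] X) := fun t =>
      hG.add ((hF.sub hG).smul t)
    have hfb : ∀ t ∈ Metric.ball (0 : ℂ) (1 / δ), ‖f t‖ ≤ B := by
      intro t ht
      refine hbd _ (hfin t) ((hq _ _).trans ?_)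
      rw [h.quasiNorm.smul]
      have ht' : ‖t‖ * δ ≤ 1 := by
        rw [mem_ball_zero_iff, lt_div_iff₀ hpos] at ht
        exact ht.le
      have : (0 : ℝ) ≤ q := by linarith
      gcongr
    obtain ⟨W, _, hWF, hWG⟩ := hF.exists_common hG
    have hd : Differentiable ℂ f := fun t =>
      differentiableAt_finRegDet p (W := W)
        (Φ := fun t => (G : X →L[ℂ] X) + t • ((F : X →L[ℂ] X) - (G : X →L[ℂ] X)))
        (fun w => range_add_le hWG (range_smul_le w (range_sub_le hWF hWG))) (by fun_prop)
    have h10 : (1 : ℂ) ∈ Metric.ball (0 : ℂ) (1 / δ) := by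
      rw [mem_ball_zero_iff, norm_one, lt_div_iff₀ hpos]; linarith
    -- With `n := 0` this is the ordinary Schwarz estimate, centred at f 0; the little-o condition
    -- is just continuity at 0.
    have hS := Complex.dist_le_mul_div_pow_of_mapsTo_ball_of_isLittleO (n := 0) (f := f) (c := 0)
      (R₁ := 1 / δ) (R₂ := 2 * B) hd.differentiableOn (fun t ht => ?_) ?_ h10
    · have e1 : f 1 = finRegDet p (F : X →L[ℂ] X) := by simp [hf]
      have e0 : f 0 = finRegDet p (G : X →L[ℂ] X) := by simp [hf]
      rw [e1, e0, dist_eq_norm] at hS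
      simpa using hS
    · rw [mem_closedBall_iff_norm]
      have := norm_sub_le (f t) (f 0)
      linarith [hfb t ht, hfb 0 (Metric.mem_ball_self (by positivity))]
    · simp only [pow_zero]
      rw [Asymptotics.isLittleO_one_iff]
      have := (hd.continuous.tendsto 0).sub_const (f 0)
      simpa using this

end IdealEstimates

/-! ### Continuous extension to the ideal and analyticity -/

section Extension

variable {X : Type u} [NormedAddCommGroup X] [NormedSpace ℂ X]
  {p γ : ℝ} {I : Submodule ℂ (X →L[ℂ] X)} {N : I → ℝ}

theorem IsLpIdeal.exists_seq (h : IsLpIdeal p γ I N) (L : I) :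
    ∃ F : ℕ → I, (∀ n, IsFiniteRank (F n : X →L[ℂ] X)) ∧
      Tendsto (fun n => N (F n - L)) atTop (𝓝 0) := by
  choose F hF hN using fun n : ℕ => h.finiteRank_dense L (1 / (n + 1)) (by positivity)
  refine ⟨F, hF, squeeze_zero (fun n => h.quasiNorm.nonneg _) (fun n => ?_)
    tendsto_one_div_add_atTop_nhds_zero_nat⟩
  rw [h.quasiNorm.sub_comm]
  exact (hN n).le

/-- A quasi-norm need not be continuous in its own topology, so approximants are controlled only up
to the factor q. -/
theorem eventually_quasiNorm_le {L : I} {F : ℕ → I}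
    (hF : Tendsto (fun n => N (F n - L)) atTop (𝓝 0)) {q : ℝ} (hq1 : 1 ≤ q)
    (hq : ∀ x y, N (x + y) ≤ q * (N x + N y)) {ε : ℝ} (hε : 0 < ε) :
    ∀ᶠ n in atTop, N (F n) ≤ q * (N L + ε) := by
  filter_upwards [hF.eventually (ge_mem_nhds hε)] with n hn
  have h1 := hq (F n - L) L
  rw [sub_add_cancel] at h1
  have : (0 : ℝ) ≤ q := by linarith
  calc N (F n) ≤ q * (N (F n - L) + N L) := h1
    _ ≤ q * (N L + ε) := mul_le_mul_of_nonneg_left (by linarith) this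

/-- The Lipschitz estimate on quasi-balls is kept along with the extension; it later gives the
uniform convergence behind analyticity. -/
theorem IsLpIdeal.exists_regDetExtension (h : IsLpIdeal p γ I N) (hp : 0 < p) {Γ : ℝ}
    (hΓ : IsDetConstant X p Γ) :
    ∃ d : I → ℂ, (∀ F : I, IsFiniteRank (F : X →L[ℂ] X) → d F = finRegDet p (F : X →L[ℂ] X)) ∧
      ∀ r : ℝ, ∃ C : ℝ, 0 ≤ C ∧ ∀ L M : I, N L ≤ r → N M ≤ r →
        ‖d L - d M‖ ≤ C * N (L - M) := by
  obtain ⟨q, hq1, hq⟩ := h.quasiNorm.quasi_triangle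
  have hq0 : (0 : ℝ) ≤ q := by linarith
  have hcauchy : ∀ (L : I) (F : ℕ → I), (∀ n, IsFiniteRank (F n : X →L[ℂ] X)) →
      Tendsto (fun n => N (F n - L)) atTop (𝓝 0) →
      ∃ z, Tendsto (fun n => finRegDet p (F n : X →L[ℂ] X)) atTop (𝓝 z) := by
    intro L F hF hL
    obtain ⟨C, hC, hlip⟩ := h.exists_lipschitz hp hΓ (q * (N L + 1))
    refine cauchySeq_tendsto_of_complete ?_
    obtain ⟨n₀, hn₀⟩ := eventually_atTop.1 (eventually_quasiNorm_le hL hq1 hq one_pos)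
    rw [Metric.cauchySeq_iff]
    intro ε hε
    have hε' : 0 < ε / (2 * (C * q + 1)) := by positivity
    obtain ⟨n₁, hn₁⟩ := eventually_atTop.1 (hL.eventually (gt_mem_nhds hε'))
    refine ⟨max n₀ n₁, fun m hm n hn => ?_⟩
    rw [dist_eq_norm]
    have h1 := hlip (F m) (F n) (hF m) (hF n) (hn₀ m ((le_max_left _ _).trans hm))
      (hn₀ n ((le_max_left _ _).trans hn))
    have h2 := hq (F m - L) (L - F n)
    rw [sub_add_sub_cancel, h.quasiNorm.sub_comm L] at h2
    have h3 := hn₁ m ((le_max_right _ _).trans hm)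
    have h4 := hn₁ n ((le_max_right _ _).trans hn)
    calc _ ≤ C * N (F m - F n) := h1
      _ ≤ C * (q * (N (F m - L) + N (F n - L))) := by gcongr
      _ ≤ C * (q * (ε / (2 * (C * q + 1)) + ε / (2 * (C * q + 1)))) := by gcongr
      _ = ε * ((C * q) / (C * q + 1)) := by field_simp; ring
      _ < ε * 1 := by
        gcongr
        rw [div_lt_one (by positivity)]
        linarith
      _ = ε := mul_one ε
  choose F hF hL using h.exists_seq
  choose d hd using fun L => hcauchy L (F L) (hF L) (hL L)
  -- Limits along arbitrary approximating sequences are compared at once: a constant sequence gives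
  -- the values at finite rank operators, the chosen sequences give the Lipschitz estimate.
  have hlip' : ∀ r : ℝ, ∃ C : ℝ, 0 ≤ C ∧ ∀ (L M : I) (F G : ℕ → I) (a b : ℂ),
      (∀ n, IsFiniteRank (F n : X →L[ℂ] X)) → (∀ n, IsFiniteRank (G n : X →L[ℂ] X)) →
      Tendsto (fun n => N (F n - L)) atTop (𝓝 0) → Tendsto (fun n => N (G n - M)) atTop (𝓝 0) →
      Tendsto (fun n => finRegDet p (F n : X →L[ℂ] X)) atTop (𝓝 a) →
      Tendsto (fun n => finRegDet p (G n : X →L[ℂ] X)) atTop (𝓝 b) → N L ≤ r → N M ≤ r →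
        ‖a - b‖ ≤ C * N (L - M) := by
    intro r
    obtain ⟨C, hC, hlip⟩ := h.exists_lipschitz hp hΓ (q * (r + 1))
    refine ⟨C * (q * q), by positivity, fun L M F G a b hF hG hFL hGM ha hb hLr hMr => ?_⟩
    have hlim : Tendsto (fun n => C * (q * (N (F n - L) + q * (N (L - M) + N (G n - M))))) atTop
        (𝓝 (C * (q * (0 + q * (N (L - M) + 0))))) :=
      (((hFL.add ((hGM.const_add _).const_mul q)).const_mul q).const_mul C)
    have hlim2 := (ha.sub hb).norm
    rw [show C * (q * q) * N (L - M) = C * (q * (0 + q * (N (L - M) + 0))) by ring]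
    refine le_of_tendsto_of_tendsto hlim2 hlim ?_
    filter_upwards [eventually_quasiNorm_le hFL hq1 hq one_pos,
      eventually_quasiNorm_le hGM hq1 hq one_pos]
      with n h1 h2
    have h3 := hlip (F n) (G n) (hF n) (hG n) (h1.trans (by gcongr)) (h2.trans (by gcongr))
    have h4 := hq (F n - L) (L - G n)
    have h5 := hq (L - M) (M - G n)
    rw [sub_add_sub_cancel] at h4 h5
    rw [h.quasiNorm.sub_comm M] at h5
    refine h3.trans ?_
    calc C * N (F n - G n) ≤ C * (q * (N (F n - L) + N (L - G n))) := by gcongr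
      _ ≤ _ := by gcongr
  refine ⟨d, fun G hG => ?_, fun r => ?_⟩
  · obtain ⟨C, hC, hlip⟩ := hlip' (N G)
    have := hlip G G (F G) (fun _ => G) (d G) (finRegDet p (G : X →L[ℂ] X)) (hF G) (fun _ => hG)
      (hL G) (by simp [(h.quasiNorm.eq_zero_iff 0).2]) (hd G) tendsto_const_nhds le_rfl le_rfl
    rw [sub_self, (h.quasiNorm.eq_zero_iff 0).2 rfl, mul_zero] at this
    exact sub_eq_zero.1 (norm_le_zero_iff.1 this)
  · obtain ⟨C, hC, hlip⟩ := hlip' r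
    exact ⟨C, hC, fun L M hLr hMr => hlip L M (F L) (F M) (d L) (d M) (hF L) (hF M) (hL L) (hL M)
      (hd L) (hd M) hLr hMr⟩

theorem QuasiContinuous.tendsto {d : I → ℂ} (hd : QuasiContinuous N d) {α : Type*} {l : Filter α}
    {F : α → I} {L : I} (hF : Tendsto (fun n => N (F n - L)) l (𝓝 0)) :
    Tendsto (fun n => d (F n)) l (𝓝 (d L)) := by
  rw [Metric.tendsto_nhds]
  intro ε hε
  obtain ⟨δ, hδ, hd⟩ := hd L ε hε
  filter_upwards [hF.eventually (gt_mem_nhds hδ)] with n hn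
  rw [dist_eq_norm]
  exact hd _ hn

theorem IsLpIdeal.existsUnique_regDetExtension (h : IsLpIdeal p γ I N) (hp : 0 < p) {Γ : ℝ}
    (hΓ : IsDetConstant X p Γ) : ∃! d : I → ℂ, IsRegDetExtension p I N d := by
  obtain ⟨d, hd, hlip⟩ := h.exists_regDetExtension hp hΓ
  obtain ⟨q, hq1, hq⟩ := h.quasiNorm.quasi_triangle
  have hq0 : (0 : ℝ) ≤ q := by linarith
  refine ⟨d, ⟨fun L ε hε => ?_, hd⟩, fun d' ⟨hd'c, hd'⟩ => ?_⟩
  · obtain ⟨C, hC, hlip⟩ := hlip (q * (1 + N L))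
    have hL0 := h.quasiNorm.nonneg L
    refine ⟨min 1 (ε / (C + 1)), by positivity, fun M hM => ?_⟩
    have h1 := hq (M - L) L
    rw [sub_add_cancel] at h1
    have hMr : N M ≤ q * (1 + N L) := by
      refine h1.trans ?_
      gcongr
      exact hM.le.trans (min_le_left _ _)
    have hLr : N L ≤ q * (1 + N L) := by nlinarith
    calc _ ≤ C * N (M - L) := hlip M L hMr hLr
      _ ≤ C * (ε / (C + 1)) := by
        gcongr
        exact hM.le.trans (min_le_right _ _)
      _ = ε * (C / (C + 1)) := by ring
      _ < ε * 1 := by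
        gcongr
        rw [div_lt_one (by positivity)]
        linarith
      _ = ε := mul_one ε
  · ext L
    obtain ⟨F, hF, hFL⟩ := h.exists_seq L
    have h1 := hd'c.tendsto hFL
    obtain ⟨C, hC, hlip⟩ := hlip (q * (N L + 1))
    have h2 : Tendsto (fun n => d (F n)) atTop (𝓝 (d L)) := by
      rw [tendsto_iff_norm_sub_tendsto_zero]
      refine squeeze_zero' (Eventually.of_forall fun _ => norm_nonneg _) ?_
        (by simpa using hFL.const_mul C)
      filter_upwards [eventually_quasiNorm_le hFL hq1 hq one_pos] with n hn
      exact hlip _ _ hn (by have := h.quasiNorm.nonneg L; nlinarith)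
    refine tendsto_nhds_unique h1 (h2.congr fun n => ?_)
    rw [hd _ (hF n), hd' _ (hF n)]

theorem IsLpIdeal.isRegDetExtension_regDet (h : IsLpIdeal p γ I N) (hp : 0 < p) {Γ : ℝ}
    (hΓ : IsDetConstant X p Γ) : IsRegDetExtension p I N (regDet p I N) := by
  have hex := (h.existsUnique_regDetExtension hp hΓ).exists
  rw [regDet, dif_pos hex]
  exact hex.choose_spec

theorem IsLpIdeal.regDet_eq (h : IsLpIdeal p γ I N) (hp : 0 < p) {Γ : ℝ}
    (hΓ : IsDetConstant X p Γ) {F : I} (hF : IsFiniteRank (F : X →L[ℂ] X)) :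
    regDet p I N F = finRegDet p (F : X →L[ℂ] X) :=
  (h.isRegDetExtension_regDet hp hΓ).2 F hF

theorem IsLpIdeal.tendsto_regDet (h : IsLpIdeal p γ I N) (hp : 0 < p) {Γ : ℝ}
    (hΓ : IsDetConstant X p Γ) {α : Type*} {l : Filter α} {F : α → I} {L : I}
    (hF : Tendsto (fun n => N (F n - L)) l (𝓝 0)) :
    Tendsto (fun n => regDet p I N (F n)) l (𝓝 (regDet p I N L)) :=
  (h.isRegDetExtension_regDet hp hΓ).1.tendsto hF

theorem IsLpIdeal.regDet_zero (h : IsLpIdeal p γ I N) (hp : 0 < p) {Γ : ℝ}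
    (hΓ : IsDetConstant X p Γ) : regDet p I N 0 = 1 := by
  rw [h.regDet_eq hp hΓ isFiniteRank_zero, Submodule.coe_zero, finRegDet, finDet_zero]
  have : ∑ k ∈ Finset.Icc 1 (⌈p⌉₊ - 1), (1 / (k : ℂ)) * finTrace ((0 : X →L[ℂ] X) ^ k) = 0 :=
    Finset.sum_eq_zero fun k hk => by
      rw [zero_pow (by have := (Finset.mem_Icc.1 hk).1; lia)]
      have : finTrace (0 : X →L[ℂ] X) = 0 := by
        simpa using finTrace_smul (isFiniteRank_zero (X := X)) 0
      rw [this, mul_zero]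
  rw [this, Complex.exp_zero, mul_one]

theorem IsLpIdeal.regDet_lipschitz (h : IsLpIdeal p γ I N) (hp : 0 < p) {Γ : ℝ}
    (hΓ : IsDetConstant X p Γ) (r : ℝ) : ∃ C : ℝ, 0 ≤ C ∧ ∀ L M : I, N L ≤ r → N M ≤ r →
      ‖regDet p I N L - regDet p I N M‖ ≤ C * N (L - M) := by
  obtain ⟨d, hd, hlip⟩ := h.exists_regDetExtension hp hΓ
  obtain ⟨q, hq1, hq⟩ := h.quasiNorm.quasi_triangle
  have hd' : regDet p I N = d := by
    ext L
    obtain ⟨F, hF, hFL⟩ := h.exists_seq L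
    have h1 := h.tendsto_regDet hp hΓ hFL
    obtain ⟨C, hC, hlip⟩ := hlip (q * (N L + 1))
    have h2 : Tendsto (fun n => d (F n)) atTop (𝓝 (d L)) := by
      rw [tendsto_iff_norm_sub_tendsto_zero]
      refine squeeze_zero' (Eventually.of_forall fun _ => norm_nonneg _) ?_
        (by simpa using hFL.const_mul C)
      filter_upwards [eventually_quasiNorm_le hFL hq1 hq one_pos] with n hn
      exact hlip _ _ hn (by have := h.quasiNorm.nonneg L; nlinarith)
    refine tendsto_nhds_unique h1 (h2.congr fun n => ?_)
    rw [hd _ (hF n), h.regDet_eq hp hΓ (hF n)]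
  rw [hd']
  exact hlip r

/-- The bound on finite rank operators persists, up to the constant of the quasi-norm. -/
theorem IsLpIdeal.exists_norm_regDet_le (h : IsLpIdeal p γ I N) (hp : 0 < p) {Γ : ℝ}
    (hΓ : IsDetConstant X p Γ) :
    ∃ C : ℝ, 0 ≤ C ∧ ∀ L : I, ‖regDet p I N L‖ ≤ Real.exp (C * N L ^ p) := by
  obtain ⟨q, hq1, hq⟩ := h.quasiNorm.quasi_triangle
  have hq0 : (0 : ℝ) ≤ q := by linarith
  have hγ : 0 ≤ max γ 0 := le_max_right _ _
  -- The factor q comes from N(F n) ≤ q (N(F n - L) + N L). This crude constant is enough for growth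
  -- in w, not for the final bound.
  refine ⟨Γ * (max γ 0 * q) ^ p, mul_nonneg hΓ.1.le (by positivity), fun L => ?_⟩
  have hL := h.quasiNorm.nonneg L
  obtain ⟨F, hF, hFL⟩ := h.exists_seq L
  have h1 := (h.tendsto_regDet hp hΓ hFL).norm
  have h2 : Tendsto (fun n => Real.exp (Γ * (max γ 0 * (q * (N (F n - L) + N L))) ^ p)) atTop
      (𝓝 (Real.exp (Γ * (max γ 0 * (q * (0 + N L))) ^ p))) :=
    (Real.continuous_exp.tendsto _).comp ((((((hFL.add_const _).const_mul q).const_mul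
      (max γ 0)).rpow_const (Or.inr hp.le))).const_mul Γ)
  have e : Γ * (max γ 0 * q) ^ p * N L ^ p = Γ * (max γ 0 * (q * (0 + N L))) ^ p := by
    rw [zero_add, ← mul_assoc (max γ 0), Real.mul_rpow (by positivity) hL, mul_assoc]
  rw [e]
  refine le_of_tendsto_of_tendsto h1 h2 (Eventually.of_forall fun n => ?_)
  simp only [h.regDet_eq hp hΓ (hF n)]
  refine (h.norm_finRegDet_le hp hΓ (hF n)).trans (Real.exp_le_exp.2 ?_)
  have h3 := hq (F n - L) L
  rw [sub_add_cancel] at h3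
  have h4 := h.quasiNorm.nonneg (F n)
  have := hΓ.1.le
  gcongr

/-- `K T` as an element of the ideal. -/
def IsLpIdeal.mulRight (h : IsLpIdeal p γ I N) (K : I) (T : X →L[ℂ] X) : I :=
  ⟨(K : X →L[ℂ] X) * T, h.mul_right_mem K T⟩

/-- With K replaced by a finite rank F n, all operators F n T(z) have range in the fixed space Ran F
n and the determinant is holomorphic. The Lipschitz estimate makes the convergence locally uniform.
-/
theorem IsLpIdeal.differentiableOn_regDet (h : IsLpIdeal p γ I N) (hp : 0 < p) {Γ : ℝ}
    (hΓ : IsDetConstant X p Γ) (K : I) {T : ℂ → X →L[ℂ] X} {U : Set ℂ} (hU : IsOpen U)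
    (hT : DifferentiableOn ℂ T U) :
    DifferentiableOn ℂ (fun z => regDet p I N (h.mulRight K (T z))) U := by
  obtain ⟨q, hq1, hq⟩ := h.quasiNorm.quasi_triangle
  have hq0 : (0 : ℝ) ≤ q := by linarith
  obtain ⟨F, hF, hFK⟩ := h.exists_seq K
  have hlim : TendstoLocallyUniformlyOn (fun n z => regDet p I N (h.mulRight (F n) (T z)))
      (fun z => regDet p I N (h.mulRight K (T z))) atTop U := by
    rw [Metric.tendstoLocallyUniformlyOn_iff]
    intro ε hε z hz
    set b := ‖T z‖ + 1
    have hb : ∀ᶠ w in 𝓝[U] z, ‖T w‖ ≤ b :=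
      ((hT.continuousOn z hz).norm.eventually (ge_mem_nhds (lt_add_one _)))
    refine ⟨_, hb, ?_⟩
    obtain ⟨C, hC, hlip⟩ := h.regDet_lipschitz hp hΓ (q * (N K + 1) * b)
    have hK := h.quasiNorm.nonneg K
    have hsmall := (hFK.const_mul (C * b)).eventually (gt_mem_nhds (by simpa using hε))
    filter_upwards [hsmall, eventually_quasiNorm_le hFK hq1 hq one_pos] with n h1 h2 w hw
    have hw' : ‖T w‖ ≤ b := hw
    have hle : ∀ L : I, N L ≤ q * (N K + 1) → N (h.mulRight L (T w)) ≤ q * (N K + 1) * b :=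
      fun L hL => (h.mul_right_le L (T w)).trans (by gcongr)
    rw [dist_comm, dist_eq_norm]
    refine (hlip _ _ (hle _ h2) (hle K (by nlinarith))).trans_lt (lt_of_le_of_lt ?_ h1)
    have e : h.mulRight (F n) (T w) - h.mulRight K (T w) = h.mulRight (F n - K) (T w) :=
      Subtype.ext (sub_mul _ _ _).symm
    rw [e]
    calc _ ≤ C * (N (F n - K) * ‖T w‖) := by
          gcongr
          exact h.mul_right_le _ _
      _ ≤ C * (N (F n - K) * b) := by
          have := h.quasiNorm.nonneg (F n - K)
          gcongr
      _ = _ := by ring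
  refine hlim.differentiableOn (Eventually.of_forall fun n => ?_) hU
  have hFn := hF n
  have hfd : FiniteDimensional ℂ (LinearMap.range ((F n : X →L[ℂ] X) : X →ₗ[ℂ] X)) := hFn
  have e : (fun z => regDet p I N (h.mulRight (F n) (T z))) =
      fun z => finRegDet p ((F n : X →L[ℂ] X) * T z) := by
    ext z
    exact h.regDet_eq hp hΓ (hFn.mul_right _)
  rw [e]
  intro z hz
  exact (differentiableAt_finRegDet p (fun w => range_mul_le (T w) le_rfl)
    (((hT z hz).differentiableAt (hU.mem_nhds hz)).const_mul _)).differentiableWithinAt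

end Extension

/-! ### Multiplicativity up to a trace exponential -/

section Multiplicativity

variable {X : Type u} [NormedAddCommGroup X] [NormedSpace ℂ X]

/-- The exponent `∑_{k=1}^{n-1} tr (S^k - T^k) / k`, for `S - T` of finite rank. -/
def traceCorrection (n : ℕ) (S T : X →L[ℂ] X) : ℂ :=
  ∑ k ∈ Finset.Icc 1 (n - 1), (1 / (k : ℂ)) * finTrace (S ^ k - T ^ k)

/-- Only the differences of powers need a trace; their rank is at most kr, which makes the trace
norm continuous. -/
theorem tendsto_traceCorrection (n : ℕ) {α : Type*} {l : Filter α} {S T : α → X →L[ℂ] X}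
    {S₀ T₀ : X →L[ℂ] X} {r : ℕ}
    (hr : ∀ᶠ a in l, LinearMap.rank ((S a - T a : X →L[ℂ] X) : X →ₗ[ℂ] X) ≤ r)
    (hr₀ : LinearMap.rank ((S₀ - T₀ : X →L[ℂ] X) : X →ₗ[ℂ] X) ≤ r)
    (hS : Tendsto S l (𝓝 S₀)) (hT : Tendsto T l (𝓝 T₀)) :
    Tendsto (fun a => traceCorrection n (S a) (T a)) l (𝓝 (traceCorrection n S₀ T₀)) := by
  unfold traceCorrection
  refine tendsto_finsetSum _ fun k _ => Tendsto.const_mul _ ?_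
  exact tendsto_finTrace (r := k * r) (hr.mono fun a ha => rank_pow_sub_pow_le ha k)
    (rank_pow_sub_pow_le hr₀ k) ((hS.pow k).sub (hT.pow k))

theorem finRegDet_mul {F G : X →L[ℂ] X} (hF : IsFiniteRank F) (hG : IsFiniteRank G) (p : ℝ) :
    finRegDet p (F + G * (1 - F)) = finDet G * finRegDet p F *
      Complex.exp (traceCorrection ⌈p⌉₊ (F + G * (1 - F)) F) := by
  have hF' : IsFiniteRank (F + G * (1 - F)) := hF.add (hG.mul_right _)
  have : ∑ k ∈ Finset.Icc 1 (⌈p⌉₊ - 1), (1 / (k : ℂ)) * finTrace ((F + G * (1 - F)) ^ k) =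
      ∑ k ∈ Finset.Icc 1 (⌈p⌉₊ - 1), (1 / (k : ℂ)) * finTrace (F ^ k) +
        traceCorrection ⌈p⌉₊ (F + G * (1 - F)) F := by
    rw [traceCorrection, ← Finset.sum_add_distrib]
    refine Finset.sum_congr rfl fun k hk => ?_
    have hk0 : k ≠ 0 := by have := (Finset.mem_Icc.1 hk).1; lia
    rw [finTrace_sub (hF'.pow hk0) (hF.pow hk0)]
    ring
  rw [finRegDet, finRegDet, finDet_mul hF hG, this, Complex.exp_add]
  ring

variable {p γ : ℝ} {I : Submodule ℂ (X →L[ℂ] X)} {N : I → ℝ}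

theorem IsLpIdeal.tendsto_coe (h : IsLpIdeal p γ I N) {F : ℕ → I} {L : I}
    (hF : Tendsto (fun n => N (F n - L)) atTop (𝓝 0)) :
    Tendsto (fun n => (F n : X →L[ℂ] X)) atTop (𝓝 (L : X →L[ℂ] X)) := by
  rw [tendsto_iff_norm_sub_tendsto_zero]
  exact squeeze_zero (fun _ => norm_nonneg _) (fun n => h.norm_le (F n - L)) hF

theorem IsLpIdeal.mul_left_le (h : IsLpIdeal p γ I N) (L M : I) (B : X →L[ℂ] X)
    (hM : (M : X →L[ℂ] X) = B * L) : N M ≤ ‖B‖ * N L := by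
  have h1 := h.quasiNorm_mul_le B L 1
  have h2 : ‖(1 : X →L[ℂ] X)‖ ≤ 1 := ContinuousLinearMap.norm_id_le
  have e : M = ⟨B * (L : X →L[ℂ] X) * 1, h.mul_mem B L 1⟩ := Subtype.ext (hM.trans (mul_one _).symm)
  rw [e]
  refine h1.trans (mul_le_of_le_one_right (mul_nonneg (norm_nonneg _) (h.quasiNorm.nonneg _)) h2)

/-- If `I - L' = (I - G) (I - L)` with `G` of finite rank, then `det_p (I - L')` is
`det (I - G) det_p (I - L)` up to an exponential factor. -/
theorem IsLpIdeal.regDet_mul (h : IsLpIdeal p γ I N) (hp : 0 < p) {Γ : ℝ}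
    (hΓ : IsDetConstant X p Γ) {G : X →L[ℂ] X} (hG : IsFiniteRank G) {L L' : I}
    (hL : (L' : X →L[ℂ] X) = L + G * (1 - L)) :
    regDet p I N L' = finDet G * regDet p I N L *
      Complex.exp (traceCorrection ⌈p⌉₊ (L' : X →L[ℂ] X) L) := by
  obtain ⟨F, hF, hFL⟩ := h.exists_seq L
  have hmem : ∀ n, (F n : X →L[ℂ] X) + G * (1 - F n) ∈ I := fun n =>
    h.finiteRank_mem _ ((hF n).add (hG.mul_right _))
  obtain ⟨F', hF'⟩ : ∃ F' : ℕ → I, ∀ n, (F' n : X →L[ℂ] X) = F n + G * (1 - F n) :=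
    ⟨fun n => ⟨_, hmem n⟩, fun _ => rfl⟩
  -- The approximants satisfy F' n - L' = (1 - G)(F n - L), so the ideal property gives convergence
  -- in the quasi-norm.
  have hFL' : Tendsto (fun n => N (F' n - L')) atTop (𝓝 0) := by
    refine squeeze_zero (fun _ => h.quasiNorm.nonneg _) (fun n => ?_)
      (by simpa using hFL.const_mul ‖1 - G‖)
    refine h.mul_left_le (F n - L) _ _ ?_
    rw [Submodule.coe_sub, Submodule.coe_sub, hF', hL]
    noncomm_ring
  have hGr := hG.rank_eq.le
  have hcorr : Tendsto (fun n => traceCorrection ⌈p⌉₊ (F' n : X →L[ℂ] X) (F n)) atTop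
      (𝓝 (traceCorrection ⌈p⌉₊ (L' : X →L[ℂ] X) L)) :=
    tendsto_traceCorrection ⌈p⌉₊
      (Eventually.of_forall fun n => by
        rw [hF', add_sub_cancel_left]; exact rank_mul_right_le hGr _)
      (by rw [hL, add_sub_cancel_left]; exact rank_mul_right_le hGr _)
      (h.tendsto_coe hFL') (h.tendsto_coe hFL)
  have hlim := ((h.tendsto_regDet hp hΓ hFL).const_mul (finDet G)).mul
    ((Complex.continuous_exp.tendsto _).comp hcorr)
  refine tendsto_nhds_unique (h.tendsto_regDet hp hΓ hFL') (hlim.congr fun n => ?_)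
  have hF'f : IsFiniteRank (F' n : X →L[ℂ] X) := by
    rw [hF']; exact (hF n).add (hG.mul_right _)
  rw [h.regDet_eq hp hΓ (hF n), h.regDet_eq hp hΓ hF'f, Function.comp_apply, hF']
  exact (finRegDet_mul (hF n) hG p).symm

end Multiplicativity

/-! ### Zeros of the determinant, behaviour at infinity, analyticity of D -/

section Zeros

variable {X : Type u} [NormedAddCommGroup X] [NormedSpace ℂ X]

theorem finDet_eq_prod {G : X →L[ℂ] X} (hG : IsFiniteRank G) :
    finDet G = ((eigenvalueMultiset G hG).map fun μ => 1 - μ).prod := by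
  have : FiniteDimensional ℂ (LinearMap.range (G : X →ₗ[ℂ] X)) := hG
  have := det_id_sub_smul_eq_prod_roots (restrictRange G) 1
  simp only [one_smul, one_mul] at this
  exact this

theorem finDet_eq_zero_iff {G : X →L[ℂ] X} (hG : IsFiniteRank G) :
    finDet G = 0 ↔ (1 : ℂ) ∈ eigenvalueMultiset G hG := by
  rw [finDet_eq_prod hG, Multiset.prod_eq_zero_iff, Multiset.mem_map]
  constructor
  · rintro ⟨μ, h1, h2⟩
    rwa [← sub_eq_zero.1 h2] at h1
  · exact fun h => ⟨1, h, sub_self 1⟩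

theorem exists_fixed_of_finDet_eq_zero {G : X →L[ℂ] X} (hG : IsFiniteRank G)
    (h : finDet G = 0) : ∃ x ≠ 0, G x = x := by
  have hfd : FiniteDimensional ℂ (LinearMap.range (G : X →ₗ[ℂ] X)) := hG
  rw [finDet_eq_zero_iff hG] at h
  have h1 := (Polynomial.mem_roots (LinearMap.charpoly_monic (restrictRange G)).ne_zero).1 h
  obtain ⟨v, hv⟩ := ((Module.End.hasEigenvalue_iff_isRoot_charpoly _ _).2 h1).exists_hasEigenvector
  refine ⟨v, by simpa using hv.2, ?_⟩
  have := congrArg Subtype.val hv.apply_eq_smul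
  rw [one_smul] at this
  exact this

/-- The spectral projection of G at 1 has rank equal to the multiplicity of the eigenvalue 1, which
is 0; its partial inverse is then a full inverse of 1 - G. -/
theorem isUnit_one_sub_of_finDet_ne_zero {G : X →L[ℂ] X} (hG : IsFiniteRank G)
    (h : finDet G ≠ 0) : IsUnit (1 - G) := by
  classical
  obtain ⟨Q, hQ, hQf, hQr⟩ := exists_isSpectralProjection_of_finiteRank hG one_ne_zero
  rw [Ne, finDet_eq_zero_iff hG, ← Multiset.count_eq_zero.not_left] at h
  have h0 : (eigenvalueMultiset G hG).count 1 = 0 := by simpa using h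
  rw [h0] at hQr
  have hfd : FiniteDimensional ℂ (LinearMap.range (Q : X →ₗ[ℂ] X)) := hQf
  have hQ0 : Q = 0 := by
    ext x
    have h2 := Submodule.finrank_eq_zero.1 hQr
    have h3 : (Q : X →ₗ[ℂ] X) x ∈ LinearMap.range (Q : X →ₗ[ℂ] X) := ⟨x, rfl⟩
    rw [h2] at h3
    simpa using h3
  obtain ⟨S, -, h1, h2⟩ := hQ.inv
  rw [hQ0, sub_zero, map_one] at h1 h2
  exact ⟨⟨1 - G, S, h1, h2⟩, rfl⟩

variable [CompleteSpace X] {p γ : ℝ} {I : Submodule ℂ (X →L[ℂ] X)} {N : I → ℝ}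

/-- Take F of finite rank so close to L that M = L - F has norm below 1 and determinant near 1. Then
G = F(1 - M)⁻¹ satisfies 1 - L = (1 - G)(1 - M). -/
theorem IsLpIdeal.exists_factorization (h : IsLpIdeal p γ I N) (hp : 0 < p) {Γ : ℝ}
    (hΓ : IsDetConstant X p Γ) (L : I) :
    ∃ (M : I) (G : X →L[ℂ] X) (u : (X →L[ℂ] X)ˣ), IsFiniteRank G ∧ (u : X →L[ℂ] X) = 1 - M ∧
      (L : X →L[ℂ] X) = M + G * (1 - M) ∧ regDet p I N M ≠ 0 := by
  obtain ⟨δ, hδ, hd⟩ := (h.isRegDetExtension_regDet hp hΓ).1 0 1 one_pos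
  obtain ⟨F, hF, hFN⟩ := h.finiteRank_dense L (min δ 1) (by positivity)
  have hM : ‖((L - F : I) : X →L[ℂ] X)‖ < 1 :=
    (h.norm_le _).trans_lt (hFN.trans_le (min_le_right _ _))
  obtain ⟨u, hu⟩ : IsUnit (1 - ((L - F : I) : X →L[ℂ] X)) := isUnit_one_sub_of_norm_lt_one hM
  refine ⟨L - F, F * ↑u⁻¹, u, hF.mul_right _, hu, ?_, ?_⟩
  · rw [← hu, mul_assoc, Units.inv_mul, mul_one]
    simp
  · intro h0
    have := hd (L - F) (by simpa using hFN.trans_le (min_le_left _ _))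
    rw [h0, h.regDet_zero hp hΓ] at this
    simp at this

theorem IsLpIdeal.exists_fixed_of_regDet_eq_zero (h : IsLpIdeal p γ I N) (hp : 0 < p) {Γ : ℝ}
    (hΓ : IsDetConstant X p Γ) {L : I} (h0 : regDet p I N L = 0) :
    ∃ x ≠ 0, (L : X →L[ℂ] X) x = x := by
  obtain ⟨M, G, u, hG, hu, hL, hM⟩ := h.exists_factorization hp hΓ L
  rw [h.regDet_mul hp hΓ hG hL] at h0
  have h1 : finDet G = 0 := by
    simpa [hM, Complex.exp_ne_zero] using h0
  obtain ⟨x, hx, hGx⟩ := exists_fixed_of_finDet_eq_zero hG h1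
  have e : (1 - (L : X →L[ℂ] X)) * ↑u⁻¹ = 1 - G := by
    have : 1 - (L : X →L[ℂ] X) = (1 - G) * u := by rw [hL, hu]; noncomm_ring
    rw [this, mul_assoc, Units.mul_inv, mul_one]
  refine ⟨(↑u⁻¹ : X →L[ℂ] X) x, fun h2 => hx ?_, ?_⟩
  · have : ((u : X →L[ℂ] X) * ↑u⁻¹) x = 0 := by
      rw [mul_apply_eq_comp, h2, map_zero]
    rwa [Units.mul_inv] at this
  · have h3 := congrArg (fun B : X →L[ℂ] X => B x) e
    have h4 : (↑u⁻¹ : X →L[ℂ] X) x - (L : X →L[ℂ] X) ((↑u⁻¹ : X →L[ℂ] X) x) = x - G x := h3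
    rw [hGx, sub_self] at h4
    exact (sub_eq_zero.1 h4).symm

/-- A zero gives a vector fixed by L. Conversely, in 1 - L = (1 - G)(1 - M) the second factor is
invertible, and a nonzero determinant forces det(1 - G) ≠ 0, hence invertibility of 1 - G. -/
theorem IsLpIdeal.regDet_eq_zero_iff (h : IsLpIdeal p γ I N) (hp : 0 < p) {Γ : ℝ}
    (hΓ : IsDetConstant X p Γ) (L : I) :
    regDet p I N L = 0 ↔ ¬ IsUnit (1 - (L : X →L[ℂ] X)) := by
  constructor
  · rintro h0 ⟨v, hv⟩
    obtain ⟨x, hx, hLx⟩ := h.exists_fixed_of_regDet_eq_zero hp hΓ h0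
    have h1 : (v : X →L[ℂ] X) x = 0 := by
      rw [hv]
      change x - (L : X →L[ℂ] X) x = 0
      rw [hLx, sub_self]
    have h2 : ((↑v⁻¹ : X →L[ℂ] X) * v) x = 0 := by rw [mul_apply_eq_comp, h1, map_zero]
    rw [Units.inv_mul] at h2
    exact hx h2
  · intro hu'
    obtain ⟨M, G, u, hG, hu, hL, hM⟩ := h.exists_factorization hp hΓ L
    by_contra h0
    rw [h.regDet_mul hp hΓ hG hL] at h0
    have h1 : finDet G ≠ 0 := by
      intro h2
      simp [h2] at h0
    refine hu' ?_
    have : 1 - (L : X →L[ℂ] X) = (1 - G) * u := by rw [hL, hu]; noncomm_ring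
    rw [this]
    exact (isUnit_one_sub_of_finDet_ne_zero hG h1).mul u.isUnit

/-- Rests on 1 - K(z - A)⁻¹ = (z - (A + K))(z - A)⁻¹. -/
theorem IsLpIdeal.pertDet_eq_zero_iff (h : IsLpIdeal p γ I N) (hp : 0 < p) {Γ : ℝ}
    (hΓ : IsDetConstant X p Γ) (A : X →L[ℂ] X) (K : I) {z : ℂ} (hz : z ∈ resolventSet ℂ A) :
    pertDet h A K z = 0 ↔ z ∈ spectrum ℂ (A + (K : X →L[ℂ] X)) := by
  obtain ⟨u, hu⟩ := spectrum.mem_resolventSet_iff.1 hz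
  have e : 1 - (resolventProduct h A K z : X →L[ℂ] X) =
      (algebraMap ℂ (X →L[ℂ] X) z - (A + K)) * ↑u⁻¹ := by
    change 1 - (K : X →L[ℂ] X) * resolvent A z = _
    rw [resolvent, ← hu, Ring.inverse_unit, ← sub_sub, ← hu, sub_mul, Units.mul_inv]
  rw [pertDet, h.regDet_eq_zero_iff hp hΓ, e, Units.isUnit_mul_units]
  rfl

theorem IsLpIdeal.tendsto_pertDet (h : IsLpIdeal p γ I N) (hp : 0 < p) {Γ : ℝ}
    (hΓ : IsDetConstant X p Γ) (A : X →L[ℂ] X) (K : I) :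
    Tendsto (pertDet h A K) (Bornology.cobounded ℂ) (𝓝 1) := by
  rw [← h.regDet_zero hp hΓ]
  refine (h.isRegDetExtension_regDet hp hΓ).1.tendsto ?_
  have h1 : Tendsto (resolvent A) (Bornology.cobounded ℂ) (𝓝 (0 : X →L[ℂ] X)) :=
    spectrum.resolvent_tendsto_cobounded A
  refine squeeze_zero (fun _ => h.quasiNorm.nonneg _) (fun z => ?_)
    (by simpa using h1.norm.const_mul (N K))
  rw [sub_zero]
  exact h.mul_right_le K (resolvent A z)

theorem IsLpIdeal.analyticOnNhd_pertDet (h : IsLpIdeal p γ I N) (hp : 0 < p) {Γ : ℝ}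
    (hΓ : IsDetConstant X p Γ) (A : X →L[ℂ] X) (K : I) :
    AnalyticOnNhd ℂ (pertDet h A K) (resolventSet ℂ A) :=
  (h.differentiableOn_regDet hp hΓ K (spectrum.isOpen_resolventSet A)
    fun _ hz => (differentiableAt_resolvent hz).differentiableWithinAt).analyticOnNhd
      (spectrum.isOpen_resolventSet A)

end Zeros

/-! ### Order of a zero and algebraic multiplicity -/

section Order

/-- Continuity of g at z is enough, since off z it equals f/(w - z)^m and the singularity is
removable. This spares a proof that the trace correction is holomorphic. -/
theorem analyticOrderAt_eq_of_eventuallyEq_pow_mul {f g : ℂ → ℂ} {z : ℂ} {m : ℕ}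
    (hf : AnalyticAt ℂ f z) (hg : ContinuousAt g z) (hz : g z ≠ 0)
    (h : ∀ᶠ w in 𝓝 z, f w = (w - z) ^ m * g w) : analyticOrderAt f z = m := by
  refine hf.analyticOrderAt_eq_natCast.2 ⟨g, ?_, hz, h⟩
  refine Complex.analyticAt_of_differentiable_on_punctured_nhds_of_continuousAt ?_ hg
  have h1 : ∀ᶠ w in 𝓝[≠] z, ∀ᶠ v in 𝓝 w, g v = f v / (v - z) ^ m := by
    filter_upwards [h.eventually_nhds.filter_mono nhdsWithin_le_nhds, self_mem_nhdsWithin]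
      with w hw hwz
    filter_upwards [hw, isOpen_ne.mem_nhds hwz] with v hv hvz
    have : (v - z) ^ m ≠ 0 := pow_ne_zero _ (sub_ne_zero.2 hvz)
    rw [hv]
    field_simp
  have h3 : ∀ᶠ w in 𝓝[≠] z, AnalyticAt ℂ f w :=
    hf.eventually_analyticAt.filter_mono nhdsWithin_le_nhds
  filter_upwards [h1, h3, self_mem_nhdsWithin] with w hw hfw hwz
  have : (w - z) ^ m ≠ 0 := pow_ne_zero _ (sub_ne_zero.2 hwz)
  refine DifferentiableAt.congr_of_eventuallyEq ?_ hw
  exact hfw.differentiableAt.div (by fun_prop) this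

/-- On Ran Q, Z is z plus a nilpotent n, so w - Z + Q acts as (w - z + 1) - n and w - Z as (w - z) -
n. Their determinants are pure powers, and 1 - Q(w - Z + Q)⁻¹ is their quotient there. -/
theorem IsSpectralProjection.finDet_mul_pow {X : Type u} [NormedAddCommGroup X] [NormedSpace ℂ X]
    {Z Q : X →L[ℂ] X} {z : ℂ} (h : IsSpectralProjection Z z Q) (hQ : IsFiniteRank Q) {w : ℂ}
    (hw : w ∈ resolventSet ℂ (Z - Q)) :
    finDet (Q * resolvent (Z - Q) w) *
        (w - z + 1) ^ Module.finrank ℂ (LinearMap.range (Q : X →ₗ[ℂ] X)) =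
      (w - z) ^ Module.finrank ℂ (LinearMap.range (Q : X →ₗ[ℂ] X)) := by
  set W := LinearMap.range (Q : X →ₗ[ℂ] X) with hW
  have : FiniteDimensional ℂ W := hQ
  have hQW : ∀ x ∈ W, Q x = x := by
    rintro _ ⟨x, rfl⟩
    exact congrArg (fun B : X →L[ℂ] X => B x) h.idem
  have hNW : LinearMap.range (((Z - algebraMap ℂ (X →L[ℂ] X) z) * Q : X →L[ℂ] X) : X →ₗ[ℂ] X) ≤
      W := by
    rw [← (h.comm.sub_right (Algebra.commute_algebraMap_right z Q)).eq]
    exact range_mul_le _ le_rfl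
  set n : W →ₗ[ℂ] W := restrictTo W ((Z - algebraMap ℂ (X →L[ℂ] X) z) * Q) hNW with hn
  have hnil : IsNilpotent n := by
    obtain ⟨m, hm⟩ := h.nilp
    refine ⟨m, ?_⟩
    have key : ∀ (k : ℕ) (x : W), ((n ^ k) x : X) = ((Z - algebraMap ℂ (X →L[ℂ] X) z) ^ k) x := by
      intro k
      induction k with
      | zero => intro x; rfl
      | succ k ih =>
        intro x
        rw [pow_succ', pow_succ', Module.End.mul_apply, hn, coe_restrictTo, ← hn]
        change (Z - algebraMap ℂ (X →L[ℂ] X) z) (Q ((n ^ k) x : X)) = _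
        rw [hQW _ ((n ^ k) x).2, ih]
        rfl
    ext x
    rw [key]
    have h1 : (Z - algebraMap ℂ (X →L[ℂ] X) z) ^ m * Q = 0 := by
      rw [← neg_sub, neg_pow, mul_assoc, hm, mul_zero]
    have h2 := congrArg (fun B : X →L[ℂ] X => B x) h1
    have h3 : ((Z - algebraMap ℂ (X →L[ℂ] X) z) ^ m) (Q x) = 0 := h2
    rw [hQW _ x.2] at h3
    exact h3
  have hdet : ∀ t : ℂ, LinearMap.det (algebraMap ℂ (W →ₗ[ℂ] W) t - n) = t ^ Module.finrank ℂ W := by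
    intro t
    rw [← LinearMap.eval_charpoly, hnil.charpoly_eq_X_pow_finrank]
    simp
  rw [finDet_eq_det_restrictTo (W := W) (range_mul_le _ le_rfl), ← hdet, ← hdet, ← LinearMap.det_comp]
  congr 1
  ext x
  have hx : Q x = x := hQW _ x.2
  have hR : resolvent (Z - Q) w * (algebraMap ℂ (X →L[ℂ] X) w - (Z - Q)) = 1 := by
    obtain ⟨v, hv⟩ := spectrum.mem_resolventSet_iff.1 hw
    rw [resolvent, ← hv, Ring.inverse_unit, Units.inv_mul]
  have e : (((algebraMap ℂ (W →ₗ[ℂ] W) (w - z + 1) - n) x : W) : X) =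
      (algebraMap ℂ (X →L[ℂ] X) w - (Z - Q)) x := by
    change (w - z + 1) • (x : X) - (Z - algebraMap ℂ (X →L[ℂ] X) z) (Q x) =
      w • (x : X) - (Z x - Q x)
    rw [hx]
    change (w - z + 1) • (x : X) - (Z x - z • (x : X)) = w • (x : X) - (Z x - x)
    module
  have e' : (((algebraMap ℂ (W →ₗ[ℂ] W) (w - z) - n) x : W) : X) =
      (w - z) • (x : X) - (Z x - z • (x : X)) := by
    change (w - z) • (x : X) - (Z - algebraMap ℂ (X →L[ℂ] X) z) (Q x) = _
    rw [hx]
    rfl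
  rw [e', LinearMap.comp_apply, LinearMap.sub_apply, Submodule.coe_sub, coe_restrictTo,
    LinearMap.id_apply, e]
  have h4 : (Q * resolvent (Z - Q) w) ((algebraMap ℂ (X →L[ℂ] X) w - (Z - Q)) x) = x := by
    change Q ((resolvent (Z - Q) w * (algebraMap ℂ (X →L[ℂ] X) w - (Z - Q))) x) = x
    rw [hR]
    exact hx
  rw [h4]
  change w • (x : X) - (Z x - Q x) - x = _
  rw [hx]
  module

variable {X : Type u} [NormedAddCommGroup X] [NormedSpace ℂ X] [CompleteSpace X]
  {p γ : ℝ} {I : Submodule ℂ (X →L[ℂ] X)} {N : I → ℝ}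

/-- Replacing K by K' = K - Q moves z into the resolvent set of A + K', so the determinant for K' is
nonzero at z. The factorization 1 - K(w - A)⁻¹ = (1 - Q(w - A - K')⁻¹)(1 - K'(w - A)⁻¹) leaves the
factor ((w - z)/(w - z + 1))^m. -/
theorem IsLpIdeal.analyticOrderAt_pertDet (h : IsLpIdeal p γ I N) (hp : 0 < p) {Γ : ℝ}
    (hΓ : IsDetConstant X p Γ) (A : X →L[ℂ] X) (K : I) {z : ℂ} (hz : z ∈ resolventSet ℂ A)
    {Q : X →L[ℂ] X} (hQ : IsSpectralProjection (A + (K : X →L[ℂ] X)) z Q) (hQf : IsFiniteRank Q) :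
    analyticOrderAt (pertDet h A K) z =
      (Module.finrank ℂ (LinearMap.range (Q : X →ₗ[ℂ] X)) : ℕ∞) := by
  set m := Module.finrank ℂ (LinearMap.range (Q : X →ₗ[ℂ] X)) with hm
  let K' : I := K - ⟨Q, h.finiteRank_mem Q hQf⟩
  have hK' : (K' : X →L[ℂ] X) = K - Q := rfl
  have hZ' : A + (K' : X →L[ℂ] X) = A + K - Q := by rw [hK']; abel
  have hz' : z ∈ resolventSet ℂ (A + (K' : X →L[ℂ] X)) := by
    have := hQ.mem_resolventSet_shift (A := X →L[ℂ] X) (a := 1) (w := z) (by simp) (Or.inr rfl)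
    rwa [one_smul, ← hZ'] at this
  have hcR : ContinuousAt (resolvent A) z := (differentiableAt_resolvent hz).continuousAt
  have hcont : ∀ B : X →L[ℂ] X, ContinuousAt (fun w => B * resolvent A w) z := fun B =>
    continuousAt_const.mul hcR
  have hcD : ContinuousAt (pertDet h A K') z :=
    (h.analyticOnNhd_pertDet hp hΓ A K' z hz).continuousAt
  have hD : pertDet h A K' z ≠ 0 := by
    rw [Ne, h.pertDet_eq_zero_iff hp hΓ A K' hz]
    exact fun h1 => h1 hz'
  have hcorr : ContinuousAt (fun w : ℂ => traceCorrection ⌈p⌉₊ ((K : X →L[ℂ] X) * resolvent A w)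
      ((K' : X →L[ℂ] X) * resolvent A w)) z := by
    have e : ∀ w : ℂ, (K : X →L[ℂ] X) * resolvent A w - (K' : X →L[ℂ] X) * resolvent A w =
        Q * resolvent A w := fun w => by rw [hK', sub_mul, sub_sub_cancel]
    exact tendsto_traceCorrection ⌈p⌉₊
      (Eventually.of_forall fun w => by rw [e]; exact rank_mul_right_le hQf.rank_eq.le _)
      (by rw [e]; exact rank_mul_right_le hQf.rank_eq.le _) (hcont K) (hcont K')
  refine analyticOrderAt_eq_of_eventuallyEq_pow_mul (h.analyticOnNhd_pertDet hp hΓ A K z hz)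
    (g := fun w => ((w - z + 1) ^ m)⁻¹ * pertDet h A K' w *
      Complex.exp (traceCorrection ⌈p⌉₊ ((K : X →L[ℂ] X) * resolvent A w)
        ((K' : X →L[ℂ] X) * resolvent A w))) ?_ ?_ ?_
  · refine ContinuousAt.mul (ContinuousAt.mul (ContinuousAt.inv₀ (by fun_prop) (by simp)) hcD) ?_
    exact Complex.continuous_exp.continuousAt.comp hcorr
  · simpa using hD
  · have h1 : ∀ᶠ w in 𝓝 z, w - z + 1 ≠ 0 := by
      have : ContinuousAt (fun w : ℂ => w - z + 1) z := by fun_prop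
      exact this.eventually_ne (by simp)
    filter_upwards [(spectrum.isOpen_resolventSet A).mem_nhds hz,
      (spectrum.isOpen_resolventSet (A + (K' : X →L[ℂ] X))).mem_nhds hz', h1] with w hw hw' hw1
    have hfd := hQ.finDet_mul_pow hQf (hZ' ▸ hw')
    rw [← hm] at hfd
    have hGf : IsFiniteRank (Q * resolvent (A + K - Q) w) := hQf.mul_right _
    have hL : (resolventProduct h A K w : X →L[ℂ] X) = (resolventProduct h A K' w : X →L[ℂ] X) +
        Q * resolvent (A + K - Q) w * (1 - (resolventProduct h A K' w : X →L[ℂ] X)) := by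
      change (K : X →L[ℂ] X) * resolvent A w = (K' : X →L[ℂ] X) * resolvent A w +
        Q * resolvent (A + K - Q) w * (1 - (K' : X →L[ℂ] X) * resolvent A w)
      have e1 : 1 - (K' : X →L[ℂ] X) * resolvent A w =
          (algebraMap ℂ (X →L[ℂ] X) w - (A + K - Q)) * resolvent A w := by
        obtain ⟨v, hv⟩ := spectrum.mem_resolventSet_iff.1 hw
        rw [← hZ', ← sub_sub, ← hv, sub_mul, resolvent, ← hv, Ring.inverse_unit, Units.mul_inv]
      have e2 : resolvent (A + K - Q) w * (algebraMap ℂ (X →L[ℂ] X) w - (A + K - Q)) = 1 := by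
        rw [← hZ']
        obtain ⟨v, hv⟩ := spectrum.mem_resolventSet_iff.1 hw'
        rw [resolvent, ← hv, Ring.inverse_unit, Units.inv_mul]
      rw [e1, mul_assoc Q, ← mul_assoc (resolvent _ w), e2, one_mul, hK', sub_mul, sub_add_cancel]
    have key := h.regDet_mul hp hΓ hGf hL
    have hfd' : finDet (Q * resolvent (A + K - Q) w) = (w - z) ^ m * ((w - z + 1) ^ m)⁻¹ := by
      rw [← hfd, mul_assoc, mul_inv_cancel₀ (pow_ne_zero _ hw1), mul_one]
    rw [hfd'] at key
    refine (key.trans ?_)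
    simp only [mul_assoc]
    rfl

end Order

/-! ### Idempotence of the Riesz integral -/

section RieszIdempotent

variable {X : Type u} [NormedAddCommGroup X] [NormedSpace ℂ X]

theorem resolvent_mul_resolvent {Z : X →L[ℂ] X} {v w : ℂ} (hv : v ∈ resolventSet ℂ Z)
    (hw : w ∈ resolventSet ℂ Z) (hvw : v ≠ w) :
    resolvent Z v * resolvent Z w = (v - w)⁻¹ • (resolvent Z w - resolvent Z v) := by
  have h1 : resolvent Z v * (algebraMap ℂ (X →L[ℂ] X) v - Z) = 1 :=
    Ring.inverse_mul_cancel _ (spectrum.mem_resolventSet_iff.1 hv)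
  have h2 : (algebraMap ℂ (X →L[ℂ] X) w - Z) * resolvent Z w = 1 :=
    Ring.mul_inverse_cancel _ (spectrum.mem_resolventSet_iff.1 hw)
  have h3 : resolvent Z w - resolvent Z v = (v - w) • (resolvent Z v * resolvent Z w) := by
    calc resolvent Z w - resolvent Z v
        = resolvent Z v * (algebraMap ℂ (X →L[ℂ] X) v - Z) * resolvent Z w -
          resolvent Z v * ((algebraMap ℂ (X →L[ℂ] X) w - Z) * resolvent Z w) := by
          rw [h1, h2, one_mul, mul_one]
      _ = resolvent Z v * (algebraMap ℂ (X →L[ℂ] X) v - algebraMap ℂ (X →L[ℂ] X) w) *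
          resolvent Z w := by noncomm_ring
      _ = (v - w) • (resolvent Z v * resolvent Z w) := by
          rw [← map_sub, Algebra.algebraMap_eq_smul_one, mul_smul_comm, mul_one, smul_mul_assoc]
  rw [h3, smul_smul, inv_mul_cancel₀ (sub_ne_zero.2 hvw), one_smul]

variable [CompleteSpace X]

theorem Isolates.circleIntegral_eq {Z : X →L[ℂ] X} {z : ℂ} {r s : ℝ} (h : Isolates Z z s)
    (hr : 0 < r) (hrs : r ≤ s) :
    (∮ w in C(z, s), resolvent Z w) = ∮ w in C(z, r), resolvent Z w := by
  refine Complex.circleIntegral_eq_of_differentiable_on_annulus_off_countable hr hrs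
    Set.countable_empty ?_ ?_
  · refine (continuousOn_resolvent Z).mono fun w hw => h.mem_resolventSet hw.1 ?_
    rintro rfl
    exact hw.2 (Metric.mem_ball_self hr)
  · rintro w ⟨⟨hw, hw'⟩, -⟩
    refine differentiableAt_resolvent (h.mem_resolventSet (Metric.ball_subset_closedBall hw) ?_)
    rintro rfl
    exact hw' (Metric.mem_closedBall_self hr.le)

/-- The Riesz integral over a circle that isolates a point of the spectrum is idempotent. -/
theorem Isolates.rieszIntegral_idem {Z : X →L[ℂ] X} {z : ℂ} {s : ℝ} (h : Isolates Z z s) :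
    ((2 * (Real.pi : ℂ) * Complex.I)⁻¹ • ∮ w in C(z, s), resolvent Z w) *
      ((2 * (Real.pi : ℂ) * Complex.I)⁻¹ • ∮ w in C(z, s), resolvent Z w) =
      (2 * (Real.pi : ℂ) * Complex.I)⁻¹ • ∮ w in C(z, s), resolvent Z w := by
  set c : ℂ := (2 * (Real.pi : ℂ) * Complex.I)⁻¹ with hc
  have hs := h.1
  set r := s / 2 with hr
  have hr0 : 0 < r := by positivity
  have hrs : r < s := by linarith
  have hcont : ∀ t, 0 < t → t ≤ s → ContinuousOn (resolvent Z) (Metric.sphere z t) :=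
    fun t ht hts => (continuousOn_resolvent Z).mono fun w hw => h.mem_resolventSet
      (Metric.closedBall_subset_closedBall hts (Metric.sphere_subset_closedBall hw))
      (Metric.ne_of_mem_sphere hw ht.ne')
  have his := (hcont s hs le_rfl).circleIntegrable hs.le
  have hir := (hcont r hr0 hrs.le).circleIntegrable hr0.le
  -- The Cauchy integral of the resolvent over the outer circle; it is holomorphic inside, even
  -- across the spectral point z, so it integrates to 0 over the inner circle.
  set f : ℂ → X →L[ℂ] X := fun w => c • ∮ v in C(z, s), (v - w)⁻¹ • resolvent Z v with hf
  have hfd : DifferentiableOn ℂ f (Metric.ball z s) := by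
    have := (hasFPowerSeriesOn_cauchy_integral (R := s.toNNReal) (c := z) (f := resolvent Z)
      (by rwa [Real.coe_toNNReal s hs.le]) (by simpa using hs)).differentiableOn
    rw [Metric.eball_coe, Real.coe_toNNReal s hs.le] at this
    exact this
  have hf0 : (∮ w in C(z, r), f w) = 0 := by
    refine Complex.circleIntegral_eq_zero_of_differentiable_on_off_countable hr0.le
      Set.countable_empty
      (hfd.continuousOn.mono (Metric.closedBall_subset_ball hrs)) fun w hw => ?_
    exact hfd.differentiableAt (Metric.isOpen_ball.mem_nhds
      (Metric.ball_subset_ball hrs.le hw.1))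
  have hfc : ContinuousOn f (Metric.sphere z r) :=
    hfd.continuousOn.mono ((Metric.sphere_subset_closedBall).trans
      (Metric.closedBall_subset_ball hrs))
  -- By the resolvent identity; w lies inside the outer circle, so the integral of (v - w)⁻¹ is 2πi.
  have key : ∀ w ∈ Metric.sphere z r,
      (c • ∮ v in C(z, s), resolvent Z v) * resolvent Z w = resolvent Z w - f w := by
    intro w hw
    have hwb : w ∈ Metric.ball z s :=
      Metric.closedBall_subset_ball hrs (Metric.sphere_subset_closedBall hw)
    have hvw : ∀ v ∈ Metric.sphere z s, v ≠ w := by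
      rintro v hv rfl
      exact (Metric.mem_ball.1 hwb).ne hv
    have hwr : w ∈ resolventSet ℂ Z := h.mem_resolventSet (Metric.ball_subset_closedBall hwb)
      (Metric.ne_of_mem_sphere hw hr0.ne')
    have hi : ContinuousOn (fun v : ℂ => (v - w)⁻¹) (Metric.sphere z s) :=
      ContinuousOn.inv₀ (by fun_prop) fun v hv => sub_ne_zero.2 (hvw v hv)
    have hi1 : CircleIntegrable (fun v : ℂ => (v - w)⁻¹ • resolvent Z w) z s :=
      (hi.smul continuousOn_const).circleIntegrable hs.le
    have hi2 : CircleIntegrable (fun v : ℂ => (v - w)⁻¹ • resolvent Z v) z s :=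
      (hi.smul (hcont s hs le_rfl)).circleIntegrable hs.le
    have e1 : (∮ v in C(z, s), resolvent Z v) * resolvent Z w =
        ∮ v in C(z, s), ((v - w)⁻¹ • resolvent Z w - (v - w)⁻¹ • resolvent Z v) := by
      refine (circleIntegral_map ((ContinuousLinearMap.mul ℂ (X →L[ℂ] X)).flip
        (resolvent Z w)) his).trans ?_
      refine circleIntegral.integral_congr hs.le fun v hv => ?_
      change resolvent Z v * resolvent Z w = _
      rw [resolvent_mul_resolvent (h.mem_resolventSet (Metric.sphere_subset_closedBall hv)
        (Metric.ne_of_mem_sphere hv hs.ne')) hwr (hvw v hv), smul_sub]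
    rw [smul_mul_assoc, e1, circleIntegral.integral_sub hi1 hi2, circleIntegral.integral_smul_const,
      circleIntegral.integral_sub_inv_of_mem_ball hwb, smul_sub, smul_smul, hc,
      inv_mul_cancel₀ Complex.two_pi_I_ne_zero, one_smul]
  have e2 : (c • ∮ v in C(z, s), resolvent Z v) * (∮ w in C(z, r), resolvent Z w) =
      ∮ w in C(z, r), resolvent Z w := by
    have := (circleIntegral_map (ContinuousLinearMap.mul ℂ (X →L[ℂ] X)
      (c • ∮ v in C(z, s), resolvent Z v)) hir).trans
      (circleIntegral.integral_congr hr0.le fun w hw => key w hw)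
    rw [circleIntegral.integral_sub hir (hfc.circleIntegrable hr0.le), hf0, sub_zero] at this
    exact this
  rw [← h.circleIntegral_eq hr0 hrs.le] at e2
  rw [mul_smul_comm, e2]

end RieszIdempotent

/-! ### Nonzero spectrum of operators in the ideal -/

section CompactSpectrum

variable {X : Type u} [NormedAddCommGroup X] [NormedSpace ℂ X]

/-- F is injective on Ran P: if Px = x and Fx = 0, then ‖x‖ ≤ ‖P - F‖ ‖x‖. -/
theorem isFiniteRank_of_idempotent {P F : X →L[ℂ] X} (hP : P * P = P) (hF : IsFiniteRank F)
    (h : ‖P - F‖ < 1) : IsFiniteRank P := by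
  have hfd : FiniteDimensional ℂ (LinearMap.range (F : X →ₗ[ℂ] X)) := hF
  let φ : LinearMap.range (P : X →ₗ[ℂ] X) →ₗ[ℂ] LinearMap.range (F : X →ₗ[ℂ] X) :=
    (F : X →ₗ[ℂ] X).rangeRestrict ∘ₗ Submodule.subtype _
  refine FiniteDimensional.of_injective φ ?_
  rw [← LinearMap.ker_eq_bot, LinearMap.ker_eq_bot']
  rintro ⟨x, hx⟩ h0
  have hFx : F x = 0 := congrArg Subtype.val h0
  have hPx : P x = x := by
    obtain ⟨y, rfl⟩ := hx
    exact congrArg (fun B : X →L[ℂ] X => B y) hP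
  have h1 : ‖x‖ ≤ ‖P - F‖ * ‖x‖ := by
    have := (P - F).le_opNorm x
    rwa [sub_apply, hPx, hFx, sub_zero] at this
  have h2 : ‖x‖ = 0 := by nlinarith [norm_nonneg x]
  exact Subtype.ext (norm_eq_zero.1 h2)

theorem mem_resolventSet_zero {z : ℂ} (hz : z ≠ 0) : z ∈ resolventSet ℂ (0 : X →L[ℂ] X) := by
  rw [spectrum.mem_resolventSet_iff, sub_zero]
  exact (IsUnit.mk0 z hz).map _

variable [CompleteSpace X] {p γ : ℝ} {I : Submodule ℂ (X →L[ℂ] X)} {N : I → ℝ}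

/-- The perturbation determinant with A = 0 is analytic on the connected punctured plane and tends
to 1 at infinity, so its zeros, the nonzero spectrum of L, are isolated. A radius below ‖z‖ keeps 0
outside the disc. -/
theorem IsLpIdeal.exists_isolates (h : IsLpIdeal p γ I N) (hp : 0 < p) {Γ : ℝ}
    (hΓ : IsDetConstant X p Γ) (L : I) {z : ℂ} (hz : z ≠ 0) :
    ∃ r, r < ‖z‖ ∧ Isolates (L : X →L[ℂ] X) z r := by
  have hsub : ({0}ᶜ : Set ℂ) ⊆ resolventSet ℂ (0 : X →L[ℂ] X) := fun w hw =>
    mem_resolventSet_zero hw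
  have han : AnalyticOnNhd ℂ (pertDet h 0 L) {0}ᶜ := (h.analyticOnNhd_pertDet hp hΓ 0 L).mono hsub
  have hev : ∀ᶠ w in 𝓝[≠] z, pertDet h 0 L w ≠ 0 := by
    by_contra hcon
    have hfr : ∃ᶠ w in 𝓝[≠] z, pertDet h 0 L w = 0 := by
      simpa only [Ne, not_not] using Filter.not_eventually.1 hcon
    have hz0 := han.eqOn_zero_of_preconnected_of_frequently_eq_zero
      (isConnected_compl_singleton_of_one_lt_rank (by simp) 0).isPreconnected hz hfr
    have h1 := h.tendsto_pertDet hp hΓ 0 L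
    have h2 : Tendsto (pertDet h 0 L) (Bornology.cobounded ℂ) (𝓝 0) := by
      refine tendsto_const_nhds.congr' ?_
      filter_upwards [Bornology.eventually_ne_cobounded (0 : ℂ)] with w hw
      exact (hz0 hw).symm
    exact one_ne_zero (tendsto_nhds_unique h1 h2)
  obtain ⟨ε, hε, hball⟩ := Metric.mem_nhdsWithin_iff.1 hev
  have hz0 : 0 < ‖z‖ := norm_pos_iff.2 hz
  refine ⟨min (ε / 2) (‖z‖ / 2), by linarith [min_le_right (ε / 2) (‖z‖ / 2)], by positivity, ?_⟩
  rintro w ⟨hw1, hw2⟩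
  by_contra hwz
  have hd : dist w z ≤ min (ε / 2) (‖z‖ / 2) := hw1
  have hw0 : w ≠ 0 := by
    rintro rfl
    have := hd.trans (min_le_right _ _)
    rw [dist_zero_left] at this
    linarith
  have h1 : pertDet h 0 L w ≠ 0 :=
    hball ⟨lt_of_le_of_lt (hd.trans (min_le_left _ _)) (by linarith), hwz⟩
  refine h1 ((h.pertDet_eq_zero_iff hp hΓ 0 L (mem_resolventSet_zero hw0)).2 ?_)
  rwa [zero_add]

/-- At every nonzero point, an operator in an `l_p`-ideal has a spectral projection of finite
rank. -/
theorem IsLpIdeal.exists_isSpectralProjection (h : IsLpIdeal p γ I N) (hp : 0 < p) {Γ : ℝ}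
    (hΓ : IsDetConstant X p Γ) (L : I) {z : ℂ} (hz : z ≠ 0) :
    ∃ Q, IsSpectralProjection (L : X →L[ℂ] X) z Q ∧ IsFiniteRank Q := by
  obtain ⟨r, hrz, hr⟩ := h.exists_isolates hp hΓ L hz
  obtain ⟨S, h1, h2⟩ := exists_parametrix hr
  refine PertDet.exists_isSpectralProjection ?_ h1 h2
  have hr0 := hr.1
  have hmem : ∀ w ∈ Metric.sphere z r, w ∈ resolventSet ℂ (L : X →L[ℂ] X) := fun w hw =>
    hr.mem_resolventSet (Metric.sphere_subset_closedBall hw) (Metric.ne_of_mem_sphere hw hr0.ne')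
  have hw0 : ∀ w ∈ Metric.closedBall z r, w ≠ 0 := by
    rintro w hw rfl
    rw [Metric.mem_closedBall, dist_zero_left] at hw
    linarith
  have hw0' : ∀ w ∈ Metric.sphere z r, w ≠ 0 := fun w hw =>
    hw0 w (Metric.sphere_subset_closedBall hw)
  have hci : ContinuousOn (fun w : ℂ => w⁻¹) (Metric.closedBall z r) :=
    ContinuousOn.inv₀ continuousOn_id hw0
  have hc : ContinuousOn (fun w : ℂ => w⁻¹ • resolvent (L : X →L[ℂ] X) w) (Metric.sphere z r) :=
    (hci.mono Metric.sphere_subset_closedBall).smul ((continuousOn_resolvent _).mono hmem)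
  have hi := hc.circleIntegrable hr0.le
  have hc2 : ContinuousOn (fun w : ℂ => (L : X →L[ℂ] X) * (w⁻¹ • resolvent (L : X →L[ℂ] X) w))
    (Metric.sphere z r) := continuousOn_const.mul hc
  have hinv : (∮ w in C(z, r), w⁻¹ • (1 : X →L[ℂ] X)) = 0 := by
    rw [circleIntegral.integral_smul_const,
      Complex.circleIntegral_eq_zero_of_differentiable_on_off_countable hr0.le Set.countable_empty
        hci, zero_smul]
    exact fun w hw => differentiableAt_inv (hw0 w (Metric.ball_subset_closedBall hw.1))
  -- From (w - L)⁻¹ = w⁻¹(1 + L(w - L)⁻¹), where w⁻¹ integrates to 0. The Riesz integral is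
  -- therefore L times a bounded B, and FB with F close to L approximates it within distance 1.
  have e : (∮ w in C(z, r), resolvent (L : X →L[ℂ] X) w) =
      (L : X →L[ℂ] X) * ∮ w in C(z, r), w⁻¹ • resolvent (L : X →L[ℂ] X) w := by
    have e1 : (∮ w in C(z, r), resolvent (L : X →L[ℂ] X) w) = ∮ w in C(z, r),
        (w⁻¹ • (1 : X →L[ℂ] X) + (L : X →L[ℂ] X) * (w⁻¹ • resolvent (L : X →L[ℂ] X) w)) := by
      refine circleIntegral.integral_congr hr0.le fun w hw => ?_
      have h3 : (algebraMap ℂ (X →L[ℂ] X) w - L) * resolvent (L : X →L[ℂ] X) w = 1 :=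
        Ring.mul_inverse_cancel _ (spectrum.mem_resolventSet_iff.1 (hmem w hw))
      change resolvent (L : X →L[ℂ] X) w = _
      rw [mul_smul_comm, ← smul_add]
      nth_rewrite 1 [← h3]
      rw [← add_mul, sub_add_cancel, Algebra.algebraMap_eq_smul_one, smul_mul_assoc, one_mul,
        smul_smul, inv_mul_cancel₀ (hw0' w hw), one_smul]
    rw [e1, circleIntegral.integral_add, hinv, zero_add]
    · exact (circleIntegral_map (ContinuousLinearMap.mul ℂ (X →L[ℂ] X) L) hi).symm
    · exact ((hci.mono Metric.sphere_subset_closedBall).smul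
        continuousOn_const).circleIntegrable hr0.le
    · exact hc2.circleIntegrable hr0.le
  have hidem := hr.rieszIntegral_idem
  rw [e, ← mul_smul_comm] at hidem ⊢
  set B := (2 * (Real.pi : ℂ) * Complex.I)⁻¹ •
    ∮ w in C(z, r), w⁻¹ • resolvent (L : X →L[ℂ] X) w with hB
  obtain ⟨F, hF, hFN⟩ := h.finiteRank_dense L (1 / (‖B‖ + 1)) (by positivity)
  refine isFiniteRank_of_idempotent hidem (hF.mul_right B) ?_
  rw [← sub_mul]
  have h4 : ‖(L : X →L[ℂ] X) - F‖ ≤ N (L - F) := h.norm_le (L - F)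
  calc ‖((L : X →L[ℂ] X) - F) * B‖ ≤ ‖(L : X →L[ℂ] X) - F‖ * ‖B‖ := norm_mul_le _ _
    _ ≤ 1 / (‖B‖ + 1) * ‖B‖ := by gcongr; exact h4.trans hFN.le
    _ < 1 := by rw [one_div, inv_mul_lt_iff₀ (by positivity)]; linarith

end CompactSpectrum

/-! ### Zero-free functions and removal of zeros -/

section ZeroFree

open Asymptotics

/-- h is the primitive of G'/G with h(0) = 0; the derivative of G e^(-h) vanishes. -/
theorem exists_eq_exp_of_ne_zero {G : ℂ → ℂ} {R : ℝ} (hR : 0 < R)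
    (hG : DifferentiableOn ℂ G (Metric.ball 0 R)) (h0 : G 0 = 1)
    (hne : ∀ w ∈ Metric.ball (0 : ℂ) R, G w ≠ 0) :
    ∃ h : ℂ → ℂ, DifferentiableOn ℂ h (Metric.ball 0 R) ∧ h 0 = 0 ∧
      ∀ w ∈ Metric.ball (0 : ℂ) R, G w = Complex.exp (h w) := by
  have hlog : DifferentiableOn ℂ (fun w => deriv G w / G w) (Metric.ball 0 R) :=
    (hG.deriv Metric.isOpen_ball).div hG hne
  obtain ⟨h, hh0, hh⟩ := hlog.isExactOn_ball.with_val_at 0 0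
  have hd : DifferentiableOn ℂ h (Metric.ball 0 R) := fun w hw =>
    (hh w hw).differentiableAt.differentiableWithinAt
  refine ⟨h, hd, hh0, fun w hw => ?_⟩
  have h00 : (0 : ℂ) ∈ Metric.ball (0 : ℂ) R := Metric.mem_ball_self hR
  have key := Metric.isOpen_ball.is_const_of_deriv_eq_zero
    (convex_ball (0 : ℂ) R).isPreconnected (f := fun v => G v * Complex.exp (-h v))
    (hG.mul hd.neg.cexp) (fun v hv => by
      have h1 := (hG.differentiableAt (Metric.isOpen_ball.mem_nhds hv)).hasDerivAt
      have h2 := h1.mul (hh v hv).neg.cexp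
      refine HasDerivAt.deriv (f := fun v => G v * Complex.exp (-h v)) (h2.congr_deriv ?_)
      simp only [Pi.zero_apply, Pi.neg_apply]
      have := hne v hv
      field_simp
      ring) hw h00
  simp only [h0, hh0, neg_zero, Complex.exp_zero, mul_one] at key
  rw [← mul_one (Complex.exp (h w)), ← key, mul_comm (G w), ← mul_assoc, ← Complex.exp_add,
    add_neg_cancel, Complex.exp_zero, one_mul]

/-- A zero-free function `G` on a disc with `G - 1` of high order at `0` is close to `1` near the
center, in terms of the growth of `G`. -/
theorem norm_le_exp_of_ne_zero {G : ℂ → ℂ} {R M : ℝ} {n : ℕ} (hM : 0 < M)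
    (hG : DifferentiableOn ℂ G (Metric.ball 0 R)) (h0 : G 0 = 1)
    (hne : ∀ w ∈ Metric.ball (0 : ℂ) R, G w ≠ 0)
    (hb : ∀ w ∈ Metric.ball (0 : ℂ) R, ‖G w‖ ≤ Real.exp M)
    (ho : (fun w => G w - 1) =o[𝓝 0] fun w : ℂ => w ^ n) (hR : 2 < R) :
    ‖G 1‖ ≤ Real.exp (2 * M * (2 / R) ^ (n + 1)) := by
  have hR0 : 0 < R := by linarith
  obtain ⟨h, hd, hh0, hh⟩ := exists_eq_exp_of_ne_zero hR0 hG h0 hne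
  have hsub : Metric.ball (0 : ℂ) (R / 2) ⊆ Metric.ball 0 R := Metric.ball_subset_ball (by linarith)
  have hmaps : Set.MapsTo h (Metric.ball 0 (R / 2)) (Metric.closedBall (h 0) (2 * M)) := by
    intro w hw
    have hw' : ‖w‖ < R / 2 := by simpa using hw
    -- Borel–Carathéodory: Re h ≤ M on radius R yields |h| ≤ 2M on radius R/2.
    have h1 := Complex.borelCaratheodory_zero hM hd (fun v hv => by
      have := hb v hv
      rwa [hh v hv, Complex.norm_exp, Real.exp_le_exp] at this) hR0 (hsub hw) hh0
    rw [hh0, mem_closedBall_zero_iff]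
    refine h1.trans ?_
    rw [div_le_iff₀ (by linarith)]
    have : 2 * M * ‖w‖ ≤ 2 * M * (R - ‖w‖) := by gcongr; linarith
    exact this
  have hho : (fun w => h w - h 0) =o[𝓝 0] fun w : ℂ => ‖w - 0‖ ^ n := by
    simp only [hh0, sub_zero]
    have hcont : ContinuousAt h 0 :=
      (hd.differentiableAt (Metric.isOpen_ball.mem_nhds (Metric.mem_ball_self hR0))).continuousAt
    -- Near 0, h is comparable to e^h - 1 and so inherits the high order of vanishing; the Schwarz
    -- lemma of order n + 1 on the half disc then controls h(1).
    have hO : h =O[𝓝 0] fun w => G w - 1 := by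
      refine IsBigO.of_bound 2 ?_
      have h1 : ∀ᶠ w in 𝓝 0, ‖h w‖ < 1 / 2 := by
        have := hcont.norm
        rw [ContinuousAt, hh0, norm_zero] at this
        exact this.eventually (gt_mem_nhds (by norm_num))
      filter_upwards [h1, Metric.isOpen_ball.mem_nhds (Metric.mem_ball_self hR0)] with w hw hwb
      rw [hh w hwb]
      have h2 := Complex.norm_exp_sub_one_sub_id_le (x := h w) (by linarith)
      have h3 : ‖h w‖ ≤ ‖Complex.exp (h w) - 1‖ + ‖Complex.exp (h w) - 1 - h w‖ := by
        have := norm_sub_le (Complex.exp (h w) - 1) (Complex.exp (h w) - 1 - h w)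
        rwa [sub_sub_cancel] at this
      nlinarith [norm_nonneg (h w)]
    exact (hO.trans_isLittleO ho).trans_isBigO
      (IsBigO.of_bound 1 (Eventually.of_forall fun w => by simp))
  have h1 : (1 : ℂ) ∈ Metric.ball (0 : ℂ) (R / 2) := by
    rw [mem_ball_zero_iff, norm_one]; linarith
  have := Complex.dist_le_mul_div_pow_of_mapsTo_ball_of_isLittleO (hd.mono hsub) hmaps hho h1
  rw [hh0, dist_zero_right, dist_zero_right, norm_one] at this
  rw [hh 1 (hsub h1), Complex.norm_exp, Real.exp_le_exp]
  refine (Complex.re_le_norm _).trans (this.trans_eq ?_)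
  rw [one_div_div]

/-- Division of an entire function by the power of `w - a` that belongs to its order at `a`. -/
theorem exists_eq_pow_mul {f : ℂ → ℂ} (hf : Differentiable ℂ f) {a : ℂ} {m : ℕ}
    (hm : analyticOrderAt f a = m) :
    ∃ g : ℂ → ℂ, Differentiable ℂ g ∧ g a ≠ 0 ∧ ∀ w, f w = (w - a) ^ m * g w := by
  induction m generalizing f with
  | zero =>
    refine ⟨f, hf, ?_, by simp⟩
    exact (hf.analyticAt a).analyticOrderAt_eq_zero.1 (by simpa using hm)
  | succ m ih =>
    have hfa : f a = 0 := by
      by_contra h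
      rw [(hf.analyticAt a).analyticOrderAt_eq_zero.2 h] at hm
      norm_cast at hm
    have hd : Differentiable ℂ (dslope f a) := by
      rw [← differentiableOn_univ] at hf ⊢
      exact (Complex.differentiableOn_dslope univ_mem).2 hf
    have hfd : ∀ w, f w = (w - a) * dslope f a w := fun w => by
      have := sub_smul_dslope f a w
      rw [hfa, sub_zero, smul_eq_mul] at this
      exact this.symm
    have hord : analyticOrderAt (dslope f a) a = m := by
      have h1 : f = (fun w => w - a) * dslope f a := funext hfd
      rw [h1, analyticOrderAt_mul (by fun_prop) (hd.analyticAt a),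
        analyticOrderAt_id_sub_const_self, Nat.cast_add, Nat.cast_one, add_comm] at hm
      exact (ENat.add_left_injective_of_ne_top ENat.one_ne_top) hm
    obtain ⟨g, hg, hga, hgw⟩ := ih hd hord
    exact ⟨g, hg, hga, fun w => by rw [hfd, hgw, pow_succ']; ring⟩

theorem exists_eq_primaryFactor_pow_mul (n : ℕ) {f : ℂ → ℂ} (hf : Differentiable ℂ f) {a : ℂ}
    (ha : a ≠ 0) {m : ℕ} (hm : analyticOrderAt f a = m) :
    ∃ g : ℂ → ℂ, Differentiable ℂ g ∧ g a ≠ 0 ∧ ∀ w, f w = primaryFactor n (w / a) ^ m * g w := by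
  obtain ⟨g, hg, hga, hgw⟩ := exists_eq_pow_mul hf hm
  refine ⟨fun w => (-a) ^ m * Complex.exp (-∑ k ∈ Finset.Icc 1 (n - 1),
    (1 / (k : ℂ)) * (w / a) ^ k) ^ m * g w, by fun_prop, ?_, fun w => ?_⟩
  · exact mul_ne_zero (mul_ne_zero (pow_ne_zero _ (neg_ne_zero.2 ha))
      (pow_ne_zero _ (Complex.exp_ne_zero _))) hga
  · rw [hgw, primaryFactor, ← mul_assoc, ← mul_assoc, ← mul_pow, ← mul_pow]
    congr 2
    have : ∀ s : ℂ, (1 - w / a) * Complex.exp s * -a * Complex.exp (-s) =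
        (1 - w / a) * -a * (Complex.exp s * Complex.exp (-s)) := fun s => by ring
    rw [this, ← Complex.exp_add, add_neg_cancel, Complex.exp_zero]
    field_simp
    ring

theorem primaryFactor_ne_zero {n : ℕ} {u : ℂ} (hu : u ≠ 1) : primaryFactor n u ≠ 0 :=
  mul_ne_zero (sub_ne_zero.2 hu.symm) (Complex.exp_ne_zero _)

theorem exists_eq_prod_primaryFactor_mul (n : ℕ) {f : ℂ → ℂ} (hf : Differentiable ℂ f)
    (m : ℂ → ℕ) (T : Finset ℂ) (hT : ∀ a ∈ T, a ≠ 0 ∧ analyticOrderAt f a = m a) :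
    ∃ g : ℂ → ℂ, Differentiable ℂ g ∧ (∀ a ∈ T, g a ≠ 0) ∧
      ∀ w, f w = (∏ a ∈ T, primaryFactor n (w / a) ^ m a) * g w := by
  classical
  induction T using Finset.induction_on with
  | empty => exact ⟨f, hf, by simp, by simp⟩
  | insert b T hb ih =>
    obtain ⟨g, hg, hgT, hgw⟩ := ih fun a ha => hT a (Finset.mem_insert_of_mem ha)
    obtain ⟨hb0, hbm⟩ := hT b (Finset.mem_insert_self b T)
    have hPd : Differentiable ℂ fun w => ∏ a ∈ T, primaryFactor n (w / a) ^ m a := by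
      refine Differentiable.fun_finsetProd fun a _ => ?_
      exact ((differentiable_primaryFactor n).comp (by fun_prop)).pow _
    have hPb : (∏ a ∈ T, primaryFactor n (b / a) ^ m a) ≠ 0 := by
      refine Finset.prod_ne_zero_iff.2 fun a ha => pow_ne_zero _ (primaryFactor_ne_zero ?_)
      have ha0 := (hT a (Finset.mem_insert_of_mem ha)).1
      rw [Ne, div_eq_one_iff_eq ha0]
      rintro rfl
      exact hb ha
    -- The factors already removed do not vanish at b, so the order at b has not changed.
    have hgm : analyticOrderAt g b = m b := by
      have h1 : f = (fun w => ∏ a ∈ T, primaryFactor n (w / a) ^ m a) * g := funext hgw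
      rw [← hbm, h1, analyticOrderAt_mul (hPd.analyticAt b) (hg.analyticAt b),
        (hPd.analyticAt b).analyticOrderAt_eq_zero.2 hPb, zero_add]
    obtain ⟨G, hG, hGb, hGw⟩ := exists_eq_primaryFactor_pow_mul n hg hb0 hgm
    refine ⟨G, hG, ?_, fun w => by rw [hgw, hGw, Finset.prod_insert hb]; ring⟩
    intro a ha
    rcases Finset.mem_insert.1 ha with rfl | ha
    · exact hGb
    · intro h0
      exact hgT a ha (by rw [hGw, h0, mul_zero])

end ZeroFree

/-! ### Estimates for primary factors and zeros of entire functions -/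

section Growth

open Asymptotics

/-- For |u| ≥ 2 the linear factor has modulus at least 1, so only the exponential can be small. -/
theorem exp_neg_le_norm_primaryFactor (n : ℕ) {u : ℂ} (hu : 2 ≤ ‖u‖) :
    Real.exp (-(n * ‖u‖ ^ (n - 1))) ≤ ‖primaryFactor n u‖ := by
  have h1 : 1 ≤ ‖1 - u‖ := by
    have := norm_sub_norm_le u 1
    rw [norm_one, norm_sub_rev] at this
    linarith
  have h2 : ‖∑ k ∈ Finset.Icc 1 (n - 1), (1 / (k : ℂ)) * u ^ k‖ ≤ n * ‖u‖ ^ (n - 1) := by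
    refine (norm_sum_le_of_le _ (f := fun k : ℕ => (1 / (k : ℂ)) * u ^ k)
      (n := fun _ => ‖u‖ ^ (n - 1)) fun k hk => ?_).trans ?_
    · obtain ⟨hk1, hk2⟩ := Finset.mem_Icc.1 hk
      have hk1' : (1 : ℝ) ≤ k := by exact_mod_cast hk1
      rw [norm_mul, norm_pow, norm_div, norm_one, Complex.norm_natCast]
      calc 1 / (k : ℝ) * ‖u‖ ^ k ≤ 1 * ‖u‖ ^ k := by
            gcongr
            exact (div_le_one (by linarith)).2 hk1'
        _ ≤ ‖u‖ ^ (n - 1) := by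
            rw [one_mul]
            exact pow_le_pow_right₀ (by linarith) hk2
    · rw [Finset.sum_const, Nat.card_Icc, nsmul_eq_mul]
      gcongr
      lia
  rw [primaryFactor, norm_mul, Complex.norm_exp]
  calc Real.exp (-(n * ‖u‖ ^ (n - 1)))
      ≤ Real.exp (∑ k ∈ Finset.Icc 1 (n - 1), (1 / (k : ℂ)) * u ^ k).re := by
        rw [Real.exp_le_exp]
        have := (abs_le.1 (Complex.abs_re_le_norm
          (∑ k ∈ Finset.Icc 1 (n - 1), (1 / (k : ℂ)) * u ^ k))).1
        linarith
    _ ≤ _ := le_mul_of_one_le_left (Real.exp_pos _).le h1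

theorem isLittleO_mul_sub_one {φ ψ : ℂ → ℂ} {k : ℕ} (hψ : ContinuousAt ψ 0)
    (h1 : (fun w => φ w - 1) =o[𝓝 0] fun w : ℂ => w ^ k)
    (h2 : (fun w => ψ w - 1) =o[𝓝 0] fun w : ℂ => w ^ k) :
    (fun w => φ w * ψ w - 1) =o[𝓝 0] fun w : ℂ => w ^ k := by
  have h3 : (fun w => (φ w - 1) * ψ w) =o[𝓝 0] fun w : ℂ => w ^ k * 1 :=
    h1.mul_isBigO (hψ.tendsto.isBigO_one ℂ)
  simp only [mul_one] at h3
  exact (h3.add h2).congr_left fun w => by ring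

theorem isLittleO_sub_one_of_mul {φ ψ : ℂ → ℂ} {k : ℕ} (hψ : ContinuousAt ψ 0)
    (h1 : (fun w => φ w - 1) =o[𝓝 0] fun w : ℂ => w ^ k)
    (h2 : (fun w => φ w * ψ w - 1) =o[𝓝 0] fun w : ℂ => w ^ k) :
    (fun w => ψ w - 1) =o[𝓝 0] fun w : ℂ => w ^ k := by
  have h3 : (fun w => (φ w - 1) * ψ w) =o[𝓝 0] fun w : ℂ => w ^ k * 1 :=
    h1.mul_isBigO (hψ.tendsto.isBigO_one ℂ)
  simp only [mul_one] at h3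
  exact (h2.sub h3).congr_left fun w => by ring

/-- The value a = 0 is allowed: w/0 = 0 makes the factor constantly 1. This covers zero eigenvalues
when a is written as an inverse. -/
theorem isLittleO_primaryFactor_sub_one {n : ℕ} (hn : 1 ≤ n) (a : ℂ) :
    (fun w => primaryFactor n (w / a) - 1) =o[𝓝 0] fun w : ℂ => w ^ (n - 1) := by
  have h1 : (fun w => primaryFactor n (w / a) - 1) =O[𝓝 0] fun w : ℂ => w ^ n := by
    refine IsBigO.of_bound (4 * ‖a⁻¹‖ ^ n) ?_
    have h2 : ∀ᶠ w in 𝓝 (0 : ℂ), ‖w / a‖ < 1 / 2 := by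
      have : ContinuousAt (fun w : ℂ => ‖w / a‖) 0 := by fun_prop
      exact this.eventually (gt_mem_nhds (by simp))
    filter_upwards [h2] with w hw
    refine (norm_primaryFactor_sub_one_le hn hw.le).trans_eq ?_
    rw [div_eq_mul_inv, norm_mul, mul_pow, norm_pow]
    ring
  exact h1.trans_isLittleO (isLittleO_pow_pow (by lia))

theorem isLittleO_prod_primaryFactor_sub_one {n : ℕ} (hn : 1 ≤ n) (m : ℂ → ℕ) (T : Finset ℂ) :
    (fun w => (∏ a ∈ T, primaryFactor n (w / a) ^ m a) - 1) =o[𝓝 0] fun w : ℂ => w ^ (n - 1) := by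
  classical
  have hc : ∀ a : ℂ, Continuous fun w : ℂ => primaryFactor n (w / a) := fun a =>
    (differentiable_primaryFactor n).continuous.comp (by fun_prop)
  have hpow : ∀ (a : ℂ) (k : ℕ),
      (fun w => primaryFactor n (w / a) ^ k - 1) =o[𝓝 0] fun w : ℂ => w ^ (n - 1) := by
    intro a k
    induction k with
    | zero => simp
    | succ k ih =>
      simp only [pow_succ (primaryFactor n _)]
      exact isLittleO_mul_sub_one (hc a).continuousAt ih (isLittleO_primaryFactor_sub_one hn a)
  induction T using Finset.induction_on with
  | empty => simp
  | insert b T hb ih =>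
    simp only [Finset.prod_insert hb]
    refine isLittleO_mul_sub_one (Continuous.continuousAt ?_) (hpow b _) ih
    exact continuous_finsetProd _ fun a _ => (hc a).pow _

/-- Dominated convergence. It shows that the loss from dividing out the zeros in a disc of radius R
is o(R^p). -/
theorem tendsto_tsum_mul_min {ι : Type*} {g b : ι → ℝ} (hg : Summable g) (hg0 : ∀ i, 0 ≤ g i)
    (hb : ∀ i, 0 ≤ b i) {s : ℝ} (hs : 0 < s) :
    Tendsto (fun R : ℝ => ∑' i, g i * min 1 ((b i / R) ^ s)) atTop (𝓝 0) := by
  have h0 : ∑' _ : ι, (0 : ℝ) = 0 := tsum_zero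
  rw [← h0]
  refine tendsto_tsum_of_dominated_convergence hg (fun i => ?_) ?_
  · have h1 : Tendsto (fun R : ℝ => (b i / R) ^ s) atTop (𝓝 0) := by
      have := (tendsto_const_nhds (x := b i)).div_atTop tendsto_id
      simpa [Real.zero_rpow hs.ne'] using this.rpow_const (p := s) (Or.inr hs.le)
    have h2 := ((tendsto_const_nhds (x := (1 : ℝ))).min h1).const_mul (g i)
    simpa using h2
  · filter_upwards [eventually_ge_atTop 0] with R hR i
    have h3 : 0 ≤ (b i / R) ^ s := Real.rpow_nonneg (div_nonneg (hb i) hR) s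
    rw [Real.norm_of_nonneg (mul_nonneg (hg0 i) (le_min zero_le_one h3))]
    exact mul_le_of_le_one_right (hg0 i) (min_le_left _ _)

theorem finite_zeros {f : ℂ → ℂ} (hf : Differentiable ℂ f) (h0 : f 0 = 1) (R : ℝ) :
    {a | f a = 0 ∧ a ∈ Metric.closedBall (0 : ℂ) R}.Finite := by
  by_contra hinf
  obtain ⟨x, -, hx⟩ := Set.Infinite.exists_accPt_of_subset_isCompact hinf
    (isCompact_closedBall (0 : ℂ) R) fun a ha => ha.2
  rw [accPt_iff_frequently_nhdsNE] at hx
  have h1 : AnalyticOnNhd ℂ f Set.univ := fun z _ => hf.analyticAt z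
  have h2 := h1.eqOn_zero_of_preconnected_of_frequently_eq_zero isPreconnected_univ
    (Set.mem_univ x) (hx.mono fun a ha => ha.1)
  have := h2 (Set.mem_univ 0)
  rw [h0] at this
  exact one_ne_zero this

theorem analyticOrderAt_ne_top_of_entire {f : ℂ → ℂ} (hf : Differentiable ℂ f) (h0 : f 0 = 1)
    (a : ℂ) : analyticOrderAt f a ≠ ⊤ := by
  intro h
  rw [analyticOrderAt_eq_top] at h
  have h1 : AnalyticOnNhd ℂ f Set.univ := fun z _ => hf.analyticAt z
  have := h1.eqOn_zero_of_preconnected_of_eventuallyEq_zero isPreconnected_univ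
    (Set.mem_univ a) h (Set.mem_univ 0)
  rw [h0] at this
  exact one_ne_zero this

end Growth

/-! ### A Hadamard bound for entire functions of minimal type -/

section EntireBound

open Asymptotics

variable {p : ℝ} {f : ℂ → ℂ}

/-- The growth of an entire function divided by the primary factors of its zeros in a disc. -/
theorem norm_quotient_le {n : ℕ} {c δ R : ℝ} (hR : 0 < R) {G : ℂ → ℂ} (hG : Differentiable ℂ G)
    (hf : ∀ w, ‖f w‖ ≤ Real.exp (c + δ * ‖w‖ ^ p)) {m : ℂ → ℕ} {T : Finset ℂ}
    (hT : ∀ a ∈ T, a ≠ 0 ∧ ‖a‖ ≤ R)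
    (hfG : ∀ w, f w = (∏ a ∈ T, primaryFactor n (w / a) ^ m a) * G w) {w : ℂ} (hw : ‖w‖ ≤ 2 * R) :
    ‖G w‖ ≤ Real.exp (c + δ * (2 * R) ^ p +
      ∑ a ∈ T, m a * (n * (2 * R / ‖a‖) ^ (n - 1))) := by
  -- On |v| = 2R every quotient v/a has modulus at least 2, so the lower bound for primary factors
  -- applies; the maximum principle carries the estimate inside.
  have hsph : ∀ v : ℂ, ‖v‖ = 2 * R → ‖G v‖ ≤ Real.exp (c + δ * (2 * R) ^ p +
      ∑ a ∈ T, m a * (n * (2 * R / ‖a‖) ^ (n - 1))) := by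
    intro v hv
    have h1 : Real.exp (-∑ a ∈ T, m a * (n * (2 * R / ‖a‖) ^ (n - 1))) ≤
        ‖∏ a ∈ T, primaryFactor n (v / a) ^ m a‖ := by
      rw [← Finset.sum_neg_distrib, Real.exp_sum, norm_prod]
      refine Finset.prod_le_prod (fun _ _ => (Real.exp_pos _).le) fun a ha => ?_
      obtain ⟨ha0, haR⟩ := hT a ha
      have ha0' : 0 < ‖a‖ := norm_pos_iff.2 ha0
      rw [norm_pow, ← mul_neg, Real.exp_nat_mul]
      have h2 : 2 ≤ ‖v / a‖ := by
        rw [norm_div, hv, le_div_iff₀ ha0']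
        linarith
      have h3 := exp_neg_le_norm_primaryFactor n h2
      rw [norm_div, hv] at h3
      gcongr
    have h4 := hf v
    rw [hfG, norm_mul, hv] at h4
    have h5 := (mul_le_mul_of_nonneg_right h1 (norm_nonneg (G v))).trans h4
    rw [Real.exp_neg, inv_mul_le_iff₀ (Real.exp_pos _), ← Real.exp_add] at h5
    rwa [add_comm]
  refine Complex.norm_le_of_forall_mem_frontier_norm_le (U := Metric.ball 0 (2 * R))
    Metric.isBounded_ball hG.diffContOnCl (fun v hv => hsph v ?_) ?_
  · rw [frontier_ball _ (by positivity)] at hv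
    simpa using hv
  · rw [closure_ball _ (by positivity)]
    simpa using hw

/-- An entire function of order `p` and minimal type, with `f - 1` of high order at `0`, is bounded
by the product of the bounds of the primary factors of its zeros. -/
theorem norm_le_exp_of_minimalType (hp : 0 < p) (hf : Differentiable ℂ f) (h0 : f 0 = 1)
    (ho : (fun w => f w - 1) =o[𝓝 0] fun w : ℂ => w ^ (⌈p⌉₊ - 1))
    (htype : ∀ δ : ℝ, 0 < δ → ∃ c : ℝ, 0 < c ∧ ∀ w, ‖f w‖ ≤ Real.exp (c + δ * ‖w‖ ^ p))
    {Γ : ℝ} (hΓ : 0 ≤ Γ) (hE : ∀ u, ‖primaryFactor ⌈p⌉₊ u‖ ≤ Real.exp (Γ * ‖u‖ ^ p))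
    {S : ℝ} (hS : ∀ T : Finset ℂ, ∑ a ∈ T, (analyticOrderNatAt f a : ℝ) * ‖a‖ ^ (-p) ≤ S) :
    ‖f 1‖ ≤ Real.exp (Γ * S) := by
  set n := ⌈p⌉₊ with hn
  have hn1 : 1 ≤ n := Nat.ceil_pos.2 hp
  have hnp : p ≤ n := Nat.le_ceil p
  have hnp' : ((n - 1 : ℕ) : ℝ) < p := by
    have := Nat.ceil_lt_add_one hp.le
    rw [Nat.cast_sub hn1, Nat.cast_one]
    linarith
  set m : ℂ → ℕ := analyticOrderNatAt f with hm
  set g : ℂ → ℝ := fun a => (m a : ℝ) * ‖a‖ ^ (-p) with hg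
  have hg0 : ∀ a, 0 ≤ g a := fun a => by positivity
  have hgs : Summable g := summable_of_sum_le hg0 hS
  set s : ℝ := p - (n - 1 : ℕ) with hs
  have hs0 : 0 < s := by linarith
  have htail := tendsto_tsum_mul_min hgs hg0 (b := fun a : ℂ => ‖a‖) (fun a => norm_nonneg a) hs0
  suffices H : ∀ η : ℝ, 0 < η → ‖f 1‖ ≤ Real.exp (Γ * S + η) by
    have hlim : Tendsto (fun η : ℝ => Real.exp (Γ * S + η)) (𝓝[>] 0) (𝓝 (Real.exp (Γ * S))) := by
      have : Continuous fun η : ℝ => Real.exp (Γ * S + η) := by fun_prop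
      simpa using (this.tendsto 0).mono_left nhdsWithin_le_nhds
    exact ge_of_tendsto hlim (by filter_upwards [self_mem_nhdsWithin] with η hη using H η hη)
  intro η hη
  -- δ and ε, like the lower bound imposed on R below, are chosen so that each of the three summands
  -- of M contributes at most η/3 to 2M(2/R)^n.
  set δ : ℝ := η / (3 * 2 ^ (n + 1) * 2 ^ p) with hδ
  have hδ0 : 0 < δ := by positivity
  set ε : ℝ := η / (3 * 2 ^ (n + 1) * (n * 2 ^ (n - 1))) with hε
  have hn0 : (0 : ℝ) < n := by exact_mod_cast hn1
  have hε0 : 0 < ε := by positivity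
  obtain ⟨c, hc0, hc⟩ := htype δ hδ0
  obtain ⟨R, hRt, hR2, hRc⟩ := ((htail.eventually (ge_mem_nhds hε0)).and
    ((eventually_gt_atTop 2).and (eventually_ge_atTop (3 * 2 ^ (n + 1) * c / η)))).exists
  have hR0 : 0 < R := by linarith
  set T := (finite_zeros hf h0 R).toFinset with hT
  have hTmem : ∀ a, a ∈ T ↔ f a = 0 ∧ ‖a‖ ≤ R := fun a => by simp [hT]
  have hT0 : ∀ a ∈ T, a ≠ 0 := by
    rintro a ha rfl
    have := ((hTmem 0).1 ha).1
    rw [h0] at this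
    exact one_ne_zero this
  obtain ⟨G, hG, hGT, hfG⟩ := exists_eq_prod_primaryFactor_mul n hf m T fun a ha =>
    ⟨hT0 a ha, (Nat.cast_analyticOrderNatAt (analyticOrderAt_ne_top_of_entire hf h0 a)).symm⟩
  -- M bounds log |G| on the disc of radius 2R, where G is f divided by the primary factors of its
  -- zeros up to R. G is zero-free on the open disc of radius R and G - 1 is still o(w^(n-1)).
  set M : ℝ := c + δ * (2 * R) ^ p + ∑ a ∈ T, m a * (n * (2 * R / ‖a‖) ^ (n - 1)) with hM
  have hM0 : 0 < M := by positivity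
  have hG1 : ‖G 1‖ ≤ Real.exp (2 * M * (2 / R) ^ (n - 1 + 1)) := by
    refine norm_le_exp_of_ne_zero hM0 hG.differentiableOn ?_ ?_ ?_ ?_ hR2
    · have := hfG 0
      simpa [h0] using this.symm
    · intro w hw hGw
      refine hGT w ((hTmem w).2 ⟨by rw [hfG, hGw, mul_zero], ?_⟩) hGw
      exact (mem_ball_zero_iff.1 hw).le
    · intro w hw
      exact norm_quotient_le hR0 hG hc (fun a ha => ⟨hT0 a ha, ((hTmem a).1 ha).2⟩) hfG
        ((mem_ball_zero_iff.1 hw).le.trans (by linarith))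
    · exact isLittleO_sub_one_of_mul hG.continuous.continuousAt
        (isLittleO_prod_primaryFactor_sub_one hn1 m T) (ho.congr_left fun w => by rw [hfG])
  have hsum : ∑ a ∈ T, m a * (n * (2 * R / ‖a‖) ^ (n - 1)) ≤ n * 2 ^ (n - 1) * ε * R ^ p := by
    -- Rewrites (R/|a|)^(n-1) as R^p |a|^(-p) (|a|/R)^s with s = p - (n - 1); the minimum with 1 is
    -- inactive because |a| ≤ R.
    have e : ∀ a ∈ T, (m a : ℝ) * (n * (2 * R / ‖a‖) ^ (n - 1)) =
        n * 2 ^ (n - 1) * R ^ p * (g a * min 1 ((‖a‖ / R) ^ s)) := by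
      intro a ha
      have ha0 : 0 < ‖a‖ := norm_pos_iff.2 (hT0 a ha)
      have ha1 : ‖a‖ / R ≤ 1 := (div_le_one hR0).2 ((hTmem a).1 ha).2
      rw [min_eq_right (Real.rpow_le_one (by positivity) ha1 hs0.le), hs,
        Real.rpow_sub (by positivity), Real.rpow_natCast, Real.div_rpow ha0.le hR0.le, hg]
      simp only
      rw [Real.rpow_neg ha0.le, div_pow, div_pow, mul_pow]
      have := (Real.rpow_pos_of_pos hR0 p).ne'
      have := (Real.rpow_pos_of_pos ha0 p).ne'
      field_simp
    rw [Finset.sum_congr rfl e, ← Finset.mul_sum]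
    have hle : ∀ a, g a * min 1 ((‖a‖ / R) ^ s) ≤ g a := fun a =>
      mul_le_of_le_one_right (hg0 a) (min_le_left _ _)
    have hnn : ∀ a : ℂ, 0 ≤ g a * min 1 ((‖a‖ / R) ^ s) := fun a =>
      mul_nonneg (hg0 a) (le_min zero_le_one (by positivity))
    have h1 := (Summable.of_nonneg_of_le hnn hle hgs).sum_le_tsum T fun a _ => hnn a
    calc n * 2 ^ (n - 1) * R ^ p * ∑ a ∈ T, g a * min 1 ((‖a‖ / R) ^ s)
        ≤ n * 2 ^ (n - 1) * R ^ p * ε := by gcongr; exact h1.trans hRt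
      _ = n * 2 ^ (n - 1) * ε * R ^ p := by ring
  -- Since R ≥ 1 and p ≤ n, R^p ≤ R^n. If p is an integer there is equality, and the arbitrarily
  -- small δ is indispensable.
  have hbound : 2 * M * (2 / R) ^ (n - 1 + 1) ≤ η := by
    have hRp : R ^ p ≤ R ^ n := by
      rw [← Real.rpow_natCast R n]
      exact Real.rpow_le_rpow_of_exponent_le (by linarith) hnp
    have hRn : R ≤ R ^ n := le_self_pow₀ (by linarith) (by lia)
    have hRn0 : 0 < R ^ n := by positivity
    have h1 : M ≤ (η / 2 ^ (n + 1)) * R ^ n := by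
      have e1 : c ≤ η / (3 * 2 ^ (n + 1)) * R ^ n := by
        have : c = η / (3 * 2 ^ (n + 1)) * (3 * 2 ^ (n + 1) * c / η) := by field_simp
        rw [this]
        gcongr
        exact hRc.trans hRn
      have e2 : δ * (2 * R) ^ p ≤ η / (3 * 2 ^ (n + 1)) * R ^ n := by
        rw [Real.mul_rpow (by norm_num) hR0.le]
        calc δ * (2 ^ p * R ^ p) = η / (3 * 2 ^ (n + 1)) * R ^ p := by
              rw [hδ]; field_simp
          _ ≤ _ := by gcongr
      have e3 : n * 2 ^ (n - 1) * ε * R ^ p ≤ η / (3 * 2 ^ (n + 1)) * R ^ n := by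
        calc n * 2 ^ (n - 1) * ε * R ^ p = η / (3 * 2 ^ (n + 1)) * R ^ p := by
              rw [hε]; field_simp
          _ ≤ _ := by gcongr
      calc M ≤ η / (3 * 2 ^ (n + 1)) * R ^ n + η / (3 * 2 ^ (n + 1)) * R ^ n +
            η / (3 * 2 ^ (n + 1)) * R ^ n := by
            rw [hM]
            exact add_le_add (add_le_add e1 e2) (hsum.trans e3)
        _ = _ := by field_simp; ring
    rw [Nat.sub_add_cancel hn1, div_pow]
    calc 2 * M * (2 ^ n / R ^ n) ≤ 2 * ((η / 2 ^ (n + 1)) * R ^ n) * (2 ^ n / R ^ n) := by gcongr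
      _ = η := by rw [pow_succ]; field_simp
  have hprod : ‖∏ a ∈ T, primaryFactor n (1 / a) ^ m a‖ ≤ Real.exp (Γ * S) := by
    rw [norm_prod]
    calc ∏ a ∈ T, ‖primaryFactor n (1 / a) ^ m a‖ ≤ ∏ a ∈ T, Real.exp (Γ * g a) := by
          refine Finset.prod_le_prod (fun _ _ => norm_nonneg _) fun a ha => ?_
          rw [norm_pow]
          have h1 := pow_le_pow_left₀ (norm_nonneg _) (hE (1 / a)) (m a)
          refine h1.trans_eq ?_
          change _ = Real.exp (Γ * ((m a : ℝ) * ‖a‖ ^ (-p)))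
          rw [← Real.exp_nat_mul, norm_div, norm_one, one_div, Real.inv_rpow (norm_nonneg a),
            Real.rpow_neg (norm_nonneg a)]
          congr 1
          ring
      _ = Real.exp (Γ * ∑ a ∈ T, g a) := by rw [← Real.exp_sum, Finset.mul_sum]
      _ ≤ _ := by gcongr; exact hS T
  rw [hfG, norm_mul, Real.exp_add]
  exact mul_le_mul hprod (hG1.trans (Real.exp_le_exp.2 hbound)) (norm_nonneg _) (Real.exp_pos _).le

end EntireBound

/-! ### Auxiliary growth estimates for the determinant -/

section MinimalType

open Asymptotics

theorem exists_pow_le_add_mul_rpow {k : ℕ} {p δ : ℝ} (hk : (k : ℝ) < p) (hδ : 0 < δ) :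
    ∃ c : ℝ, 0 ≤ c ∧ ∀ x : ℝ, 0 ≤ x → x ^ k ≤ c + δ * x ^ p := by
  have h1 : Tendsto (fun x : ℝ => x ^ (p - k)) atTop atTop := tendsto_rpow_atTop (by linarith)
  obtain ⟨b, hb⟩ := (h1.eventually_ge_atTop δ⁻¹).exists_forall_of_atTop
  refine ⟨max b 1 ^ k, by positivity, fun x hx => ?_⟩
  have h3 : 0 ≤ δ * x ^ p := by positivity
  rcases le_total x (max b 1) with hxb | hxb
  · have := pow_le_pow_left₀ hx hxb k
    linarith
  · have hx0 : 0 < x := lt_of_lt_of_le (by positivity) hxb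
    have h2 := hb x ((le_max_left _ _).trans hxb)
    rw [Real.rpow_sub hx0, Real.rpow_natCast, le_div_iff₀ (by positivity),
      inv_mul_le_iff₀ hδ] at h2
    have h4 : 0 ≤ max b 1 ^ k := by positivity
    linarith

variable {X : Type u} [NormedAddCommGroup X] [NormedSpace ℂ X]

/-- The rank bound kr of the k-th difference cancels the weight 1/k. What matters is the degree n -
1 in |w|, which for n = ⌈p⌉ is less than p. -/
theorem norm_traceCorrection_smul_le (n : ℕ) {S T : X →L[ℂ] X} {r : ℕ} {a : ℝ}
    (hr : LinearMap.rank ((S - T : X →L[ℂ] X) : X →ₗ[ℂ] X) ≤ r) (hS : ‖S‖ ≤ a) (hT : ‖T‖ ≤ a)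
    (w : ℂ) : ‖traceCorrection n (w • S) (w • T)‖ ≤
      (∑ k ∈ Finset.Icc 1 (n - 1), r * (2 * a ^ k)) * (1 + ‖w‖ ^ (n - 1)) := by
  rw [traceCorrection, Finset.sum_mul]
  refine norm_sum_le_of_le _ fun k hk => ?_
  obtain ⟨hk1, hk2⟩ := Finset.mem_Icc.1 hk
  have hk0 : (0 : ℝ) < k := by exact_mod_cast hk1
  have ha : 0 ≤ a := (norm_nonneg S).trans hS
  have h1 := norm_finTrace_le (T := (w • S) ^ k - (w • T) ^ k) (r := k * r)
    (rank_pow_sub_pow_le (by rw [← smul_sub]; exact rank_smul_le' w hr) k)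
  have h2 : ‖(w • S) ^ k - (w • T) ^ k‖ ≤ ‖w‖ ^ k * (2 * a ^ k) := by
    rw [smul_pow, smul_pow, ← smul_sub, norm_smul, norm_pow]
    gcongr
    have hS' := (norm_pow_le' S hk1).trans (pow_le_pow_left₀ (norm_nonneg S) hS k)
    have hT' := (norm_pow_le' T hk1).trans (pow_le_pow_left₀ (norm_nonneg T) hT k)
    linarith [norm_sub_le (S ^ k) (T ^ k)]
  have h3 : ‖w‖ ^ k ≤ 1 + ‖w‖ ^ (n - 1) := by
    rcases le_total ‖w‖ 1 with hw | hw
    · have := pow_le_one₀ (n := k) (norm_nonneg w) hw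
      have : 0 ≤ ‖w‖ ^ (n - 1) := by positivity
      linarith
    · have := pow_le_pow_right₀ hw hk2
      linarith
  rw [norm_mul, norm_div, norm_one, Complex.norm_natCast]
  calc 1 / (k : ℝ) * ‖finTrace ((w • S) ^ k - (w • T) ^ k)‖
      ≤ 1 / (k : ℝ) * (((k * r : ℕ) : ℝ) * (‖w‖ ^ k * (2 * a ^ k))) := by
        gcongr
        exact h1.trans (by gcongr)
    _ = r * (2 * a ^ k) * ‖w‖ ^ k := by push_cast; field_simp
    _ ≤ _ := by gcongr

theorem finDet_smul_eq_prod {G : X →L[ℂ] X} (hG : IsFiniteRank G) (t : ℂ) :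
    finDet (t • G) = ((eigenvalueMultiset G hG).map fun μ => 1 - t * μ).prod := by
  have : FiniteDimensional ℂ (LinearMap.range (G : X →ₗ[ℂ] X)) := hG
  rw [finDet_eq_det_restrictTo (W := LinearMap.range (G : X →ₗ[ℂ] X)) (range_smul_le t le_rfl)]
  exact det_id_sub_smul_eq_prod_roots (restrictRange G) t

/-- The determinant det(I - tG) is a polynomial in t. The maximum principle for the reversed
polynomial s^d det(I - s⁻¹G) on |s| ≤ 1/ε transports a bound from |t| = ε to t = 1 at the cost
ε^(-d), with d the rank. -/
theorem norm_finDet_le {G : X →L[ℂ] X} (hG : IsFiniteRank G) {ε B : ℝ} (hε : 0 < ε) (hε1 : ε ≤ 1)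
    (h : ∀ t : ℂ, ‖t‖ = ε → ‖finDet (t • G)‖ ≤ B) :
    ‖finDet G‖ ≤ (ε⁻¹) ^ Multiset.card (eigenvalueMultiset G hG) * B := by
  set E := eigenvalueMultiset G hG with hE
  let φ : ℂ → ℂ := fun s => (E.map fun μ => s - μ).prod
  have hφ : Differentiable ℂ φ := by
    have : ∀ E : Multiset ℂ, Differentiable ℂ fun s : ℂ => (E.map fun μ => s - μ).prod := by
      intro E
      induction E using Multiset.induction_on with
      | empty => simp
      | cons μ E ih =>
        simp only [Multiset.map_cons, Multiset.prod_cons]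
        exact (differentiable_id.sub_const μ).mul ih
    exact this E
  have hinv : ∀ s : ℂ, s ≠ 0 → φ s = s ^ Multiset.card E * finDet (s⁻¹ • G) := by
    intro s hs
    rw [finDet_smul_eq_prod hG, ← hE, ← Multiset.prod_replicate, ← Multiset.map_const',
      ← Multiset.prod_map_mul]
    refine congrArg Multiset.prod (Multiset.map_congr rfl fun μ _ => ?_)
    field_simp
  have h1 : finDet G = φ 1 := by
    rw [hinv 1 one_ne_zero]; simp
  have hε' : 0 < ε⁻¹ := by positivity
  rw [h1]
  refine Complex.norm_le_of_forall_mem_frontier_norm_le (U := Metric.ball 0 ε⁻¹)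
    Metric.isBounded_ball hφ.diffContOnCl (fun s hs => ?_) ?_
  · rw [frontier_ball _ hε'.ne', mem_sphere_zero_iff_norm] at hs
    have hs0 : s ≠ 0 := by
      rintro rfl
      rw [norm_zero] at hs
      exact hε'.ne hs
    rw [hinv s hs0, norm_mul, norm_pow, hs]
    gcongr
    exact h _ (by rw [norm_inv, hs, inv_inv])
  · rw [closure_ball _ hε'.ne', mem_closedBall_zero_iff, norm_one]
    exact (one_le_inv₀ hε).2 hε1

theorem card_eigenvalueMultiset {G : X →L[ℂ] X} (hG : IsFiniteRank G) :
    Multiset.card (eigenvalueMultiset G hG) =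
      Module.finrank ℂ (LinearMap.range (G : X →ₗ[ℂ] X)) := by
  have : FiniteDimensional ℂ (LinearMap.range (G : X →ₗ[ℂ] X)) := hG
  rw [eigenvalueMultiset, ← LinearMap.charpoly_natDegree (restrictRange G)]
  exact (IsAlgClosed.splits _).natDegree_eq_card_roots.symm

variable {p γ : ℝ} {I : Submodule ℂ (X →L[ℂ] X)} {N : I → ℝ}

theorem IsLpIdeal.differentiable_regDet_smul (h : IsLpIdeal p γ I N) (hp : 0 < p) {Γ : ℝ}
    (hΓ : IsDetConstant X p Γ) (L : I) : Differentiable ℂ fun w : ℂ => regDet p I N (w • L) := by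
  have h1 := h.differentiableOn_regDet hp hΓ L (T := fun w => w • 1) isOpen_univ
    (by fun_prop)
  have e : ∀ w : ℂ, h.mulRight L (w • 1) = w • L := fun w =>
    Subtype.ext (by simp [IsLpIdeal.mulRight])
  simp only [e] at h1
  exact differentiableOn_univ.1 h1

/-- For finite rank operators this is read off the product formula. The Schwarz lemma of order n
turns it into a bound B|w|^n on the unit disc, uniform along the approximants, which survives the
limit. -/
theorem IsLpIdeal.isLittleO_regDet_smul_sub_one (h : IsLpIdeal p γ I N) (hp : 0 < p) {Γ : ℝ}
    (hΓ : IsDetConstant X p Γ) (L : I) :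
    (fun w : ℂ => regDet p I N (w • L) - 1) =o[𝓝 0] fun w : ℂ => w ^ (⌈p⌉₊ - 1) := by
  have hn1 : 1 ≤ ⌈p⌉₊ := Nat.ceil_pos.2 hp
  obtain ⟨C, hC0, hC⟩ := h.exists_norm_regDet_le hp hΓ
  obtain ⟨q, hq1, hq⟩ := h.quasiNorm.quasi_triangle
  obtain ⟨F, hF, hFL⟩ := h.exists_seq L
  set B : ℝ := Real.exp (C * (q * (N L + 1)) ^ p) + 1 with hB
  have hq0 : (0 : ℝ) ≤ q := by linarith
  have hNL := h.quasiNorm.nonneg L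
  have hprod : ∀ E : Multiset ℂ, (fun w : ℂ => (E.map fun μ => primaryFactor ⌈p⌉₊ (w * μ)).prod - 1)
      =o[𝓝 0] fun w : ℂ => w ^ (⌈p⌉₊ - 1) := by
    intro E
    induction E using Multiset.induction_on with
    | empty => simp
    | cons μ E ih =>
      simp only [Multiset.map_cons, Multiset.prod_cons]
      refine isLittleO_mul_sub_one ?_ ?_ ih
      · refine Continuous.continuousAt ?_
        exact continuous_multiset_prod _ fun μ _ =>
          (differentiable_primaryFactor _).continuous.comp (by fun_prop)
      · simpa using isLittleO_primaryFactor_sub_one hn1 μ⁻¹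
  have hbd : ∀ w ∈ Metric.ball (0 : ℂ) 1, ‖regDet p I N (w • L) - 1‖ ≤ B * ‖w‖ ^ ⌈p⌉₊ := by
    intro w hw
    have hlim : Tendsto (fun j => ‖regDet p I N (w • F j) - 1‖) atTop
        (𝓝 ‖regDet p I N (w • L) - 1‖) := by
      refine ((h.tendsto_regDet hp hΓ ?_).sub_const 1).norm
      have : ∀ j, N (w • F j - w • L) = ‖w‖ * N (F j - L) := fun j => by
        have e : w • F j - w • L = w • (F j - L) := (smul_sub w (F j) L).symm
        rw [e, h.quasiNorm.smul]
      simpa only [this, mul_zero] using hFL.const_mul ‖w‖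
    refine le_of_tendsto hlim ?_
    filter_upwards [eventually_quasiNorm_le hFL hq1 hq one_pos] with j hj
    have hf0 : regDet p I N ((0 : ℂ) • F j) = 1 := by rw [zero_smul, h.regDet_zero hp hΓ]
    have := Complex.dist_le_mul_div_pow_of_mapsTo_ball_of_isLittleO (n := ⌈p⌉₊ - 1)
      (h.differentiable_regDet_smul hp hΓ (F j)).differentiableOn (R₁ := 1) (R₂ := B) (c := 0)
      (fun v hv => ?_) ?_ hw
    · simp only [hf0] at this
      rwa [dist_zero_right, div_one, Nat.sub_add_cancel hn1, dist_eq_norm] at this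
    · rw [hf0, Metric.mem_closedBall, dist_eq_norm]
      refine (norm_sub_le _ _).trans ?_
      rw [norm_one, hB]
      gcongr
      refine (hC _).trans (Real.exp_le_exp.2 ?_)
      have hv1 : ‖v‖ ≤ 1 := (mem_ball_zero_iff.1 hv).le
      have := h.quasiNorm.nonneg (v • F j)
      gcongr
      rw [h.quasiNorm.smul]
      exact (mul_le_of_le_one_left (h.quasiNorm.nonneg _) hv1).trans hj
    · simp only [hf0, sub_zero]
      refine IsLittleO.trans_isBigO ?_
        (IsBigO.of_bound 1 (Eventually.of_forall fun w : ℂ => by simp) :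
          (fun w : ℂ => w ^ (⌈p⌉₊ - 1)) =O[𝓝 0] fun w : ℂ => ‖w‖ ^ (⌈p⌉₊ - 1))
      refine (hprod (eigenvalueMultiset _ (hF j))).congr_left fun v => ?_
      rw [← finRegDet_smul_eq_prod (hF j), ← Submodule.coe_smul, h.regDet_eq hp hΓ]
      exact (hF j).smul v
  have hO : (fun w : ℂ => regDet p I N (w • L) - 1) =O[𝓝 0] fun w : ℂ => w ^ ⌈p⌉₊ := by
    refine IsBigO.of_bound B ?_
    filter_upwards [Metric.ball_mem_nhds (0 : ℂ) one_pos] with w hw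
    rw [norm_pow]
    exact hbd w hw
  exact hO.trans_isLittleO (isLittleO_pow_pow (by lia))

end MinimalType

/-! ### Minimal type, zeros and the sharp determinant bound -/

section DeterminantBound

variable {X : Type u} [NormedAddCommGroup X] [NormedSpace ℂ X] [CompleteSpace X]
  {p γ : ℝ} {I : Submodule ℂ (X →L[ℂ] X)} {N : I → ℝ}

/-- `w ↦ det_p (I - w (M + F))` on the complement of the zeros of `w ↦ det_p (I - w M)`, for `F` of
finite rank, in terms of the operators `M + t F` with `|t| = ε`. -/
theorem IsLpIdeal.norm_regDet_smul_add_le (h : IsLpIdeal p γ I N) (hp : 0 < p) {Γ : ℝ}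
    (hΓ : IsDetConstant X p Γ) {M F : I} (hF : IsFiniteRank (F : X →L[ℂ] X)) {ε B c : ℝ}
    (hε : 0 < ε) (hε1 : ε ≤ 1) {w : ℂ} (hw : regDet p I N (w • M) ≠ 0)
    (hB : ∀ t : ℂ, ‖t‖ = ε → ‖regDet p I N (w • (M + t • F))‖ ≤ B)
    (hc : ∀ t : ℂ, ‖t‖ ≤ 1 → ‖traceCorrection ⌈p⌉₊
      (w • ((M : X →L[ℂ] X) + t • (F : X →L[ℂ] X))) (w • (M : X →L[ℂ] X))‖ ≤ c) :
    ‖regDet p I N (w • (M + F))‖ ≤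
      (ε⁻¹) ^ Module.finrank ℂ (LinearMap.range ((F : X →L[ℂ] X) : X →ₗ[ℂ] X)) *
        (B * Real.exp (2 * c)) := by
  have hfd : FiniteDimensional ℂ (LinearMap.range ((F : X →L[ℂ] X) : X →ₗ[ℂ] X)) := hF
  obtain ⟨v, hv⟩ : IsUnit (1 - ((w • M : I) : X →L[ℂ] X)) := by
    by_contra hcon
    exact hw ((h.regDet_eq_zero_iff hp hΓ _).2 hcon)
  -- Chosen so that 1 - w(M + tF) = (1 - tG)(1 - wM) for all t. G depends on w, but its range stays
  -- in Ran F.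
  set G : X →L[ℂ] X := w • (F : X →L[ℂ] X) * ↑v⁻¹ with hG
  have hGr : LinearMap.range (G : X →ₗ[ℂ] X) ≤ LinearMap.range ((F : X →L[ℂ] X) : X →ₗ[ℂ] X) :=
    range_mul_le _ (range_smul_le w le_rfl)
  have hGf : IsFiniteRank G := isFiniteRank_of_range_le hGr
  have hfac : ∀ t : ℂ, ((w • (M + t • F) : I) : X →L[ℂ] X) =
      ((w • M : I) : X →L[ℂ] X) + t • G * (1 - ((w • M : I) : X →L[ℂ] X)) := by
    intro t
    rw [← hv, hG, smul_mul_assoc, mul_assoc, Units.inv_mul, mul_one]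
    change w • ((M : X →L[ℂ] X) + t • (F : X →L[ℂ] X)) = w • (M : X →L[ℂ] X) + t • w • (F : X →L[ℂ] X)
    module
  have key : ∀ t : ℂ, regDet p I N (w • (M + t • F)) = finDet (t • G) * regDet p I N (w • M) *
      Complex.exp (traceCorrection ⌈p⌉₊ (w • ((M : X →L[ℂ] X) + t • (F : X →L[ℂ] X)))
        (w • (M : X →L[ℂ] X))) := fun t => h.regDet_mul hp hΓ (hGf.smul t) (hfac t)
  have hexp : ∀ t : ℂ, ‖t‖ ≤ 1 → Real.exp (-c) ≤ ‖Complex.exp (traceCorrection ⌈p⌉₊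
      (w • ((M : X →L[ℂ] X) + t • (F : X →L[ℂ] X))) (w • (M : X →L[ℂ] X)))‖ ∧
      ‖Complex.exp (traceCorrection ⌈p⌉₊ (w • ((M : X →L[ℂ] X) + t • (F : X →L[ℂ] X)))
        (w • (M : X →L[ℂ] X)))‖ ≤ Real.exp c := by
    intro t ht
    have := abs_le.1 ((Complex.abs_re_le_norm _).trans (hc t ht))
    rw [Complex.norm_exp, Real.exp_le_exp, Real.exp_le_exp]
    exact this
  have hD : 0 < ‖regDet p I N (w • M)‖ := norm_pos_iff.2 hw
  have hdet : ∀ t : ℂ, ‖t‖ = ε → ‖finDet (t • G)‖ ≤ B * Real.exp c / ‖regDet p I N (w • M)‖ := by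
    intro t ht
    have h1 := hB t ht
    rw [key t, norm_mul, norm_mul] at h1
    have h2 := (mul_le_mul_of_nonneg_left (hexp t (ht.trans_le hε1)).1 (by positivity)).trans h1
    rw [Real.exp_neg, ← div_eq_mul_inv, div_le_iff₀ (Real.exp_pos _)] at h2
    rwa [le_div_iff₀ hD]
  have h3 := norm_finDet_le hGf hε hε1 hdet
  have hcard : Multiset.card (eigenvalueMultiset G hGf) ≤
      Module.finrank ℂ (LinearMap.range ((F : X →L[ℂ] X) : X →ₗ[ℂ] X)) := by
    rw [card_eigenvalueMultiset]
    exact Submodule.finrank_mono hGr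
  have hB0 : 0 ≤ B := (norm_nonneg _).trans (hB ε (by simp [abs_of_pos hε]))
  have h4 := key 1
  rw [one_smul, one_smul, one_smul] at h4
  have h5 := (hexp 1 (by simp)).2
  rw [one_smul] at h5
  rw [h4, norm_mul, norm_mul]
  -- The factor det_p(I - wM), divided out at |t| = ε, returns at t = 1, so no lower bound for it is
  -- needed.
  calc ‖finDet G‖ * ‖regDet p I N (w • M)‖ * _
      ≤ ((ε⁻¹) ^ Multiset.card (eigenvalueMultiset G hGf) *
          (B * Real.exp c / ‖regDet p I N (w • M)‖)) * ‖regDet p I N (w • M)‖ * Real.exp c := by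
        gcongr
    _ = (ε⁻¹) ^ Multiset.card (eigenvalueMultiset G hGf) * (B * Real.exp (2 * c)) := by
        rw [two_mul, Real.exp_add]; field_simp
    _ ≤ _ := by
        gcongr
        exact (one_le_inv₀ hε).2 hε1

/-- The entire function `w ↦ det_p (I - w L)` is of minimal type with respect to the order `p`. -/
theorem IsLpIdeal.exists_norm_regDet_smul_le (h : IsLpIdeal p γ I N) (hp : 0 < p) {Γ : ℝ}
    (hΓ : IsDetConstant X p Γ) (L : I) {δ : ℝ} (hδ : 0 < δ) :
    ∃ c : ℝ, 0 < c ∧ ∀ w : ℂ, ‖regDet p I N (w • L)‖ ≤ Real.exp (c + δ * ‖w‖ ^ p) := by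
  obtain ⟨C, hC0, hC⟩ := h.exists_norm_regDet_le hp hΓ
  obtain ⟨q, hq1, hq⟩ := h.quasiNorm.quasi_triangle
  have hq0 : 0 < q := by linarith
  -- Solves C (2qε₁)^p ≤ δ/2. With N(M) < ε₁ and N(εF) ≤ ε₁ every M + tF with |t| = ε then has
  -- growth rate at most δ/2.
  set ε₁ : ℝ := (δ / (2 * (C + 1))) ^ (1 / p) / (2 * q) with hε₁
  have hε₁0 : 0 < ε₁ := by positivity
  have hCε : C * (q * (2 * ε₁)) ^ p ≤ δ / 2 := by
    have e1 : q * (2 * ε₁) = (δ / (2 * (C + 1))) ^ (1 / p) := by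
      rw [hε₁]; field_simp
    rw [e1, ← Real.rpow_mul (by positivity), one_div_mul_cancel hp.ne', Real.rpow_one,
      ← mul_div_assoc, div_le_div_iff₀ (by positivity) (by norm_num)]
    nlinarith
  obtain ⟨F, hF, hFN⟩ := h.finiteRank_dense L ε₁ hε₁0
  obtain ⟨M, hM⟩ : ∃ M, M = L - F := ⟨_, rfl⟩
  have hL : L = M + F := by rw [hM, sub_add_cancel]
  rw [← hM] at hFN
  have hNF := h.quasiNorm.nonneg F
  set ε : ℝ := min 1 (ε₁ / (N F + 1)) with hε
  have hε0 : 0 < ε := lt_min one_pos (by positivity)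
  have hεF : ε * N F ≤ ε₁ := by
    calc ε * N F ≤ ε₁ / (N F + 1) * (N F + 1) := by
          gcongr
          · exact min_le_right _ _
          · linarith
      _ = ε₁ := by field_simp
  set r := Module.finrank ℂ (LinearMap.range ((F : X →L[ℂ] X) : X →ₗ[ℂ] X)) with hr
  set n := ⌈p⌉₊ with hn
  have hn1 : 1 ≤ n := Nat.ceil_pos.2 hp
  have hnp' : ((n - 1 : ℕ) : ℝ) < p := by
    have := Nat.ceil_lt_add_one hp.le
    rw [Nat.cast_sub hn1, Nat.cast_one]
    linarith
  set a : ℝ := ‖(M : X →L[ℂ] X)‖ + ‖(F : X →L[ℂ] X)‖ with ha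
  have ha0 : 0 ≤ a := by positivity
  set c₁ : ℝ := ∑ k ∈ Finset.Icc 1 (n - 1), r * (2 * a ^ k) with hc₁
  have hc₁0 : 0 ≤ c₁ := Finset.sum_nonneg fun k _ => by positivity
  have htc : ∀ w t : ℂ, ‖t‖ ≤ 1 → ‖traceCorrection n
      (w • ((M : X →L[ℂ] X) + t • (F : X →L[ℂ] X))) (w • (M : X →L[ℂ] X))‖ ≤
      c₁ * (1 + ‖w‖ ^ (n - 1)) := by
    intro w t ht
    refine norm_traceCorrection_smul_le n ?_ ?_ ?_ w
    · rw [add_sub_cancel_left]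
      exact rank_smul_le' t hF.rank_eq.le
    · refine (norm_add_le _ _).trans ?_
      rw [norm_smul, ha]
      gcongr
      exact mul_le_of_le_one_left (norm_nonneg _) ht
    · rw [ha]
      linarith [norm_nonneg (F : X →L[ℂ] X)]
  -- The other half of δ absorbs the trace correction, whose degree n - 1 is less than p.
  obtain ⟨c₂, hc₂0, hc₂⟩ := exists_pow_le_add_mul_rpow hnp' (δ := δ / (2 * (2 * c₁ + 1)))
    (by positivity)
  have hεinv : 1 ≤ ε⁻¹ := (one_le_inv₀ hε0).2 (min_le_left _ _)
  have hlogε : 0 ≤ Real.log ε⁻¹ := Real.log_nonneg hεinv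
  have hgen : ∀ w : ℂ, regDet p I N (w • M) ≠ 0 → ‖regDet p I N (w • L)‖ ≤
      Real.exp ((r * Real.log ε⁻¹ + 2 * c₁ + 2 * c₁ * c₂ + 1) + δ * ‖w‖ ^ p) := by
    intro w hw
    rw [hL]
    refine (h.norm_regDet_smul_add_le hp hΓ hF hε0 (min_le_left _ _) hw
      (B := Real.exp (δ / 2 * ‖w‖ ^ p)) (fun t ht => (hC _).trans (Real.exp_le_exp.2 ?_))
      (htc w)).trans ?_
    · have h1 : N (w • (M + t • F)) ≤ ‖w‖ * (q * (2 * ε₁)) := by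
        rw [h.quasiNorm.smul]
        gcongr
        refine (hq _ _).trans ?_
        gcongr
        rw [h.quasiNorm.smul, ht]
        linarith
      calc C * N (w • (M + t • F)) ^ p ≤ C * (‖w‖ * (q * (2 * ε₁))) ^ p := by
            have := h.quasiNorm.nonneg (w • (M + t • F))
            gcongr
        _ = C * (q * (2 * ε₁)) ^ p * ‖w‖ ^ p := by
            rw [Real.mul_rpow (norm_nonneg w) (by positivity)]; ring
        _ ≤ δ / 2 * ‖w‖ ^ p := by gcongr
    · rw [← Real.exp_add]
      have e1 : (ε⁻¹) ^ r = Real.exp (r * Real.log ε⁻¹) := by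
        rw [Real.exp_nat_mul, Real.exp_log (by positivity)]
      rw [← hr, e1, ← Real.exp_add, Real.exp_le_exp]
      have h2 := mul_le_mul_of_nonneg_left (hc₂ ‖w‖ (norm_nonneg w)) (by positivity : 0 ≤ 2 * c₁)
      have h3 : 2 * c₁ * (δ / (2 * (2 * c₁ + 1)) * ‖w‖ ^ p) ≤ δ / 2 * ‖w‖ ^ p := by
        rw [← mul_assoc]
        gcongr
        rw [← mul_div_assoc, div_le_div_iff₀ (by positivity) (by norm_num)]
        nlinarith
      linarith
  refine ⟨r * Real.log ε⁻¹ + 2 * c₁ + 2 * c₁ * c₂ + 1, by positivity, fun w => ?_⟩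
  -- The zeros of w ↦ det_p(I - wM) were excluded so far. If the bound failed at w, it would fail on
  -- a neighbourhood, where that entire function would have to vanish identically.
  have hclosed : IsClosed {w : ℂ | ‖regDet p I N (w • L)‖ ≤
      Real.exp ((r * Real.log ε⁻¹ + 2 * c₁ + 2 * c₁ * c₂ + 1) + δ * ‖w‖ ^ p)} := by
    refine isClosed_le (h.differentiable_regDet_smul hp hΓ L).continuous.norm ?_
    refine Real.continuous_exp.comp (continuous_const.add (continuous_const.mul ?_))
    exact continuous_norm.rpow_const fun _ => Or.inr hp.le
  by_contra hcon
  refine analyticOrderAt_ne_top_of_entire (h.differentiable_regDet_smul hp hΓ M)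
    (by rw [zero_smul, h.regDet_zero hp hΓ]) w ?_
  rw [analyticOrderAt_eq_top]
  filter_upwards [hclosed.isOpen_compl.mem_nhds hcon] with v hv
  by_contra hv0
  exact hv (hgen v hv0)

/-- Since vL = L(v⁻¹ - 0)⁻¹, the function is the perturbation determinant for A = 0 composed with v
↦ v⁻¹, which has nonzero derivative and preserves orders. -/
theorem IsLpIdeal.analyticOrderAt_regDet_smul (h : IsLpIdeal p γ I N) (hp : 0 < p) {Γ : ℝ}
    (hΓ : IsDetConstant X p Γ) (L : I) {w : ℂ} (hw : w ≠ 0) {Q : X →L[ℂ] X}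
    (hQ : IsSpectralProjection (L : X →L[ℂ] X) w⁻¹ Q) (hQf : IsFiniteRank Q) :
    analyticOrderAt (fun v : ℂ => regDet p I N (v • L)) w =
      (Module.finrank ℂ (LinearMap.range (Q : X →ₗ[ℂ] X)) : ℕ∞) := by
  have hres : ∀ v : ℂ, v ≠ 0 → resolventProduct h 0 L v⁻¹ = v • L := by
    intro v hv
    refine Subtype.ext ?_
    change (L : X →L[ℂ] X) * resolvent (0 : X →L[ℂ] X) v⁻¹ = v • (L : X →L[ℂ] X)
    have h1 : resolvent (0 : X →L[ℂ] X) v⁻¹ = v • 1 := by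
      have h2 : (algebraMap ℂ (X →L[ℂ] X) v⁻¹ - 0) * (v • 1) = 1 := by
        rw [sub_zero, Algebra.algebraMap_eq_smul_one, smul_mul_smul_comm, inv_mul_cancel₀ hv,
          one_smul, one_mul]
      have h3 := Ring.inverse_mul_cancel _
        (spectrum.mem_resolventSet_iff.1 (mem_resolventSet_zero (X := X) (inv_ne_zero hv)))
      calc resolvent (0 : X →L[ℂ] X) v⁻¹ = resolvent (0 : X →L[ℂ] X) v⁻¹ *
            ((algebraMap ℂ (X →L[ℂ] X) v⁻¹ - 0) * (v • 1)) := by rw [h2, mul_one]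
        _ = v • 1 := by rw [← mul_assoc, resolvent, h3, one_mul]
    rw [h1, mul_smul_comm, mul_one]
  have hev : (fun v : ℂ => regDet p I N (v • L)) =ᶠ[𝓝 w] pertDet h 0 L ∘ fun v => v⁻¹ := by
    filter_upwards [isOpen_ne.mem_nhds hw] with v hv
    rw [Function.comp_apply, pertDet, hres v hv]
  have hinv : AnalyticAt ℂ (fun v : ℂ => v⁻¹) w := analyticAt_inv hw
  have hd : deriv (fun v : ℂ => v⁻¹) w ≠ 0 := by
    rw [(hasDerivAt_inv hw).deriv]
    exact neg_ne_zero.2 (inv_ne_zero (pow_ne_zero 2 hw))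
  rw [analyticOrderAt_congr hev, analyticOrderAt_comp_of_deriv_ne_zero hinv hd]
  exact h.analyticOrderAt_pertDet hp hΓ 0 L (mem_resolventSet_zero (inv_ne_zero hw))
    (by rwa [zero_add]) hQf

/-- Under a ↦ a⁻¹ the zeros become nonzero discrete eigenvalues and the orders become algebraic
multiplicities, so each finite sum is dominated by the eigenvalue sum. -/
theorem IsLpIdeal.sum_analyticOrderNatAt_le (h : IsLpIdeal p γ I N) (hp : 0 < p) {Γ : ℝ}
    (hΓ : IsDetConstant X p Γ) (L : I) (T : Finset ℂ) :
    ∑ a ∈ T, (analyticOrderNatAt (fun v : ℂ => regDet p I N (v • L)) a : ℝ) * ‖a‖ ^ (-p) ≤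
      (max γ 0 * N L) ^ p := by
  have hS : 0 ≤ (max γ 0 * N L) ^ p :=
    Real.rpow_nonneg (mul_nonneg (le_max_right _ _) (h.quasiNorm.nonneg L)) p
  rw [← ENNReal.ofReal_le_ofReal_iff hS, ENNReal.ofReal_sum_of_nonneg fun a _ => by positivity]
  refine le_trans ?_ (h.eigenvaluePowerSum_le hp L)
  rw [eigenvaluePowerSum, tsum_subtype (discreteSpectrum (L : X →L[ℂ] X))
    (fun z => (algMult (L : X →L[ℂ] X) z : ℝ≥0∞) * ENNReal.ofReal (‖z‖ ^ p)),
    ← (Equiv.inv ℂ).tsum_eq]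
  refine le_trans (Finset.sum_le_sum fun a _ => ?_) (ENNReal.sum_le_tsum T)
  rcases eq_or_ne a 0 with rfl | ha
  · have h0 : analyticOrderNatAt (fun v : ℂ => regDet p I N (v • L)) 0 = 0 := by
      rw [analyticOrderNatAt, ((h.differentiable_regDet_smul hp hΓ L).analyticAt
        0).analyticOrderAt_eq_zero.2 (by simp [h.regDet_zero hp hΓ])]
      rfl
    simp [h0]
  · obtain ⟨Q, hQ, hQf⟩ := h.exists_isSpectralProjection hp hΓ L (inv_ne_zero ha)
    have hord := h.analyticOrderAt_regDet_smul hp hΓ L ha hQ hQf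
    rw [analyticOrderNatAt, hord, ENat.toNat_natCast]
    by_cases hQ0 : Q = 0
    · have h0 : Module.finrank ℂ (LinearMap.range ((0 : X →L[ℂ] X) : X →ₗ[ℂ] X)) = 0 := by
        rw [ContinuousLinearMap.toLinearMap_zero, LinearMap.range_zero, finrank_bot]
      rw [hQ0, h0]
      simp
    · rw [Equiv.inv_apply, Set.indicator_of_mem (hQ.mem_discreteSpectrum hQf hQ0), hQ.algMult_eq,
        ENNReal.ofReal_mul (Nat.cast_nonneg _), ENNReal.ofReal_natCast, norm_inv,
        Real.rpow_neg (norm_nonneg a), Real.inv_rpow (norm_nonneg a)]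

theorem IsLpIdeal.norm_regDet_le_exp (h : IsLpIdeal p γ I N) (hp : 0 < p) {Γ : ℝ}
    (hΓ : IsDetConstant X p Γ) (L : I) : ‖regDet p I N L‖ ≤ Real.exp (γ ^ p * Γ * N L ^ p) := by
  rcases subsingleton_or_nontrivial X with hX | hX
  · have hL : L = 0 := Subtype.ext (Subsingleton.elim _ _)
    rw [hL, h.regDet_zero hp hΓ, (h.quasiNorm.eq_zero_iff 0).2 rfl, Real.zero_rpow hp.ne']
    simp
  -- A negative γ would make all eigenvalue sums vanish, contradicting a rank one operator with
  -- eigenvalue 1.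
  · have hγ : 0 ≤ γ := by
      by_contra hγ
      obtain ⟨F, hF, hm⟩ := exists_eigenvalueMultiset_eq (X := X) 1 one_ne_zero
      have h1 := h.eigenvaluePowerSum_le hp ⟨F, h.finiteRank_mem F hF⟩
      rw [max_eq_right (not_le.1 hγ).le, zero_mul, Real.zero_rpow hp.ne',
        ENNReal.ofReal_zero] at h1
      have h2 := toReal_eigenvaluePowerSum hF hp
      have h3 : eigenvaluePowerSum p F = 0 := le_antisymm h1 zero_le
      rw [h3, hm] at h2
      simp at h2
    have h1 := norm_le_exp_of_minimalType hp (h.differentiable_regDet_smul hp hΓ L)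
      (by rw [zero_smul, h.regDet_zero hp hΓ]) (h.isLittleO_regDet_smul_sub_one hp hΓ L)
      (fun δ hδ => h.exists_norm_regDet_smul_le hp hΓ L hδ) hΓ.1.le (hΓ.norm_primaryFactor_le hp)
      (h.sum_analyticOrderNatAt_le hp hΓ L)
    rw [one_smul, max_eq_left hγ, Real.mul_rpow hγ (h.quasiNorm.nonneg L)] at h1
    refine h1.trans_eq ?_
    congr 1
    ring

end DeterminantBound

end

end PertDet

theorem theorem4p9 (p : ℝ) (hp : 0 < p) :
    (∃ Γ : ℝ, ∀ (X : Type u) [NormedAddCommGroup X] [NormedSpace ℂ X] [CompleteSpace X],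
      PertDet.IsDetConstant X p Γ) ∧
    ∀ (X : Type u) [NormedAddCommGroup X] [NormedSpace ℂ X] [CompleteSpace X]
      (γ : ℝ) (I : Submodule ℂ (X →L[ℂ] X)) (N : I → ℝ) (h : PertDet.IsLpIdeal p γ I N)
      (A : X →L[ℂ] X) (K : I),
      (∃! d : I → ℂ, PertDet.IsRegDetExtension p I N d) ∧
      Tendsto (PertDet.pertDet h A K) (Bornology.cobounded ℂ) (𝓝 1) ∧
      AnalyticOnNhd ℂ (PertDet.pertDet h A K) (resolventSet ℂ A) ∧
      (∀ Γ : ℝ, PertDet.IsDetConstant X p Γ → ∀ z ∈ resolventSet ℂ A,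
        ‖PertDet.pertDet h A K z‖ ≤
          Real.exp (γ ^ p * Γ * N (PertDet.resolventProduct h A K z) ^ p)) ∧
      (∀ z ∈ resolventSet ℂ A,
        PertDet.pertDet h A K z = 0 ↔ z ∈ spectrum ℂ (A + (K : X →L[ℂ] X))) ∧
      (∀ z ∈ resolventSet ℂ A ∩ PertDet.discreteSpectrum (A + (K : X →L[ℂ] X)),
        analyticOrderAt (PertDet.pertDet h A K) z =
          (PertDet.algMult (A + (K : X →L[ℂ] X)) z : ℕ∞)) := by
  obtain ⟨Γ, hΓ0, hΓ⟩ := PertDet.exists_norm_primaryFactor_le hp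
  have hdet : ∀ (X : Type u) [NormedAddCommGroup X] [NormedSpace ℂ X] [CompleteSpace X],
      PertDet.IsDetConstant X p Γ := fun X _ _ _ =>
    PertDet.isDetConstant_of_primaryFactor_le hp hΓ0 hΓ
  refine ⟨⟨Γ, hdet⟩, fun X _ _ _ γ I N h A K => ?_⟩
  exact ⟨h.existsUnique_regDetExtension hp (hdet X), h.tendsto_pertDet hp (hdet X) A K,
    h.analyticOnNhd_pertDet hp (hdet X) A K,
    fun Γ' hΓ' z _ => h.norm_regDet_le_exp hp hΓ' _,
    fun z hz => h.pertDet_eq_zero_iff hp (hdet X) A K hz,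
    fun z hz => h.analyticOrderAt_pertDet hp (hdet X) A K hz.1
      (PertDet.isSpectralProjection_of_mem_discreteSpectrum hz.2) hz.2.2.2⟩
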